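/- **Conventions.** Let $\mathsf{Tid}$ be a finite linearly ordered set (threads) and $\mathsf{Id}$ a set (action identifiers). The *register object* has methods $\mathtt{read},\mathtt{write}$ and values $\mathbb{N}$. Its actions, forming the set $\mathsf{IR}$, are the invocations $\mathtt{inv}\langle m,a,p,k\rangle$ and responses $\mathtt{res}\langle m,a,p,k\rangle$ with $a\in\mathbb{N}\cup\{\bot\}$, $p\in\mathsf{Tid}$, $k\in\mathsf{Id}$. A *history* is a finite sequence of actions. It is *sequential* if it alternates between invocations and responses, starting with an invocation, each response has the same method, thread and action identifier as the invocation just before it, and no two operations have both the same thread and the same action identifier; it is *well-formed* if its restriction to every thread is sequential. $\mathsf{Spec}_{\mathsf{Reg}}$ is the set of sequential histories in which a read takes $\bot$ and returns the argument of the last preceding write ($0$ if there is none), and a write takes a number and returns $\bot$. An operation is a pending invocation, or an invocation with its response; $o_1<_h o_2$ means that the response of $o_1$ precedes the invocation of $o_2$ in $h$. We write $h\sqsubseteq s$ if responses to pending operations can be appended to $h$ so that the result is well-formed and, after removing the remaining pending invocations, gives a history $h'$ with the same operations as $s$ and ${<_{h'}}\subseteq{<_s}$. A *labeled transition system* (LTS)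 has states, an initial state, and labeled transitions; executions are finite and start in the initial state. A *register implementation* is an LTS with labels in $\mathsf{IR}\cup\{\mathsf{act}\langle p\rangle: p\in\mathsf{Tid}\}$ all of whose executions $e$ have a well-formed history $h(e)$ (the restriction of the trace of $e$ to $\mathsf{IR}$). We write $f[p\mapsto x]$ for function update. **The LTS $\mathtt{DR}$.** A state is $\langle v,\mathit{Ver},\ell,\mathit{ID},\mathit{PC},\mathit{VS},S,A\rangle$ with $v,\mathit{Ver}\in\mathbb{N}$, $\ell\in\{0,1\}$ and, for every thread, a sequence $\mathit{ID}(p)$ of identifiers, a location $\mathit{PC}(p)$, a set $\mathit{VS}(p)\subseteq\mathbb{N}$, and $S(p),A(p)\in\mathbb{N}$. Initially all numbers are $0$, sequences and sets are empty, locations are $\mathtt{main}$. The transitions are as follows (components not mentioned are unchanged; "$p$: $\mathtt x\to\mathtt y$" means that $\mathit{PC}(p)=\mathtt x$ becomes $\mathtt y$; the label is $\mathsf{act}\langle p\rangle$ unless given; "reset" means $\mathit{VS}(p):=\emptyset$, $S(p):=0$, $A(p):=0$). - label $\mathtt{inv}\langle\mathtt{read},\bot,p,k\rangle$, $k\notin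 \mathit{ID}(p)$, $p$: $\mathtt{main}\to\mathtt{r_b}$; append $k$ to $\mathit{ID}(p)$. - $p$: $\mathtt{r_b}\to\mathtt{r_l}$ if $\ell=0$; $\mathit{VS}(p):=\{v\}$, $S(p):=\mathit{Ver}$. - $p$: $\mathtt{r_l}\to\mathtt{r_l}$ if $v\notin \mathit{VS}(p)$ and $\mathit{Ver}\ge S(p)$; add $v$ to $\mathit{VS}(p)$. - $p$: $\mathtt{r_l}\to\mathtt{r_e}$; $A(p):=$ any element of $\mathit{VS}(p)$. - label $\mathtt{res}\langle\mathtt{read},A(p),p,k\rangle$, $k$ last in $\mathit{ID}(p)$, $p$: $\mathtt{r_e}\to\mathtt{main}$; reset. - label $\mathtt{inv}\langle\mathtt{write},n,p,k\rangle$, $k\notin \mathit{ID}(p)$, $p$: $\mathtt{main}\to\mathtt{w_b}$; append $k$ to $\mathit{ID}(p)$, $A(p):=n$. - $p$: $\mathtt{w_b}\to\mathtt{w_w}$ if $\ell=0$; $S(p):=\mathit{Ver}$. - $p$: $\mathtt{w_w}\to\mathtt{w_e}$ if $\ell=0$; $v:=A(p)$, $\mathit{Ver}:=\mathit{Ver}+1$.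 - $p$: $\mathtt{w_w}\to\mathtt{w_r}$ if $\ell=0$ and $\mathit{Ver}>S(p)$; simultaneously $v:=A(p)$, $A(p):=v$, $\mathit{Ver}:=\mathit{Ver}-1$, $\ell:=1$. - $p$: $\mathtt{w_r}\to\mathtt{w_e}$ if $\ell=1$; $v:=A(p)$, $\mathit{Ver}:=\mathit{Ver}+1$, $\ell:=0$. - label $\mathtt{res}\langle\mathtt{write},\bot,p,k\rangle$, $k$ last in $\mathit{ID}(p)$, $p$: $\mathtt{w_e}\to\mathtt{main}$; reset. **The LTS $\mathtt{ABD}$ (multi-writer).** Timestamps are pairs in $\mathbb{N}\times(\mathsf{Tid}\cup\{\bot\})$, ordered lexicographically, $\bot$ being smaller than all threads; timestamped values $\langle v,ts\rangle$ are compared by their timestamps. Messages are $\mathtt{query}(p,k)$ and $\mathtt{update}(p,k,\langle v,ts\rangle)$; replies are pairs $\langle p,\langle v,ts\rangle\rangle$ (to a query) and threads $p$ (to an update). A state is $\langle M,\mathit{ID},T,\mathit{PC},A\rangle$ with a partial map $M$ from messages to sets of replies and, for every thread, a sequence $\mathit{ID}(p)$, a timestamped value $T(p)$, a location $\mathit{PC}(p)$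 and $A(p)\in\mathbb{N}$. Initially $M$ and all $\mathit{ID}(p)$ are empty, $T(p)=\langle 0,\langle 0,\bot\rangle\rangle$, $\mathit{PC}(p)=\mathtt{main}$, $A(p)=0$. A *quorum* is a set with more than $|\mathsf{Tid}|/2$ elements. With the same conventions as above, and $k$ denoting the last element of $\mathit{ID}(p)$ in all rules except the invocations and the server rules, the transitions are: - label $\mathtt{inv}\langle\mathtt{read},\bot,p,k\rangle$, $k\notin \mathit{ID}(p)$, $p$: $\mathtt{main}\to\mathtt{r_b}$; append $k$ to $\mathit{ID}(p)$. - $p$: $\mathtt{r_b}\to\mathtt{r_q}$; $M(\mathtt{query}(p,k)):=\emptyset$. - $p$: $\mathtt{r_q}\to\mathtt{r_u}$; for some quorum $Q$ of threads that have replied to $\mathtt{query}(p,k)$, with $\langle v_m,ts_m\rangle$ the maximal timestamped value among the replies of $Q$, $M(\mathtt{update}(p,k,\langle v_m,ts_m\rangle)):=\emptyset$ and $A(p):=v_m$. - $p$: $\mathtt{r_u}\to\mathtt{r_e}$ if $M(\mathtt{update}(p,k,x))$ is a quorum for some $x$. - label $\mathtt{res}\langle\mathtt{read},A(p),p,k\rangle$,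 $p$: $\mathtt{r_e}\to\mathtt{main}$; $A(p):=0$. - label $\mathtt{inv}\langle\mathtt{write},n,p,k\rangle$, $k\notin \mathit{ID}(p)$, $p$: $\mathtt{main}\to\mathtt{w_b}$; append $k$ to $\mathit{ID}(p)$, $A(p):=n$. - $p$: $\mathtt{w_b}\to\mathtt{w_q}$; $M(\mathtt{query}(p,k)):=\emptyset$. - $p$: $\mathtt{w_q}\to\mathtt{w_u}$; for some quorum $Q$ of threads that have replied to $\mathtt{query}(p,k)$, with $\langle t,\_\rangle$ the maximal timestamp among the replies of $Q$, $M(\mathtt{update}(p,k,\langle A(p),\langle t+1,p\rangle\rangle)):=\emptyset$. - $p$: $\mathtt{w_u}\to\mathtt{w_e}$ if $M(\mathtt{update}(p,k,x))$ is a quorum for some $x$. - label $\mathtt{res}\langle\mathtt{write},\bot,p,k\rangle$, $p$: $\mathtt{w_e}\to\mathtt{main}$; $A(p):=0$. - server $p$, label $\mathsf{act}\langle p\rangle$: if $m=\mathtt{query}(\_,\_)\in\mathrm{dom}(M)$ has no reply from $p$ yet, add $\langle p,T(p)\rangle$ to $M(m)$. - server $p$, label $\mathsf{act}\langle p\rangle$: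 if $m=\mathtt{update}(\_,\_,x)\in\mathrm{dom}(M)$ and $p\notin M(m)$, add $p$ to $M(m)$ and set $T(p):=\max\{T(p),x\}$. **Theorem.** $\mathtt{ABD}$ and $\mathtt{DR}$ are register implementations, and: 1. $\mathtt{ABD}\le\mathtt{DR}$: there is a forward simulation $R$ from $\mathtt{ABD}$ to $\mathtt{DR}$, that is, $R$ relates the initial states and, whenever $q\xrightarrow{\sigma}q'$ in $\mathtt{ABD}$ and $(q,r)\in R$, there are a state $r'$ and a sequence $\rho$ of labels with $r\xrightarrow{\rho}{}^{*}r'$ in $\mathtt{DR}$, $\rho|_{\mathsf{IR}}=\sigma|_{\mathsf{IR}}$ and $(q',r')\in R$. 2. $\mathtt{ABD}$ is *decisively linearizable*: there is a map $L$ from its executions to $\mathsf{Spec}_{\mathsf{Reg}}$ such that $h(e)\sqsubseteq L(e)$ for every execution $e$, and $L(e_1)$ is a subsequence of $L(e_2)$ whenever $e_1$ is a prefix of $e_2$. 3. $\mathtt{DR}$ is a hyperproperty-preserving specification of $\mathtt{ABD}$, that is, $\mathtt{ABD}$ *strongly observationally refines* $\mathtt{DR}$: for every client program $P$ (an LTS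 with labels in $\mathsf{IR}\cup\mathsf{PInt}$ for a set $\mathsf{PInt}$ of client internal actions) and every deterministic scheduler $S$ of $P[\mathtt{ABD}]$ there is a deterministic scheduler $S'$ of $P[\mathtt{DR}]$ such that the traces of the executions of $P[\mathtt{ABD}]$ consistent with $S$ and those of the executions of $P[\mathtt{DR}]$ consistent with $S'$ have the same set of restrictions to $\mathsf{IR}\cup\mathsf{PInt}$. Here $P[I]$ is the parallel composition of $P$ and $I$ synchronizing exactly on $\mathsf{IR}$; a scheduler maps every execution to a set of transitions; it is deterministic if any two distinct transitions in such a set are both labeled in $\mathsf{PInt}$; and an execution is consistent with it if each of its transitions belongs to the set assigned to the part of the execution before that transition. -/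

import Mathlib

universe u v w x y

namespace RegSpec

/-! ## Labeled transition systems -/

/-- A labeled transition system over the alphabet `Λ`. -/
structure LTS (Λ : Type u) where
  State : Type v
  init : State
  Tr : State → Λ → State → Prop

namespace LTS

variable {Λ : Type u}

/-- The transitions of `A` (triples of source state, label and target state). -/
structure Transition (A : LTS.{u, v} Λ) where
  pre : A.State
  label : Λ
  post : A.State
  valid : A.Tr pre label post

/-- The sequence of transitions starts in `q` and every other transition continues from the target
of the previous one. -/
def IsPathFrom (A : LTS.{u, v} Λ) : A.State → List A.Transition → Prop
  | _, [] => True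
  | q, t :: e => t.pre = q ∧ A.IsPathFrom t.post e

/-- Finite executions. -/
def Execution (A : LTS.{u, v} Λ) : Type (max u v) :=
  {e : List A.Transition // A.IsPathFrom A.init e}

/-- The trace induced by an execution. -/
def Execution.trace {A : LTS.{u, v} Λ} (e : A.Execution) : List Λ :=
  e.1.map Transition.label

/-- `A.Steps q ρ q'`: the sequence of labels `ρ` leads from `q` to `q'`. -/
inductive Steps (A : LTS.{u, v} Λ) : A.State → List Λ → A.State → Prop
  | nil (q : A.State) : Steps A q [] q
  | cons {q q₁ q' : A.State} {a : Λ} {ρ : List Λ} :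
      A.Tr q a q₁ → Steps A q₁ ρ q' → Steps A q (a :: ρ) q'

end LTS

open Classical in
/-- The restriction `s|_Γ` of a sequence to the symbols in `Γ`. -/
noncomputable def restrict {α : Type u} (s : List α) (Γ : Set α) : List α :=
  s.filter (fun a => a ∈ Γ)

/-- `R` is a `Γ`-forward simulation from `A` to `B`. -/
def IsForwardSimulation {Λ : Type u} (A : LTS.{u, v} Λ) (B : LTS.{u, w} Λ) (Γ : Set Λ)
    (R : A.State → B.State → Prop) : Prop :=
  R A.init B.init ∧
  ∀ q a q' b, A.Tr q a q' → R q b →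
    ∃ b' ρ, B.Steps b ρ b' ∧ restrict ρ Γ = restrict [a] Γ ∧ R q' b'

/-- `A ≤_Γ B`: there is a `Γ`-forward simulation from `A` to `B`. -/
def Simulates {Λ : Type u} (A : LTS.{u, v} Λ) (B : LTS.{u, w} Λ) (Γ : Set Λ) : Prop :=
  ∃ R : A.State → B.State → Prop, IsForwardSimulation A B Γ R

/-! ## Objects and histories -/

/-- Invocations `inv⟨m, v, p, k⟩` and responses `res⟨m, v, p, k⟩` of an object with method names `M`
and values `V`; `p` is a thread identifier, `k` an action identifier, and `none` is `⊥`. -/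
inductive Action (M : Type u) (V : Type v) (Tid : Type w) (Id : Type x)
  | inv (m : M) (val : Option V) (p : Tid) (k : Id)
  | res (m : M) (val : Option V) (p : Tid) (k : Id)

namespace Action

variable {M : Type u} {V : Type v} {Tid : Type w} {Id : Type x}

def isInv : Action M V Tid Id → Bool
  | inv .. => true
  | res .. => false

def isRes : Action M V Tid Id → Bool
  | inv .. => false
  | res .. => true

def method : Action M V Tid Id → M
  | inv m _ _ _ => m
  | res m _ _ _ => m

def thread : Action M V Tid Id → Tid
  | inv _ _ p _ => p
  | res _ _ p _ => p

/-- The thread identifier and the action identifier; together they identify an operation. -/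
def key : Action M V Tid Id → Tid × Id
  | inv _ _ p k => (p, k)
  | res _ _ p k => (p, k)

end Action

section Histories

variable {M : Type u} {V : Type v} {Tid : Type w} {Id : Type x}

/-- The sequence alternates between invocations and responses, starting with an invocation, and each
invocation agrees with the response after it on the method, thread and action identifiers. -/
def Alternates : List (Action M V Tid Id) → Prop
  | [] => True
  | [a] => a.isInv = true
  | a :: b :: h =>
      a.isInv = true ∧ b.isRes = true ∧ a.method = b.method ∧ a.key = b.key ∧ Alternates h

/-- Sequential histories; no two operations have both the same thread and the same action
identifier. -/
def IsSequential (h : List (Action M V Tid Id)) : Prop :=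
  Alternates h ∧ ((h.filter Action.isInv).map Action.key).Nodup

/-- A history is well-formed if its restriction to each thread is sequential. -/
def WellFormed (h : List (Action M V Tid Id)) : Prop :=
  ∀ p : Tid, IsSequential (restrict h {a | a.thread = p})

/-- Some response in `h` has the same thread and action identifiers as `a`. -/
def Responded (h : List (Action M V Tid Id)) (a : Action M V Tid Id) : Prop :=
  ∃ r ∈ h, r.isRes = true ∧ r.key = a.key

/-- The subsequence of the actions that are part of completed operations. -/
noncomputable def completed (h : List (Action M V Tid Id)) : List (Action M V Tid Id) :=
  restrict h {a | Responded h a}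

/-- The operations of `h`: pairs `(i, some r)` of an invocation and its response, and
`(i, none)` for a pending invocation `i`. -/
def operations (h : List (Action M V Tid Id)) :
    Set (Action M V Tid Id × Option (Action M V Tid Id)) :=
  {o | o.1 ∈ h ∧ o.1.isInv = true ∧
    ((∃ r ∈ h, r.isRes = true ∧ r.key = o.1.key ∧ o.2 = some r) ∨
      (¬ Responded h o.1 ∧ o.2 = none))}

/-- The real-time order `o₁ <_h o₂`: the response of `o₁` appears in `h` before the invocation
of `o₂`. -/
def RealTime (h : List (Action M V Tid Id))
    (o₁ o₂ : Action M V Tid Id × Option (Action M V Tid Id)) : Prop :=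
  o₁ ∈ operations h ∧ o₂ ∈ operations h ∧
    ∃ r, o₁.2 = some r ∧ List.Sublist [r, o₂.1] h

/-- `h ⊑ s`: some of the pending operations of `h` can be completed by appending responses so that,
after the remaining pending invocations are removed, the resulting history has the same operations
as `s` and its real-time order is preserved in `s`. -/
def LinearizesTo (h s : List (Action M V Tid Id)) : Prop :=
  ∃ rs : List (Action M V Tid Id),
    (∀ r ∈ rs, r.isRes = true) ∧ WellFormed (h ++ rs) ∧
    operations (completed (h ++ rs)) = operations s ∧
    ∀ o₁ o₂, RealTime (completed (h ++ rs)) o₁ o₂ → RealTime s o₁ o₂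

end Histories

/-- A specification of an object: a prefix-closed set of sequential histories. -/
structure Specification (M : Type u) (V : Type v) (Tid : Type w) (Id : Type x) where
  histories : Set (List (Action M V Tid Id))
  sequential : ∀ h ∈ histories, IsSequential h
  prefix_closed : ∀ h ∈ histories, ∀ h', h' <+: h → h' ∈ histories

/-! ## Implementations and linearizability -/

/-- LTSs over the alphabet `IR(O) ∪ IInt`. -/
abbrev ObjLTS (M : Type u) (V : Type v) (Tid : Type w) (Id : Type x) (IInt : Type y) :=
  LTS (Action M V Tid Id ⊕ IInt)

section Implementations

variable {M : Type*} {V : Type*} {Tid : Type*} {Id : Type*} {IInt : Type*}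

/-- The labels that are invocations or responses. -/
def IR : Set (Action M V Tid Id ⊕ IInt) := Set.range Sum.inl

/-- The history induced by an execution. -/
def history {I : ObjLTS M V Tid Id IInt} (e : I.Execution) : List (Action M V Tid Id) :=
  e.trace.filterMap Sum.getLeft?

/-- Every execution of `I` induces a well-formed history. -/
def IsImplementation (I : ObjLTS M V Tid Id IInt) : Prop :=
  ∀ e : I.Execution, WellFormed (history e)

/-- `L` assigns to every execution a linearization of its history that belongs to `Spec`. -/
def IsLinearizationMapping (I : ObjLTS M V Tid Id IInt) (Spec : Specification M V Tid Id)
    (L : I.Execution → List (Action M V Tid Id)) : Prop :=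
  ∀ e, L e ∈ Spec.histories ∧ LinearizesTo (history e) (L e)

/-- Decisive linearizability: the linearization of an execution is a subsequence of the linearization
of each of its extensions. -/
def DecisivelyLinearizable (I : ObjLTS M V Tid Id IInt) (Spec : Specification M V Tid Id) : Prop :=
  ∃ L : I.Execution → List (Action M V Tid Id),
    IsLinearizationMapping I Spec L ∧
    ∀ e₁ e₂ : I.Execution, e₁.1 <+: e₂.1 → List.Sublist (L e₁) (L e₂)

end Implementations

/-! ## Client programs, schedulers and strong observational refinement -/

section Clients

variable {M : Type*} {V : Type*} {Tid : Type*} {Id : Type*} {IInt : Type*} {PInt : Type*}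

/-- The transitions of `P[I]`: `P` and `I` synchronize on invocations and responses and interleave
their internal steps. -/
inductive LinkStep (P : LTS (Action M V Tid Id ⊕ PInt)) (I : ObjLTS M V Tid Id IInt) :
    I.State × P.State → Action M V Tid Id ⊕ (IInt ⊕ PInt) → I.State × P.State → Prop
  | sync {a q q' s s'} : I.Tr q (Sum.inl a) q' → P.Tr s (Sum.inl a) s' →
      LinkStep P I (q, s) (Sum.inl a) (q', s')
  | impl {i q q' s} : I.Tr q (Sum.inr i) q' →
      LinkStep P I (q, s) (Sum.inr (Sum.inl i)) (q', s)
  | prog {c q s s'} : P.Tr s (Sum.inr c) s' →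
      LinkStep P I (q, s) (Sum.inr (Sum.inr c)) (q, s')

/-- The interface parallel composition `P[I]` of a client program `P`, which is an LTS over the
alphabet `IR(O) ∪ PInt`, and an implementation `I`. -/
def link (P : LTS (Action M V Tid Id ⊕ PInt)) (I : ObjLTS M V Tid Id IInt) :
    LTS (Action M V Tid Id ⊕ (IInt ⊕ PInt)) where
  State := I.State × P.State
  init := (I.init, P.init)
  Tr := LinkStep P I

/-- The restriction of a trace of `P[I]` to the alphabet of `P`. -/
def clientTrace (ρ : List (Action M V Tid Id ⊕ (IInt ⊕ PInt))) :
    List (Action M V Tid Id ⊕ PInt) :=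
  ρ.filterMap fun
    | Sum.inl a => some (Sum.inl a)
    | Sum.inr (Sum.inl _) => none
    | Sum.inr (Sum.inr c) => some (Sum.inr c)

/-- A label is a client internal action. -/
def IsClientInternal : Action M V Tid Id ⊕ (IInt ⊕ PInt) → Prop
  | Sum.inr (Sum.inr _) => True
  | _ => False

end Clients

/-- A scheduler maps each execution to the set of transitions that may be taken next. -/
def Scheduler {Λ : Type u} (A : LTS.{u, v} Λ) : Type (max u v) :=
  A.Execution → Set A.Transition

/-- The execution `e` is consistent with the scheduler `S`. -/
def Scheduler.Consistent {Λ : Type u} {A : LTS.{u, v} Λ} (S : Scheduler A) (e : A.Execution) :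
    Prop :=
  ∀ (e' : A.Execution) (t : A.Transition), (e'.1 ++ [t]) <+: e.1 → t ∈ S e'

section Refinement

variable {M : Type*} {V : Type*} {Tid : Type*} {Id : Type*} {IInt : Type*}

/-- A scheduler of `P[I]` is deterministic if it leaves no choice other than among client internal
transitions. -/
def Scheduler.Deterministic {PInt : Type*} {P : LTS (Action M V Tid Id ⊕ PInt)}
    {I : ObjLTS M V Tid Id IInt} (S : Scheduler (link P I)) : Prop :=
  ∀ e, ∀ t₁ ∈ S e, ∀ t₂ ∈ S e,
    t₁ = t₂ ∨ (IsClientInternal t₁.label ∧ IsClientInternal t₂.label)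

/-- The set of client-visible traces that `P[I]` generates under the scheduler `S`. -/
def clientTraces {PInt : Type*} {P : LTS (Action M V Tid Id ⊕ PInt)}
    {I : ObjLTS M V Tid Id IInt} (S : Scheduler (link P I)) : Set (List (Action M V Tid Id ⊕ PInt)) :=
  {τ | ∃ e : (link P I).Execution, S.Consistent e ∧ clientTrace e.trace = τ}

/-- Strong observational refinement `I ≤ₛ J` (preservation of hyperproperties): for every client
program, every set of client traces that a deterministic scheduler can generate with `I` can also
be generated by a deterministic scheduler with `J`. Client programs range over all types of internal
labels in `Type u` and all types of states in `Type v`. -/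
def StronglyRefines (I J : ObjLTS M V Tid Id IInt) : Prop :=
  ∀ (PInt : Type u) (P : LTS.{_, v} (Action M V Tid Id ⊕ PInt)) (S : Scheduler (link P I)),
    S.Deterministic →
      ∃ S' : Scheduler (link P J), S'.Deterministic ∧ clientTraces S = clientTraces S'

end Refinement

/-! ## Registers -/

inductive RegMethod
  | read
  | write

/-- Invocations and responses of the register object, whose values are natural numbers. -/
abbrev RegAction (Tid : Type u) (Id : Type v) := Action RegMethod ℕ Tid Id

/-- Labels of the register implementations below; `Sum.inr p` is the internal action `act⟨p⟩` of
the thread `p`. -/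
abbrev RegLabel (Tid : Type u) (Id : Type v) := RegAction Tid Id ⊕ Tid

section Spec

variable {Tid : Type u} {Id : Type v}

/-- The values in a sequential history agree with a register that currently stores `x`. (Applied to
sequential histories only, where no read occurs between the invocation and the response of a
write.) -/
def RegLegal : ℕ → List (RegAction Tid Id) → Prop
  | _, [] => True
  | x, .inv .read a _ _ :: h => a = none ∧ RegLegal x h
  | x, .res .read a _ _ :: h => a = some x ∧ RegLegal x h
  | _, .inv .write a _ _ :: h => ∃ n, a = some n ∧ RegLegal n h
  | x, .res .write a _ _ :: h => a = none ∧ RegLegal x h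

theorem RegLegal.of_append {h₂ : List (RegAction Tid Id)} :
    ∀ (h₁ : List (RegAction Tid Id)) (x : ℕ), RegLegal x (h₁ ++ h₂) → RegLegal x h₁
  | [], _, _ => trivial
  | .inv .read _ _ _ :: h, x, hl => ⟨hl.1, of_append h x hl.2⟩
  | .res .read _ _ _ :: h, x, hl => ⟨hl.1, of_append h x hl.2⟩
  | .inv .write _ _ _ :: h, _, ⟨n, hn, hl⟩ => ⟨n, hn, of_append h n hl⟩
  | .res .write _ _ _ :: h, x, hl => ⟨hl.1, of_append h x hl.2⟩

theorem Alternates.of_append {M : Type*} {V : Type*} {h₂ : List (Action M V Tid Id)} :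
    ∀ h₁ : List (Action M V Tid Id), Alternates (h₁ ++ h₂) → Alternates h₁
  | [], _ => trivial
  | [a], hl => by
      cases h₂ with
      | nil => exact hl
      | cons b t => exact hl.1
  | _ :: _ :: h, hl => ⟨hl.1, hl.2.1, hl.2.2.1, hl.2.2.2.1, of_append h hl.2.2.2.2⟩

/-- The sequential specification of a register with initial value `0`. -/
def regSpec (Tid : Type u) (Id : Type v) : Specification RegMethod ℕ Tid Id where
  histories := {h | IsSequential h ∧ RegLegal 0 h}
  sequential := fun _ hh => hh.1
  prefix_closed := by
    rintro _ ⟨⟨ha, hn⟩, hl⟩ h' ⟨t, rfl⟩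
    refine ⟨⟨Alternates.of_append h' ha, ?_⟩, RegLegal.of_append h' 0 hl⟩
    rw [List.filter_append, List.map_append] at hn
    exact hn.of_append_left

end Spec

/-! ## The register `DR` -/

/-- Program locations of `DR`. -/
inductive DRPc
  | main | wb | ww | wr | we | rb | rl | re

structure DRState (Tid : Type u) (Id : Type v) where
  /-- the current value of the register -/
  val : ℕ
  /-- the current version number -/
  ver : ℕ
  /-- the lock flag -/
  lock : Bool
  /-- the action identifiers used by each thread, the latest one last -/
  ids : Tid → List Id
  pc : Tid → DRPc
  /-- the set of values that the current read has collected -/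
  vs : Tid → Set ℕ
  /-- the version number read when the current method started -/
  start : Tid → ℕ
  /-- the input or output argument of the current method (also a temporary value) -/
  arg : Tid → ℕ

section DR

variable {Tid : Type u} {Id : Type v} [DecidableEq Tid]

open Function in
inductive DRStep : DRState Tid Id → RegLabel Tid Id → DRState Tid Id → Prop
  | readInv (q : DRState Tid Id) (p : Tid) (k : Id)
      (hpc : q.pc p = .main) (hk : k ∉ q.ids p) :
      DRStep q (.inl (.inv .read none p k))
        { q with ids := update q.ids p (q.ids p ++ [k]), pc := update q.pc p .rb }
  | readInit (q : DRState Tid Id) (p : Tid)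
      (hpc : q.pc p = .rb) (hl : q.lock = false) :
      DRStep q (.inr p)
        { q with pc := update q.pc p .rl, vs := update q.vs p {q.val},
                 start := update q.start p q.ver }
  | readLoop (q : DRState Tid Id) (p : Tid)
      (hpc : q.pc p = .rl) (hv : q.val ∉ q.vs p) (hver : q.start p ≤ q.ver) :
      DRStep q (.inr p) { q with vs := update q.vs p (q.vs p ∪ {q.val}) }
  | readPick (q : DRState Tid Id) (p : Tid) (out : ℕ)
      (hpc : q.pc p = .rl) (hv : out ∈ q.vs p) :
      DRStep q (.inr p) { q with pc := update q.pc p .re, arg := update q.arg p out }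
  | readRes (q : DRState Tid Id) (p : Tid) (k : Id)
      (hpc : q.pc p = .re) (hk : (q.ids p).getLast? = some k) :
      DRStep q (.inl (.res .read (some (q.arg p)) p k))
        { q with pc := update q.pc p .main, vs := update q.vs p ∅,
                 start := update q.start p 0, arg := update q.arg p 0 }
  | writeInv (q : DRState Tid Id) (p : Tid) (k : Id) (inp : ℕ)
      (hpc : q.pc p = .main) (hk : k ∉ q.ids p) :
      DRStep q (.inl (.inv .write (some inp) p k))
        { q with ids := update q.ids p (q.ids p ++ [k]), pc := update q.pc p .wb,
                 arg := update q.arg p inp }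
  | writeInit (q : DRState Tid Id) (p : Tid)
      (hpc : q.pc p = .wb) (hl : q.lock = false) :
      DRStep q (.inr p)
        { q with pc := update q.pc p .ww, start := update q.start p q.ver }
  | writeTop (q : DRState Tid Id) (p : Tid)
      (hpc : q.pc p = .ww) (hl : q.lock = false) :
      DRStep q (.inr p)
        { q with val := q.arg p, ver := q.ver + 1, pc := update q.pc p .we }
  | writeRollBack (q : DRState Tid Id) (p : Tid)
      (hpc : q.pc p = .ww) (hver : q.start p < q.ver) (hl : q.lock = false) :
      DRStep q (.inr p)
        { q with val := q.arg p, ver := q.ver - 1, lock := true, pc := update q.pc p .wr,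
                 arg := update q.arg p q.val }
  | writeRollForward (q : DRState Tid Id) (p : Tid)
      (hpc : q.pc p = .wr) (hl : q.lock = true) :
      DRStep q (.inr p)
        { q with val := q.arg p, ver := q.ver + 1, lock := false, pc := update q.pc p .we }
  | writeRes (q : DRState Tid Id) (p : Tid) (k : Id)
      (hpc : q.pc p = .we) (hk : (q.ids p).getLast? = some k) :
      DRStep q (.inl (.res .write none p k))
        { q with pc := update q.pc p .main, vs := update q.vs p ∅,
                 start := update q.start p 0, arg := update q.arg p 0 }

end DR

def DR (Tid : Type u) (Id : Type v) [DecidableEq Tid] : ObjLTS RegMethod ℕ Tid Id Tid where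
  State := DRState Tid Id
  init :=
    { val := 0, ver := 0, lock := false, ids := fun _ => [], pc := fun _ => .main,
      vs := fun _ => ∅, start := fun _ => 0, arg := fun _ => 0 }
  Tr := DRStep

/-! ## Multi-writer `ABD` -/

/-- Timestamps, ordered lexicographically; `⊥` is smaller than every thread identifier. -/
abbrev TS (Tid : Type u) := ℕ ×ₗ WithBot Tid

/-- Broadcast messages, tagged with the thread and action identifiers of the operation that sent
them. -/
inductive Msg (Tid : Type u) (Id : Type v)
  | query (p : Tid) (k : Id)
  | update (p : Tid) (k : Id) (vt : ℕ × TS Tid)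

/-- Replies: to a query, the timestamped value of the replying thread; to an update, an
acknowledgment. -/
inductive Ack (Tid : Type u)
  | reply (p : Tid) (vt : ℕ × TS Tid)
  | ack (p : Tid)

/-- Program locations of `ABD`. -/
inductive ABDPc
  | main | wb | wq | wu | we | rb | rq | ru | re

structure ABDState (Tid : Type u) (Id : Type v) where
  /-- the partial mapping from broadcast messages to the replies they received -/
  msgs : Msg Tid Id → Option (Set (Ack Tid))
  /-- the action identifiers used by each thread, the latest one last -/
  ids : Tid → List Id
  /-- the most recent timestamped value known to each thread -/
  tval : Tid → ℕ × TS Tid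
  pc : Tid → ABDPc
  /-- the input or output argument of the current method -/
  arg : Tid → ℕ

/-- The set `X` has more than `|Tid| / 2` elements. -/
def Quorum (Tid : Type u) [Fintype Tid] {α : Type v} (X : Set α) : Prop :=
  (Fintype.card Tid : ℕ∞) < 2 * X.encard

/-- The timestamped values that the threads in `Q` reported in the set `X` of replies. -/
def replies {Tid : Type u} (X : Set (Ack Tid)) (Q : Set Tid) : Set (ℕ × TS Tid) :=
  {vt | ∃ p ∈ Q, Ack.reply p vt ∈ X}

section ABD

variable {Tid : Type u} {Id : Type v} [Fintype Tid] [LinearOrder Tid]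

open Function Classical in
inductive ABDStep : ABDState Tid Id → RegLabel Tid Id → ABDState Tid Id → Prop
  | readInv (q : ABDState Tid Id) (p : Tid) (k : Id)
      (hpc : q.pc p = .main) (hk : k ∉ q.ids p) :
      ABDStep q (.inl (.inv .read none p k))
        { q with ids := update q.ids p (q.ids p ++ [k]), pc := update q.pc p .rb }
  | readQuery (q : ABDState Tid Id) (p : Tid) (k : Id)
      (hpc : q.pc p = .rb) (hk : (q.ids p).getLast? = some k) :
      ABDStep q (.inr p)
        { q with msgs := update q.msgs (.query p k) (some ∅), pc := update q.pc p .rq }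
  | readUpdate (q : ABDState Tid Id) (p : Tid) (k : Id) (X : Set (Ack Tid)) (Q : Set Tid)
      (vt : ℕ × TS Tid)
      (hpc : q.pc p = .rq) (hk : (q.ids p).getLast? = some k)
      (hX : q.msgs (.query p k) = some X)
      (hQ : Q ⊆ {p' | ∃ vt', Ack.reply p' vt' ∈ X}) (hcard : Quorum Tid Q)
      (hmem : vt ∈ replies X Q) (hmax : ∀ vt' ∈ replies X Q, vt'.2 ≤ vt.2) :
      ABDStep q (.inr p)
        { q with msgs := update q.msgs (.update p k vt) (some ∅), pc := update q.pc p .ru,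
                 arg := update q.arg p vt.1 }
  | readEnd (q : ABDState Tid Id) (p : Tid) (k : Id) (vt : ℕ × TS Tid) (X : Set (Ack Tid))
      (hpc : q.pc p = .ru) (hk : (q.ids p).getLast? = some k)
      (hX : q.msgs (.update p k vt) = some X) (hcard : Quorum Tid X) :
      ABDStep q (.inr p) { q with pc := update q.pc p .re }
  | readRes (q : ABDState Tid Id) (p : Tid) (k : Id)
      (hpc : q.pc p = .re) (hk : (q.ids p).getLast? = some k) :
      ABDStep q (.inl (.res .read (some (q.arg p)) p k))
        { q with pc := update q.pc p .main, arg := update q.arg p 0 }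
  | writeInv (q : ABDState Tid Id) (p : Tid) (k : Id) (inp : ℕ)
      (hpc : q.pc p = .main) (hk : k ∉ q.ids p) :
      ABDStep q (.inl (.inv .write (some inp) p k))
        { q with ids := update q.ids p (q.ids p ++ [k]), pc := update q.pc p .wb,
                 arg := update q.arg p inp }
  | writeQuery (q : ABDState Tid Id) (p : Tid) (k : Id)
      (hpc : q.pc p = .wb) (hk : (q.ids p).getLast? = some k) :
      ABDStep q (.inr p)
        { q with msgs := update q.msgs (.query p k) (some ∅), pc := update q.pc p .wq }
  | writeUpdate (q : ABDState Tid Id) (p : Tid) (k : Id) (X : Set (Ack Tid)) (Q : Set Tid)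
      (t : ℕ) (b : WithBot Tid)
      (hpc : q.pc p = .wq) (hk : (q.ids p).getLast? = some k)
      (hX : q.msgs (.query p k) = some X)
      (hQ : Q ⊆ {p' | ∃ vt', Ack.reply p' vt' ∈ X}) (hcard : Quorum Tid Q)
      (hmax : IsGreatest (Prod.snd '' replies X Q) (toLex (t, b))) :
      ABDStep q (.inr p)
        { q with msgs := update q.msgs
                   (.update p k (q.arg p, toLex (t + 1, (p : WithBot Tid)))) (some ∅),
                 pc := update q.pc p .wu }
  | writeEnd (q : ABDState Tid Id) (p : Tid) (k : Id) (vt : ℕ × TS Tid) (X : Set (Ack Tid))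
      (hpc : q.pc p = .wu) (hk : (q.ids p).getLast? = some k)
      (hX : q.msgs (.update p k vt) = some X) (hcard : Quorum Tid X) :
      ABDStep q (.inr p) { q with pc := update q.pc p .we }
  | writeRes (q : ABDState Tid Id) (p : Tid) (k : Id)
      (hpc : q.pc p = .we) (hk : (q.ids p).getLast? = some k) :
      ABDStep q (.inl (.res .write none p k))
        { q with pc := update q.pc p .main, arg := update q.arg p 0 }
  | serverQueryAck (q : ABDState Tid Id) (p p' : Tid) (k : Id) (X : Set (Ack Tid))
      (hX : q.msgs (.query p' k) = some X) (hp : ∀ vt, Ack.reply p vt ∉ X) :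
      ABDStep q (.inr p)
        { q with msgs := update q.msgs (.query p' k) (some (X ∪ {Ack.reply p (q.tval p)})) }
  | serverUpdateAck (q : ABDState Tid Id) (p p' : Tid) (k : Id) (vt : ℕ × TS Tid)
      (X : Set (Ack Tid))
      (hX : q.msgs (.update p' k vt) = some X) (hp : Ack.ack p ∉ X) :
      ABDStep q (.inr p)
        { q with msgs := update q.msgs (.update p' k vt) (some (X ∪ {Ack.ack p})),
                 tval := update q.tval p (if (q.tval p).2 < vt.2 then vt else q.tval p) }

end ABD

def ABD (Tid : Type u) (Id : Type v) [Fintype Tid] [LinearOrder Tid] :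
    ObjLTS RegMethod ℕ Tid Id Tid where
  State := ABDState Tid Id
  init :=
    { msgs := fun _ => none, ids := fun _ => [], tval := fun _ => (0, toLex (0, ⊥)),
      pc := fun _ => .main, arg := fun _ => 0 }
  Tr := ABDStep

end RegSpec

/-! Two facts carry the theorem: `ABD_simulates_DR` and `DR_decisivelyLinearizable`. The rest is
general. Matching paths of a forward simulation can be chosen transition by transition
(`LTS.exists_path_map`), which gives a prefix-monotone map of executions that preserves histories.
Composing it with a linearization map of the target transfers decisive linearizability, and
well-formedness of histories is part of being linearizable. In the presence of a client, the
scheduler for the target allows exactly the transitions that continue the image of a consistent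
execution. Images branch only where executions branch; under a deterministic scheduler these are
client internal transitions, which are matched one to one, so determinism survives.

Decisive linearizability of `DR` means that linearizations grow by insertion only. A write is
linearized either at the end, or directly before the last write that was put at the end. In the
second case it is overwritten at once, so no later value changes; rolling back the version exposes
its value to concurrent reads for a moment. The linearization is kept as `pre ++ top`, where `top`
starts with that last write. If the version has grown since an operation started, then nothing in
`top` precedes the operation in real time, which justifies inserting before `top`. A read remembers
values for which some prefix of the linearization both evaluates to the value and contains all
operations preceding the read (`Splits`); such prefixes survive insertions, so the read can be
inserted late.

In the simulation, `DR` linearizes a write of `ABD` as soon as some operation, the write itself or a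
read returning its value, ends its second phase with that timestamped value. A timestamp above all
linearized ones makes `DR` write on top; a smaller one makes it roll back and forward. By quorum
intersection, an operation sees a timestamp at least the largest one linearized before its query
(`low`). So a write that has to be rolled back overlaps the write that beat it, and a read returns
either the value that was current when it started or one linearized since, all of which its copy in
`DR` has collected (`ABDSim.exists_linearize`). -/

namespace RegSpec

/-! ## Paths -/

namespace LTS

variable {Λ : Type*} {Λ' : Type*}

/-- The state in which a path from `q` ends. -/
def lastState (A : LTS Λ) : A.State → List A.Transition → A.State
  | q, [] => q
  | _, t :: e => A.lastState t.post e

theorem lastState_append (A : LTS Λ) (e₁ e₂ : List A.Transition) (q : A.State) :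
    A.lastState q (e₁ ++ e₂) = A.lastState (A.lastState q e₁) e₂ := by
  induction e₁ generalizing q with
  | nil => rfl
  | cons t e ih => exact ih t.post

theorem isPathFrom_append (A : LTS Λ) (e₁ e₂ : List A.Transition) (q : A.State) :
    A.IsPathFrom q (e₁ ++ e₂) ↔ A.IsPathFrom q e₁ ∧ A.IsPathFrom (A.lastState q e₁) e₂ := by
  induction e₁ generalizing q with
  | nil => simp [IsPathFrom, lastState]
  | cons t e ih => simp [IsPathFrom, lastState, ih, and_assoc]

theorem IsPathFrom.of_prefix {A : LTS Λ} {e₁ e₂ : List A.Transition} {q : A.State}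
    (h : A.IsPathFrom q e₂) (hp : e₁ <+: e₂) : A.IsPathFrom q e₁ := by
  obtain ⟨t, rfl⟩ := hp
  exact ((A.isPathFrom_append _ _ _).1 h).1

theorem Steps.trans {A : LTS Λ} {q₁ q₂ q₃ : A.State} {ρ₁ ρ₂ : List Λ} (h₁ : A.Steps q₁ ρ₁ q₂)
    (h₂ : A.Steps q₂ ρ₂ q₃) : A.Steps q₁ (ρ₁ ++ ρ₂) q₃ := by
  induction h₁ with
  | nil => exact h₂
  | cons ht _ ih => exact .cons ht (ih h₂)

theorem Steps.exists_path {A : LTS Λ} {q q' : A.State} {ρ : List Λ} (h : A.Steps q ρ q') :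
    ∃ e, A.IsPathFrom q e ∧ A.lastState q e = q' ∧ e.map Transition.label = ρ := by
  induction h with
  | nil q => exact ⟨[], trivial, rfl, rfl⟩
  | cons ht _ ih =>
    obtain ⟨e, he, hl, hm⟩ := ih
    exact ⟨⟨_, _, _, ht⟩ :: e, ⟨rfl, he⟩, hl, by simp [hm]⟩

/-- If every transition of `A` can be matched by a path of `B`, in a way that satisfies `Good`, then
the matching paths can be chosen coherently for all executions of `A`. -/
theorem exists_path_map {A : LTS Λ} {B : LTS Λ'} {R : A.State → B.State → Prop}
    {Good : A.Transition → B.State → List B.Transition → Prop} (h₀ : R A.init B.init)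
    (hstep : ∀ (t : A.Transition) (b : B.State), R t.pre b →
      ∃ ρ, B.IsPathFrom b ρ ∧ R t.post (B.lastState b ρ) ∧ Good t b ρ) :
    ∃ f : List A.Transition → List B.Transition, f [] = [] ∧
      (∀ e, A.IsPathFrom A.init e → B.IsPathFrom B.init (f e) ∧
        R (A.lastState A.init e) (B.lastState B.init (f e))) ∧
      ∀ e t, A.IsPathFrom A.init (e ++ [t]) →
        ∃ ρ, f (e ++ [t]) = f e ++ ρ ∧ Good t (B.lastState B.init (f e)) ρ := by
  -- The empty path is a default for unrelated states, so that the choice below is total.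
  have hn : ∀ (t : A.Transition) (b : B.State), ∃ ρ, R t.pre b →
      B.IsPathFrom b ρ ∧ R t.post (B.lastState b ρ) ∧ Good t b ρ := by
    intro t b
    by_cases h : R t.pre b
    · obtain ⟨ρ, hρ⟩ := hstep t b h
      exact ⟨ρ, fun _ => hρ⟩
    · exact ⟨[], fun h' => absurd h' h⟩
  choose next hnext using hn
  -- The next piece is appended to the path already built, so extending an execution never revises
  -- its image.
  let f : List A.Transition → List B.Transition :=
    List.foldl (fun ρ t => ρ ++ next t (B.lastState B.init ρ)) []
  have hf : ∀ e t, f (e ++ [t]) = f e ++ next t (B.lastState B.init (f e)) := fun e t => by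
    simp [f, List.foldl_append]
  have hR : ∀ e, A.IsPathFrom A.init e → B.IsPathFrom B.init (f e) ∧
      R (A.lastState A.init e) (B.lastState B.init (f e)) := by
    intro e
    induction e using List.reverseRecOn with
    | nil => exact fun _ => ⟨trivial, h₀⟩
    | append_singleton e t ih =>
      intro he
      obtain ⟨he₁, he₂, -⟩ := (A.isPathFrom_append _ _ _).1 he
      obtain ⟨h₁, h₂⟩ := ih he₁
      obtain ⟨h₃, h₄, -⟩ := hnext t _ (he₂ ▸ h₂)
      rw [hf, isPathFrom_append, lastState_append, lastState_append]
      exact ⟨⟨h₁, h₃⟩, h₄⟩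
  refine ⟨f, rfl, hR, fun e t he => ⟨_, hf e t, ?_⟩⟩
  obtain ⟨he₁, he₂, -⟩ := (A.isPathFrom_append _ _ _).1 he
  exact (hnext t _ (he₂ ▸ (hR e he₁).2)).2.2

end LTS

/-- A map on lists that extends images is monotone for the prefix order. -/
theorem prefix_map_of_extends {α β : Type*} {f : List α → List β} {D : List α → Prop}
    (hD : ∀ e e', D e' → e <+: e' → D e)
    (hf : ∀ e t, D (e ++ [t]) → f e <+: f (e ++ [t])) {e e' : List α} (he' : D e')
    (h : e <+: e') : f e <+: f e' := by
  obtain ⟨s, rfl⟩ := h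
  induction s using List.reverseRecOn with
  | nil => simp
  | append_singleton s t ih =>
    rw [← List.append_assoc] at he' ⊢
    exact (ih (hD _ _ he' (List.prefix_append _ _))).trans (hf _ _ he')

/-- Two lists are comparable for the prefix order, or they branch. -/
theorem prefix_or_branch {α : Type*} (a b : List α) :
    a <+: b ∨ b <+: a ∨ ∃ c s t, s ≠ t ∧ c ++ [s] <+: a ∧ c ++ [t] <+: b := by
  induction a generalizing b with
  | nil => simp
  | cons x a ih =>
    cases b with
    | nil => simp
    | cons y b =>
      by_cases hxy : x = y
      · subst hxy
        rcases ih b with h | h | ⟨c, s, t, hst, h₁, h₂⟩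
        · exact .inl (by simpa using h)
        · exact .inr (.inl (by simpa using h))
        · exact .inr (.inr ⟨x :: c, s, t, hst, by simpa using h₁, by simpa using h₂⟩)
      · exact .inr (.inr ⟨[], x, y, hxy, by simp, by simp⟩)

theorem eq_of_append_singleton_prefix {α : Type*} {d e : List α} {s t : α}
    (h₁ : d ++ [s] <+: e) (h₂ : d ++ [t] <+: e) : s = t := by
  obtain ⟨u, rfl⟩ := h₁
  obtain ⟨v, h₂⟩ := h₂
  simp only [List.append_assoc, List.singleton_append, List.append_cancel_left_eq,
    List.cons.injEq] at h₂
  exact h₂.1.symm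

section Restriction

variable {M : Type*} {V : Type*} {Tid : Type*} {Id : Type*} {IInt : Type*}

theorem restrict_IR (ρ : List (Action M V Tid Id ⊕ IInt)) :
    restrict ρ IR = (ρ.filterMap Sum.getLeft?).map Sum.inl := by
  induction ρ with
  | nil => rfl
  | cons a ρ ih => cases a <;> simp_all [restrict, IR, List.filterMap_cons]

theorem filterMap_getLeft?_eq_of_restrict_eq {ρ ρ' : List (Action M V Tid Id ⊕ IInt)}
    (h : restrict ρ IR = restrict ρ' IR) :
    ρ.filterMap Sum.getLeft? = ρ'.filterMap Sum.getLeft? := by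
  rw [restrict_IR, restrict_IR] at h
  exact List.map_injective_iff.2 Sum.inl_injective h

end Restriction

/-! ## Forward simulations and histories -/

section Simulation

variable {M : Type*} {V : Type*} {Tid : Type*} {Id : Type*} {IInt : Type*}

/-- Well-formedness and linearizations are pulled back along this map; its monotonicity is what
decisiveness needs. -/
theorem Simulates.exists_history_map {I J : ObjLTS M V Tid Id IInt} (h : Simulates I J IR) :
    ∃ f : I.Execution → J.Execution, (∀ e, history (f e) = history e) ∧
      ∀ e₁ e₂, e₁.1 <+: e₂.1 → (f e₁).1 <+: (f e₂).1 := by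
  obtain ⟨R, h₀, hR⟩ := h
  obtain ⟨f, hf₀, hf₁, hf₂⟩ := LTS.exists_path_map (A := I) (B := J) (R := R)
    (Good := fun t _ ρ => (ρ.map LTS.Transition.label).filterMap Sum.getLeft? =
      [t.label].filterMap Sum.getLeft?) h₀ (by
      intro t b hb
      obtain ⟨b', ρ, hs, hρ, hb'⟩ := hR _ _ _ _ t.valid hb
      obtain ⟨e, he, hl, hm⟩ := hs.exists_path
      exact ⟨e, he, hl ▸ hb', hm ▸ filterMap_getLeft?_eq_of_restrict_eq hρ⟩)
  refine ⟨fun e => ⟨f e.1, (hf₁ _ e.2).1⟩, ?_, ?_⟩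
  · rintro ⟨e, he⟩
    simp only [history, LTS.Execution.trace]
    induction e using List.reverseRecOn with
    | nil => simp [hf₀]
    | append_singleton e t ih =>
      obtain ⟨ρ, h₁, h₂⟩ := hf₂ e t he
      rw [h₁, List.map_append, List.filterMap_append,
        ih (he.of_prefix (List.prefix_append _ _)), h₂]
      simp
  · rintro e₁ e₂ h
    refine prefix_map_of_extends (D := I.IsPathFrom I.init) (fun _ _ h' hp => h'.of_prefix hp)
      (fun e t he => ?_) e₂.2 h
    obtain ⟨ρ, h₁, -⟩ := hf₂ e t he
    exact h₁ ▸ List.prefix_append _ _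

theorem IsImplementation.of_simulates {I J : ObjLTS M V Tid Id IInt} (h : Simulates I J IR)
    (hJ : IsImplementation J) : IsImplementation I := by
  obtain ⟨f, hf, -⟩ := h.exists_history_map
  exact fun e => hf e ▸ hJ (f e)

theorem DecisivelyLinearizable.of_simulates {I J : ObjLTS M V Tid Id IInt}
    {Spec : Specification M V Tid Id} (h : Simulates I J IR)
    (hJ : DecisivelyLinearizable J Spec) : DecisivelyLinearizable I Spec := by
  obtain ⟨f, hf, hm⟩ := h.exists_history_map
  obtain ⟨L, hL, hLm⟩ := hJ
  exact ⟨fun e => L (f e), fun e => hf e ▸ hL (f e), fun e₁ e₂ he => hLm _ _ (hm _ _ he)⟩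

theorem WellFormed.of_append {h₁ h₂ : List (Action M V Tid Id)} (h : WellFormed (h₁ ++ h₂)) :
    WellFormed h₁ := by
  intro p
  obtain ⟨ha, hn⟩ := h p
  simp only [restrict, List.filter_append, List.map_append] at ha hn ⊢
  exact ⟨Alternates.of_append _ ha, hn.of_append_left⟩

/-- `LinearizesTo` already asks that the history completed by responses be well-formed, and
well-formedness passes to prefixes. -/
theorem DecisivelyLinearizable.isImplementation {I : ObjLTS M V Tid Id IInt}
    {Spec : Specification M V Tid Id} (h : DecisivelyLinearizable I Spec) :
    IsImplementation I := by
  obtain ⟨L, hL, -⟩ := h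
  intro e
  obtain ⟨rs, -, hw, -⟩ := (hL e).2
  exact hw.of_append

end Simulation

/-! ## Forward simulations and strong observational refinement -/

section Refinement

variable {M : Type*} {V : Type*} {Tid : Type*} {Id : Type*} {IInt : Type*} {PInt : Type*}

theorem clientTrace_append (ρ₁ ρ₂ : List (Action M V Tid Id ⊕ (IInt ⊕ PInt))) :
    clientTrace (ρ₁ ++ ρ₂) = clientTrace ρ₁ ++ clientTrace ρ₂ :=
  List.filterMap_append

theorem clientTrace_singleton_length (a : Action M V Tid Id ⊕ (IInt ⊕ PInt)) :
    (clientTrace [a]).length ≤ 1 :=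
  (List.length_filterMap_le _ _).trans_eq rfl

variable {P : LTS (Action M V Tid Id ⊕ PInt)} {I J : ObjLTS M V Tid Id IInt}

theorem link_steps_of_internal {b b' : J.State} {ρ : List (Action M V Tid Id ⊕ IInt)}
    (h : J.Steps b ρ b') (hρ : ρ.filterMap Sum.getLeft? = []) (s : P.State) :
    ∃ ρ', (link P J).Steps (b, s) ρ' (b', s) ∧ clientTrace ρ' = [] := by
  induction h with
  | nil => exact ⟨[], .nil _, rfl⟩
  | @cons q q₁ q' a ρ ht _ ih =>
    cases a with
    | inl a => simp at hρ
    | inr i =>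
      obtain ⟨ρ', h₁, h₂⟩ := ih (by simpa [List.filterMap_cons] using hρ)
      exact ⟨_, .cons (LinkStep.impl ht) h₁, by simpa [clientTrace] using h₂⟩

/-- The client moves together with the single visible label of `ρ`; the internal labels around it
leave the client where it is. -/
theorem link_steps_of_sync {b b' : J.State} {ρ : List (Action M V Tid Id ⊕ IInt)}
    (h : J.Steps b ρ b') {a : Action M V Tid Id} (hρ : ρ.filterMap Sum.getLeft? = [a])
    {s s' : P.State} (hs : P.Tr s (Sum.inl a) s') :
    ∃ ρ', (link P J).Steps (b, s) ρ' (b', s') ∧ clientTrace ρ' = [Sum.inl a] := by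
  induction h with
  | nil => simp at hρ
  | @cons q q₁ q' l ρ ht hst ih =>
    cases l with
    | inl l =>
      simp only [Sum.getLeft?_inl, Option.some.injEq, List.filterMap_cons_some,
        List.cons.injEq] at hρ
      obtain ⟨rfl, hρ⟩ := hρ
      obtain ⟨ρ', h₁, h₂⟩ := link_steps_of_internal (P := P) hst hρ s'
      exact ⟨_, .cons (LinkStep.sync ht hs) h₁, by simpa [clientTrace] using h₂⟩
    | inr i =>
      obtain ⟨ρ', h₁, h₂⟩ := ih (by simpa [List.filterMap_cons] using hρ)
      exact ⟨_, .cons (LinkStep.impl ht) h₁, by simpa [clientTrace] using h₂⟩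

/-- A transition `t` of `P[I]` is matched by the path `ρ` of `P[J]`. -/
def LinkMatch (t : (link P I).Transition) (ρ : List (link P J).Transition) : Prop :=
  clientTrace (ρ.map LTS.Transition.label) = clientTrace [t.label] ∧
  (IsClientInternal t.label →
    ∃ t', ρ = [t'] ∧ t'.label = t.label ∧ t'.post.2 = t.post.2)

/-- A client internal step does not touch the state of the implementation, so the client's part of
the target determines it. This keeps distinct client choices distinct after they are matched. -/
theorem eq_of_isClientInternal {t₁ t₂ : (link P I).Transition} (h₁ : IsClientInternal t₁.label)
    (hpre : t₁.pre = t₂.pre) (hl : t₁.label = t₂.label) (hpost : t₁.post.2 = t₂.post.2) :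
    t₁ = t₂ := by
  obtain ⟨pre₁, l₁, post₁, v₁⟩ := t₁
  obtain ⟨pre₂, l₂, post₂, v₂⟩ := t₂
  dsimp only at h₁ hpre hl hpost
  subst hpre hl
  cases v₁ with
  | sync _ _ => exact h₁.elim
  | impl _ => exact h₁.elim
  | prog _ =>
    cases v₂
    cases hpost
    rfl

/-- The simulation lifts to the composition with equality on client states; client steps are copied
verbatim. -/
theorem exists_link_match {R : I.State → J.State → Prop} (hR : IsForwardSimulation I J IR R)
    (t : (link P I).Transition) (b : (link P J).State) (h₁ : R t.pre.1 b.1)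
    (h₂ : t.pre.2 = b.2) :
    ∃ ρ, (link P J).IsPathFrom b ρ ∧ (R t.post.1 ((link P J).lastState b ρ).1 ∧
      t.post.2 = ((link P J).lastState b ρ).2) ∧ LinkMatch t ρ := by
  obtain ⟨pre, l, post, hv⟩ := t
  obtain ⟨b, s⟩ := b
  dsimp only at h₁ h₂ ⊢
  cases hv with
  | @sync a q q' s₁ s' hI hP =>
    dsimp only at h₂; subst h₂
    obtain ⟨b', ρ, hs, hρ, hb'⟩ := hR.2 _ _ _ _ hI h₁
    obtain ⟨ρ', hst, hc⟩ := link_steps_of_sync hs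
      (by simpa using filterMap_getLeft?_eq_of_restrict_eq hρ) hP
    obtain ⟨e, he, hl, hm⟩ := hst.exists_path
    exact ⟨e, he, by rw [hl]; exact ⟨hb', rfl⟩, by rw [hm, hc]; rfl, fun h => h.elim⟩
  | @impl i q q' s₁ hI =>
    dsimp only at h₂; subst h₂
    obtain ⟨b', ρ, hs, hρ, hb'⟩ := hR.2 _ _ _ _ hI h₁
    obtain ⟨ρ', hst, hc⟩ := link_steps_of_internal hs
      (filterMap_getLeft?_eq_of_restrict_eq hρ) s₁
    obtain ⟨e, he, hl, hm⟩ := hst.exists_path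
    exact ⟨e, he, by rw [hl]; exact ⟨hb', rfl⟩, by rw [hm, hc]; rfl, fun h => h.elim⟩
  | @prog c q s₁ s' hP =>
    dsimp only at h₂; subst h₂
    exact ⟨[⟨(b, s₁), _, (b, s'), LinkStep.prog hP⟩], ⟨rfl, trivial⟩, ⟨h₁, rfl⟩, rfl,
      fun _ => ⟨_, rfl, rfl, rfl⟩⟩

theorem Scheduler.Consistent.of_prefix {Λ : Type*} {A : LTS Λ} {S : Scheduler A}
    {e e' : A.Execution} (h : S.Consistent e') (hp : e.1 <+: e'.1) : S.Consistent e :=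
  fun e'' t ht => h e'' t (ht.trans hp)

/-- The new scheduler follows the tree of images `f e` of consistent executions. Since `f` is
monotone, two branches of this tree come from two branches of the tree of executions, where `S`
leaves only client internal choices. Images keep the client trace, so the traces agree up to
intermediate points of images, which add nothing new. -/
theorem Simulates.exists_scheduler (h : Simulates I J IR) (S : Scheduler (link P I))
    (hS : S.Deterministic) :
    ∃ S' : Scheduler (link P J), S'.Deterministic ∧ clientTraces S = clientTraces S' := by
  obtain ⟨R, hR⟩ := h
  obtain ⟨f, hf₀, hf₁, hf₂⟩ := LTS.exists_path_map (A := link P I) (B := link P J)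
    (R := fun a b => R a.1 b.1 ∧ a.2 = b.2) (Good := fun t _ ρ => LinkMatch t ρ)
    ⟨hR.1, rfl⟩ (fun t b hb => exists_link_match hR t b hb.1 hb.2)
  have hmono : ∀ {e e'}, (link P I).IsPathFrom (link P I).init e' → e <+: e' →
      f e <+: f e' := by
    refine prefix_map_of_extends (fun _ _ h' hp => h'.of_prefix hp) (fun e t he => ?_)
    obtain ⟨ρ, h₁, -⟩ := hf₂ e t he
    exact h₁ ▸ List.prefix_append _ _
  have htr : ∀ e, (link P I).IsPathFrom (link P I).init e →
      clientTrace ((f e).map LTS.Transition.label) = clientTrace (e.map LTS.Transition.label) := by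
    intro e
    induction e using List.reverseRecOn with
    | nil => simp [hf₀]
    | append_singleton e t ih =>
      intro he
      obtain ⟨ρ, h₁, h₂, -⟩ := hf₂ e t he
      rw [h₁, List.map_append, List.map_append, clientTrace_append, clientTrace_append,
        ih (he.of_prefix (List.prefix_append _ _)), h₂]
      rfl
  let S' : Scheduler (link P J) := fun d =>
    {t | ∃ e : (link P I).Execution, S.Consistent e ∧ d.1 ++ [t] <+: f e.1}
  refine ⟨S', ?_, ?_⟩
  · rintro d t₁ ⟨e₁, hc₁, hp₁⟩ t₂ ⟨e₂, hc₂, hp₂⟩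
    rcases prefix_or_branch e₁.1 e₂.1 with h | h | ⟨c, s₁, s₂, hne, h₁, h₂⟩
    · exact .inl (eq_of_append_singleton_prefix (hp₁.trans (hmono e₂.2 h)) hp₂)
    · exact .inl (eq_of_append_singleton_prefix hp₁ (hp₂.trans (hmono e₁.2 h)))
    · have hpc₁ := e₁.2.of_prefix h₁
      have hpc₂ := e₂.2.of_prefix h₂
      have hpc := hpc₁.of_prefix (List.prefix_append _ _)
      -- Both executions are consistent, so `S` allows `s₁` and `s₂` after `c`; being distinct, they
      -- must be client internal.
      obtain ⟨hi₁, hi₂⟩ := (hS ⟨c, hpc⟩ s₁ (hc₁ ⟨c, hpc⟩ s₁ h₁) s₂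
        (hc₂ ⟨c, hpc⟩ s₂ h₂)).resolve_left hne
      obtain ⟨ρ₁, hρ₁, -, hm₁⟩ := hf₂ c s₁ hpc₁
      obtain ⟨ρ₂, hρ₂, -, hm₂⟩ := hf₂ c s₂ hpc₂
      obtain ⟨u₁, rfl, hl₁, hq₁⟩ := hm₁ hi₁
      obtain ⟨u₂, rfl, hl₂, hq₂⟩ := hm₂ hi₂
      have hu : u₁ ≠ u₂ := by
        rintro rfl
        refine hne (eq_of_isClientInternal hi₁ ?_ (hl₁.symm.trans hl₂) (hq₁.symm.trans hq₂))
        rw [((LTS.isPathFrom_append _ _ _ _).1 hpc₁).2.1,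
          ((LTS.isPathFrom_append _ _ _ _).1 hpc₂).2.1]
      have hb₁ : f c ++ [u₁] <+: f e₁.1 := hρ₁ ▸ hmono e₁.2 h₁
      have hb₂ : f c ++ [u₂] <+: f e₂.1 := hρ₂ ▸ hmono e₂.2 h₂
      -- Two sequences diverge at one point only, so the branching after `d` is the one after `f c`.
      have key : ∀ {d c : List (link P J).Transition} {a b : List (link P J).Transition}
          {t₁ t₂ u₁ u₂ : (link P J).Transition}, u₁ ≠ u₂ → t₁ ≠ t₂ →
          d ++ [t₁] <+: a → d ++ [t₂] <+: b → c ++ [u₁] <+: a → c ++ [u₂] <+: b →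
          t₁ = u₁ ∧ t₂ = u₂ := by
        intro d
        induction d with
        | nil =>
          intro c a b t₁ t₂ u₁ u₂ hu ht ha hb hca hcb
          cases c with
          | nil =>
            exact ⟨eq_of_append_singleton_prefix ha hca, eq_of_append_singleton_prefix hb hcb⟩
          | cons x c =>
            obtain ⟨a', rfl⟩ := hca
            obtain ⟨b', rfl⟩ := hcb
            simp at ha hb
            exact absurd (ha.trans hb.symm) ht
        | cons y d ih =>
          intro c a b t₁ t₂ u₁ u₂ hu ht ha hb hca hcb
          cases c with
          | nil =>
            obtain ⟨a', rfl⟩ := ha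
            obtain ⟨b', rfl⟩ := hb
            simp at hca hcb
            exact absurd (hca.trans hcb.symm) hu
          | cons x c =>
            obtain ⟨a', rfl⟩ := hca
            obtain ⟨b', rfl⟩ := hcb
            simp only [List.cons_append, List.cons_prefix_cons] at ha hb
            exact ih hu ht ha.2 hb.2 (List.prefix_append _ _) (List.prefix_append _ _)
      by_cases ht : t₁ = t₂
      · exact .inl ht
      · obtain ⟨rfl, rfl⟩ := key hu ht hp₁ hp₂ hb₁ hb₂
        exact .inr ⟨hl₁ ▸ hi₁, hl₂ ▸ hi₂⟩
  · ext τ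
    constructor
    · rintro ⟨e, hc, rfl⟩
      exact ⟨⟨f e.1, (hf₁ _ e.2).1⟩, fun d t ht => ⟨e, hc, ht⟩, htr _ e.2⟩
    · rintro ⟨⟨d, hd⟩, hc, rfl⟩
      -- It suffices to look at the last transition of `d`: the scheduler allowed it because all of
      -- `d` lies on the image of some consistent execution.
      have : ∃ e : (link P I).Execution, S.Consistent e ∧ d <+: f e.1 := by
        rcases d.eq_nil_or_concat with rfl | ⟨d, t, rfl⟩
        · refine ⟨⟨[], trivial⟩, fun e' t ht => ?_, List.nil_prefix⟩
          simp at ht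
        · simp only [List.concat_eq_append] at hd hc ⊢
          exact hc ⟨d, hd.of_prefix (List.prefix_append _ _)⟩ t (List.prefix_refl _)
      obtain ⟨⟨e, he⟩, hce, hde⟩ := this
      -- `d` may stop in the middle of the path matching a transition. Since a transition of `e`
      -- shows at most one action to the client, each prefix of the client trace of `e` is still the
      -- trace of a prefix of `e`.
      obtain ⟨e', he', htr'⟩ : ∃ e', e' <+: e ∧ clientTrace (e'.map LTS.Transition.label) =
          clientTrace (d.map LTS.Transition.label) := by
        have hpre : clientTrace (d.map LTS.Transition.label) <+:
            clientTrace (e.map LTS.Transition.label) := by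
          rw [← htr e he]
          exact (hde.map _).filterMap _
        generalize clientTrace (d.map LTS.Transition.label) = τ at hpre
        clear hde hce he
        induction e using List.reverseRecOn with
        | nil => exact ⟨[], List.nil_prefix, (List.prefix_nil.1 hpre).symm⟩
        | append_singleton e t ih =>
          by_cases h : τ <+: clientTrace (e.map LTS.Transition.label)
          · obtain ⟨e', h₁, h₂⟩ := ih h
            exact ⟨e', h₁.trans (List.prefix_append _ _), h₂⟩
          · refine ⟨_, List.prefix_refl _, (hpre.eq_of_length_le ?_).symm⟩
            by_contra! hlt
            refine h (List.prefix_of_prefix_length_le hpre ?_ ?_)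
            · rw [List.map_append, clientTrace_append]
              exact List.prefix_append _ _
            · rw [List.map_append, clientTrace_append, List.length_append] at hlt
              have := clientTrace_singleton_length t.label
              simp only [List.map_cons, List.map_nil] at hlt
              omega
      exact ⟨⟨e', he.of_prefix he'⟩, hce.of_prefix he', htr'⟩

theorem StronglyRefines.of_simulates {M : Type*} {V : Type*} {Tid : Type*} {Id : Type*}
    {IInt : Type*} {I J : ObjLTS M V Tid Id IInt} (h : Simulates I J IR) :
    StronglyRefines.{u, v} I J :=
  fun _ _ S hS => h.exists_scheduler S hS

end Refinement

open scoped List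

/-! ## Operations of the register and their linearization -/

/-- Completed operations of the register; `n` is the value read or written. -/
inductive RegOp (Tid : Type u) (Id : Type v)
  | read (p : Tid) (k : Id) (n : ℕ)
  | write (p : Tid) (k : Id) (n : ℕ)

section RegOps

variable {Tid : Type u} {Id : Type v}

namespace RegOp

def inv : RegOp Tid Id → RegAction Tid Id
  | read p k _ => .inv .read none p k
  | write p k n => .inv .write (some n) p k

def res : RegOp Tid Id → RegAction Tid Id
  | read p k n => .res .read (some n) p k
  | write p k _ => .res .write none p k

def key : RegOp Tid Id → Tid × Id
  | read p k _ => (p, k)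
  | write p k _ => (p, k)

@[simp] theorem key_inv (o : RegOp Tid Id) : o.inv.key = o.key := by cases o <;> rfl
@[simp] theorem key_res (o : RegOp Tid Id) : o.res.key = o.key := by cases o <;> rfl
@[simp] theorem thread_inv (o : RegOp Tid Id) : o.inv.thread = o.key.1 := by cases o <;> rfl
@[simp] theorem thread_res (o : RegOp Tid Id) : o.res.thread = o.key.1 := by cases o <;> rfl
@[simp] theorem isInv_inv (o : RegOp Tid Id) : o.inv.isInv = true := by cases o <;> rfl
@[simp] theorem isRes_inv (o : RegOp Tid Id) : o.inv.isRes = false := by cases o <;> rfl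
@[simp] theorem isInv_res (o : RegOp Tid Id) : o.res.isInv = false := by cases o <;> rfl
@[simp] theorem isRes_res (o : RegOp Tid Id) : o.res.isRes = true := by cases o <;> rfl
theorem method_inv (o : RegOp Tid Id) : o.inv.method = o.res.method := by cases o <;> rfl

/-- The value of a register with value `x` after an operation. -/
def step (x : ℕ) : RegOp Tid Id → ℕ
  | read _ _ _ => x
  | write _ _ n => n

/-- The value of a register with initial value `x` after a sequence of operations. -/
def eval (x : ℕ) (l : List (RegOp Tid Id)) : ℕ := l.foldl step x

@[simp] theorem eval_nil (x : ℕ) : eval x ([] : List (RegOp Tid Id)) = x := rfl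

@[simp] theorem eval_cons (x : ℕ) (o : RegOp Tid Id) (l : List (RegOp Tid Id)) :
    eval x (o :: l) = eval (step x o) l := rfl

theorem eval_append (x : ℕ) (l₁ l₂ : List (RegOp Tid Id)) :
    eval x (l₁ ++ l₂) = eval (eval x l₁) l₂ := List.foldl_append

/-- Every read returns the current value of a register with initial value `x`. -/
def Legal : ℕ → List (RegOp Tid Id) → Prop
  | _, [] => True
  | x, read _ _ n :: l => n = x ∧ Legal x l
  | _, write _ _ n :: l => Legal n l

theorem legal_append (x : ℕ) (l₁ l₂ : List (RegOp Tid Id)) :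
    Legal x (l₁ ++ l₂) ↔ Legal x l₁ ∧ Legal (eval x l₁) l₂ := by
  induction l₁ generalizing x with
  | nil => simp [Legal]
  | cons o l ih => cases o <;> simp [Legal, ih, step, and_assoc]

/-- The sequential history of a sequence of operations. -/
def toHistory (l : List (RegOp Tid Id)) : List (RegAction Tid Id) :=
  l.flatMap fun o => [o.inv, o.res]

@[simp] theorem toHistory_nil : toHistory ([] : List (RegOp Tid Id)) = [] := rfl

@[simp] theorem toHistory_cons (o : RegOp Tid Id) (l : List (RegOp Tid Id)) :
    toHistory (o :: l) = o.inv :: o.res :: toHistory l := rfl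

@[simp] theorem toHistory_append (l₁ l₂ : List (RegOp Tid Id)) :
    toHistory (l₁ ++ l₂) = toHistory l₁ ++ toHistory l₂ := List.flatMap_append

theorem mem_toHistory {a : RegAction Tid Id} {l : List (RegOp Tid Id)} :
    a ∈ toHistory l ↔ ∃ o ∈ l, a = o.inv ∨ a = o.res := by
  simp [toHistory]

theorem toHistory_sublist {l₁ l₂ : List (RegOp Tid Id)} (h : l₁ <+ l₂) :
    toHistory l₁ <+ toHistory l₂ := by
  induction h with
  | slnil => exact List.Sublist.refl _
  | cons a _ ih => exact (ih.cons _).cons _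
  | cons_cons a _ ih => exact (ih.cons_cons _).cons_cons _

theorem regLegal_toHistory {x : ℕ} {l : List (RegOp Tid Id)} (h : Legal x l) :
    RegLegal x (toHistory l) := by
  induction l generalizing x with
  | nil => trivial
  | cons o l ih =>
    cases o with
    | read p k n => exact ⟨rfl, congrArg some h.1, ih h.2⟩
    | write p k n => exact ⟨n, rfl, rfl, ih h⟩

theorem alternates_toHistory_append {l : List (RegOp Tid Id)} {h : List (RegAction Tid Id)} :
    Alternates (toHistory l ++ h) ↔ Alternates h := by
  induction l with
  | nil => simp
  | cons o l ih =>
    change (o.inv.isInv = true ∧ o.res.isRes = true ∧ o.inv.method = o.res.method ∧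
      o.inv.key = o.res.key ∧ Alternates (toHistory l ++ h)) ↔ _
    simp [ih, method_inv]

theorem map_key_toHistory (l : List (RegOp Tid Id)) :
    ((toHistory l).filter Action.isInv).map Action.key = l.map key := by
  induction l with
  | nil => rfl
  | cons o l ih => simp [ih]

end RegOp

/-- A response with key `k₁` occurs in `h` before an invocation with key `k₂`. -/
def Precedes (h : List (RegAction Tid Id)) (k₁ k₂ : Tid × Id) : Prop :=
  ∃ r i, r.isRes = true ∧ i.isInv = true ∧ r.key = k₁ ∧ i.key = k₂ ∧ [r, i] <+ h

theorem pair_sublist_concat {α : Type*} {r i a : α} {h : List α} :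
    [r, i] <+ h ++ [a] ↔ [r, i] <+ h ∨ (i = a ∧ r ∈ h) := by
  constructor
  · intro hs
    obtain ⟨l₁, l₂, he, h₁, h₂⟩ := List.sublist_append_iff.1 hs
    rcases l₂ with _ | ⟨x, l₂⟩
    · exact .inl (by simpa [he] using h₁)
    · obtain ⟨rfl, rfl⟩ : x = a ∧ l₂ = [] := by
        have := List.sublist_singleton.1 h₂
        simpa using this
      rcases l₁ with _ | ⟨y, _ | ⟨z, l₁⟩⟩
      · simp at he
      · simp at he
        exact .inr ⟨he.2, by simpa [he.1] using h₁⟩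
      · simp at he
  · rintro (hs | ⟨rfl, hr⟩)
    · exact hs.trans (List.sublist_append_left _ _)
    · exact (List.singleton_sublist.2 hr).append (List.Sublist.refl [i])

/-- New pairs appear only when an invocation is appended, and only with its key on the right. Hence
responses change nothing, and an operation never gains predecessors after its invocation. -/
theorem precedes_concat {h : List (RegAction Tid Id)} {a : RegAction Tid Id}
    {k₁ k₂ : Tid × Id} : Precedes (h ++ [a]) k₁ k₂ ↔
      Precedes h k₁ k₂ ∨ (a.isInv = true ∧ a.key = k₂ ∧ ∃ r ∈ h, r.isRes = true ∧ r.key = k₁) := by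
  simp only [Precedes, pair_sublist_concat]
  constructor
  · rintro ⟨r, i, hr, hi, h₁, h₂, hs | ⟨rfl, hm⟩⟩
    · exact .inl ⟨r, i, hr, hi, h₁, h₂, hs⟩
    · exact .inr ⟨hi, h₂, r, hm, hr, h₁⟩
  · rintro (⟨r, i, hr, hi, h₁, h₂, hs⟩ | ⟨hi, h₂, r, hm, hr, h₁⟩)
    · exact ⟨r, i, hr, hi, h₁, h₂, .inl hs⟩
    · exact ⟨r, a, hr, hi, h₁, h₂, .inr ⟨rfl, hm⟩⟩

theorem Precedes.exists_res {h : List (RegAction Tid Id)} {k₁ k₂ : Tid × Id}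
    (hp : Precedes h k₁ k₂) : ∃ r ∈ h, r.isRes = true ∧ r.key = k₁ := by
  obtain ⟨r, i, hr, -, h₁, -, hs⟩ := hp
  exact ⟨r, hs.subset (by simp), hr, h₁⟩

theorem pair_sublist_or {α : Type*} {a b : α} {l : List α} (ha : a ∈ l) (hb : b ∈ l)
    (hab : a ≠ b) : [a, b] <+ l ∨ [b, a] <+ l := by
  induction l with
  | nil => simp at ha
  | cons c l ih =>
    rcases List.mem_cons.1 ha with rfl | ha'
    · exact .inl ((List.singleton_sublist.2 ((List.mem_cons.1 hb).resolve_left hab.symm)).cons_cons _)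
    · rcases List.mem_cons.1 hb with rfl | hb'
      · exact .inr ((List.singleton_sublist.2 ha').cons_cons _)
      · exact (ih ha' hb').imp (·.cons _) (·.cons _)

/-- `l` is a linearization of the history `h`; `done p` are the completed operations of the thread
`p`, `cur p` is its pending invocation, and `ids p` are the identifiers that it has used. -/
structure IsLinearization (ids : Tid → List Id) (h : List (RegAction Tid Id))
    (l : List (RegOp Tid Id)) (done : Tid → List (RegOp Tid Id))
    (cur : Tid → Option (RegAction Tid Id)) : Prop where
  nodup_ids : ∀ p, (ids p).Nodup
  isInv_cur : ∀ p, ∀ a ∈ cur p, a.isInv = true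
  hist : ∀ p, restrict h {a | a.thread = p} = RegOp.toHistory (done p) ++ (cur p).toList
  keys : ∀ p, (done p).map RegOp.key ++ (cur p).toList.map Action.key = (ids p).map (p, ·)
  done_subset : ∀ p, ∀ o ∈ done p, o ∈ l
  mem_done : ∀ o ∈ l, o ∈ done o.key.1 ∨ cur o.key.1 = some o.inv
  nodup : (l.map RegOp.key).Nodup
  irrefl : ∀ k, ¬ Precedes h k k
  pairwise : l.Pairwise fun a b => ¬ Precedes h b.key a.key
  legal : RegOp.Legal 0 l

/-! ### From the invariant to a linearization of the history -/

namespace IsLinearization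

variable {ids : Tid → List Id} {h : List (RegAction Tid Id)} {l : List (RegOp Tid Id)}
  {done : Tid → List (RegOp Tid Id)} {cur : Tid → Option (RegAction Tid Id)}

theorem mem_of_mem_restrict {a : RegAction Tid Id} {p : Tid}
    (ha : a ∈ restrict h {a | a.thread = p}) : a ∈ h ∧ a.thread = p := by
  simpa [restrict] using ha

theorem mem_restrict {a : RegAction Tid Id} (ha : a ∈ h) :
    a ∈ restrict h {b | b.thread = a.thread} := by
  simpa [restrict] using ha

theorem exists_of_isRes (H : IsLinearization ids h l done cur) {r : RegAction Tid Id} (hr : r ∈ h)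
    (hr' : r.isRes = true) : ∃ o ∈ done r.thread, r = o.res := by
  have := mem_restrict hr
  rw [H.hist, List.mem_append, RegOp.mem_toHistory] at this
  rcases this with ⟨o, ho, rfl | rfl⟩ | hc
  · simp at hr'
  · exact ⟨o, ho, rfl⟩
  · have := H.isInv_cur _ _ (Option.mem_toList.1 hc)
    cases r <;> simp_all [Action.isInv, Action.isRes]

theorem exists_of_isInv (H : IsLinearization ids h l done cur) {i : RegAction Tid Id} (hi : i ∈ h)
    (hi' : i.isInv = true) : (∃ o ∈ done i.thread, i = o.inv) ∨ cur i.thread = some i := by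
  have := mem_restrict hi
  rw [H.hist, List.mem_append, RegOp.mem_toHistory] at this
  rcases this with ⟨o, ho, rfl | rfl⟩ | hc
  · exact .inl ⟨o, ho, rfl⟩
  · simp at hi'
  · exact .inr (Option.mem_toList.1 hc)

theorem thread_of_cur (H : IsLinearization ids h l done cur) {p : Tid} {a : RegAction Tid Id}
    (ha : cur p = some a) : a.thread = p := by
  have : a ∈ restrict h {a | a.thread = p} := by rw [H.hist]; simp [ha]
  exact (mem_of_mem_restrict this).2

theorem nodup_keys (H : IsLinearization ids h l done cur) (p : Tid) :
    ((done p).map RegOp.key ++ (cur p).toList.map Action.key).Nodup := by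
  rw [H.keys]
  exact (H.nodup_ids p).map (Prod.mk_right_injective p)

/-- A thread never reuses an identifier, so the keys of its finished and pending operations are
distinct. -/
theorem eq_of_key_eq (H : IsLinearization ids h l done cur) {i j : RegAction Tid Id} (hi : i ∈ h)
    (hj : j ∈ h) (hi' : i.isInv = true) (hj' : j.isInv = true) (hij : i.key = j.key) : i = j := by
  have ht : i.thread = j.thread := by
    have := congrArg Prod.fst hij
    cases i <;> cases j <;> exact this
  have hn : (((done i.thread).map RegOp.inv ++ (cur i.thread).toList).map Action.key).Nodup := by
    have := H.nodup_keys i.thread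
    simpa [Function.comp_def] using this
  have key : ∀ a ∈ h, a.isInv = true → a.thread = i.thread →
      a ∈ (done i.thread).map RegOp.inv ++ (cur i.thread).toList := by
    intro a ha ha' hat
    rcases H.exists_of_isInv ha ha' with ⟨o, ho, rfl⟩ | hc
    · exact List.mem_append_left _ (List.mem_map_of_mem (hat ▸ ho))
    · exact List.mem_append_right _ (by simp [← hat, hc])
  exact List.inj_on_of_nodup_map hn (key i hi hi' rfl) (key j hj hj' ht.symm) hij

theorem eq_of_mem (H : IsLinearization ids h l done cur) {o o' : RegOp Tid Id} (ho : o ∈ l)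
    (ho' : o' ∈ l) (hk : o.key = o'.key) : o = o' :=
  List.inj_on_of_nodup_map H.nodup ho ho' hk

theorem mem_of_mem_done (H : IsLinearization ids h l done cur) {p : Tid} {o : RegOp Tid Id}
    (ho : o ∈ done p) : o.inv ∈ h ∧ o.res ∈ h := by
  constructor <;> refine (mem_of_mem_restrict (p := p) ?_).1 <;> rw [H.hist] <;>
    exact List.mem_append_left _ (RegOp.mem_toHistory.2 ⟨o, ho, by simp⟩)

theorem inv_mem (H : IsLinearization ids h l done cur) {o : RegOp Tid Id} (ho : o ∈ l) :
    o.inv ∈ h := by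
  rcases H.mem_done o ho with hd | hc
  · exact (H.mem_of_mem_done hd).1
  · refine (mem_of_mem_restrict (p := o.key.1) ?_).1
    rw [H.hist]
    simp [hc]

theorem exists_of_responded (H : IsLinearization ids h l done cur) {k : Tid × Id}
    (hr : ∃ r ∈ h, r.isRes = true ∧ r.key = k) : ∃ o ∈ done k.1, o.key = k := by
  obtain ⟨r, hr, hr', rfl⟩ := hr
  obtain ⟨o, ho, rfl⟩ := H.exists_of_isRes hr hr'
  exact ⟨o, by simpa using ho, by simp⟩

theorem not_responded_of_cur (H : IsLinearization ids h l done cur) {p : Tid}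
    {a : RegAction Tid Id} (ha : cur p = some a) :
    ¬ ∃ r ∈ h, r.isRes = true ∧ r.key = a.key := by
  intro hr
  obtain ⟨o, ho, hk⟩ := H.exists_of_responded hr
  have ht := H.thread_of_cur ha
  have hk₁ : a.key.1 = p := by rw [← ht]; cases a <;> rfl
  have := H.nodup_keys p
  rw [ha, List.nodup_append] at this
  exact this.2.2 _ (List.mem_map_of_mem (hk₁ ▸ ho)) a.key (by simp) hk

/-- This is what makes late insertion possible: as far as real time is concerned, a pending
operation may stand after any other operation. -/
theorem not_precedes_of_cur (H : IsLinearization ids h l done cur) {p : Tid}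
    {a : RegAction Tid Id} (ha : cur p = some a) (k : Tid × Id) : ¬ Precedes h a.key k :=
  fun hp => H.not_responded_of_cur ha hp.exists_res

open Classical in
/-- The responses that complete the linearized pending operations. -/
noncomputable def responses (h : List (RegAction Tid Id)) (l : List (RegOp Tid Id)) :
    List (RegAction Tid Id) :=
  (l.filter fun o => ¬ Responded h o.inv).map RegOp.res

theorem mem_responses {r : RegAction Tid Id} :
    r ∈ responses h l ↔ ∃ o ∈ l, ¬ Responded h o.inv ∧ r = o.res := by
  simp only [responses, List.mem_map, List.mem_filter, decide_eq_true_eq, and_assoc]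
  exact exists_congr fun o => and_congr_right fun _ => and_congr_right fun _ => eq_comm

theorem cur_of_not_responded (H : IsLinearization ids h l done cur) {o : RegOp Tid Id}
    (ho : o ∈ l) (hr : ¬ Responded h o.inv) : cur o.key.1 = some o.inv :=
  (H.mem_done o ho).resolve_left fun hd => hr ⟨o.res, (H.mem_of_mem_done hd).2, by simp, by simp⟩

open Classical in
-- A thread has at most one pending operation, so at most one response is appended for it; this
-- keeps the completed history alternating.
theorem restrict_responses (H : IsLinearization ids h l done cur) (p : Tid) :
    restrict (responses h l) {a | a.thread = p} = [] ∨
      ∃ o : RegOp Tid Id, cur p = some o.inv ∧ restrict (responses h l) {a | a.thread = p} = [o.res] := by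
  have he : restrict (responses h l) {a | a.thread = p} =
      ((l.filter fun o => ¬ Responded h o.inv).filter fun o => o.key.1 = p).map RegOp.res := by
    rw [restrict, responses, List.filter_map]
    congr 1
    apply List.filter_congr
    intro o _
    simp
  rw [he]
  have hall : ∀ o ∈ (l.filter fun o => ¬ Responded h o.inv).filter fun o => o.key.1 = p,
      o ∈ l ∧ cur p = some o.inv := by
    intro o ho
    simp only [decide_not, List.mem_filter, Bool.not_eq_eq_eq_not, Bool.not_true,
      decide_eq_false_iff_not, decide_eq_true_eq] at ho
    exact ⟨ho.1.1, ho.2 ▸ H.cur_of_not_responded ho.1.1 ho.1.2⟩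
  have hn : ((l.filter fun o => ¬ Responded h o.inv).filter fun o => o.key.1 = p).Nodup :=
    (H.nodup.of_map.filter _).filter _
  generalize ((l.filter fun o => ¬ Responded h o.inv).filter fun o => o.key.1 = p) = m at hall hn
  rcases m with _ | ⟨o, _ | ⟨o', m⟩⟩
  · exact .inl rfl
  · exact .inr ⟨o, (hall o (by simp)).2, rfl⟩
  · obtain ⟨h₁, h₂⟩ := hall o (by simp)
    obtain ⟨h₃, h₄⟩ := hall o' (by simp)
    have : o.key = o'.key := by
      rw [← RegOp.key_inv, ← RegOp.key_inv, Option.some.inj (h₂.symm.trans h₄)]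
    simp [H.eq_of_mem h₁ h₃ this] at hn

theorem wellFormed (H : IsLinearization ids h l done cur) : WellFormed (h ++ responses h l) := by
  intro p
  have hr : restrict (h ++ responses h l) {a | a.thread = p} =
      RegOp.toHistory (done p) ++ ((cur p).toList ++
        restrict (responses h l) {a | a.thread = p}) := by
    rw [← List.append_assoc, ← H.hist]
    simp [restrict]
  have hc : ((cur p).toList.filter Action.isInv) = (cur p).toList :=
    List.filter_eq_self.2 fun a ha => H.isInv_cur p a (Option.mem_toList.1 ha)
  rw [hr]
  constructor
  · rw [RegOp.alternates_toHistory_append]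
    rcases H.restrict_responses p with h₁ | ⟨o, h₁, h₂⟩
    · rw [h₁]
      cases hcp : cur p with
      | none => trivial
      | some a => exact H.isInv_cur p a hcp
    · rw [h₁, h₂]
      have := (RegOp.alternates_toHistory_append (l := [o]) (h := [])).2 trivial
      simpa using this
  · have : (restrict (responses h l) {a | a.thread = p}).filter Action.isInv = [] := by
      rcases H.restrict_responses p with h₁ | ⟨o, h₁, h₂⟩
      · rw [h₁]; rfl
      · rw [h₂]; simp
    rw [List.filter_append, List.filter_append, hc, this, List.append_nil, List.map_append,
      RegOp.map_key_toHistory]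
    exact H.nodup_keys p

/-- Used for both sides of the comparison: the completed history and the sequential history of `l`.
-/
theorem operations_eq {g : List (RegAction Tid Id)} (hl : (l.map RegOp.key).Nodup)
    (hres : ∀ r ∈ g, r.isRes = true → ∃ o ∈ l, r = o.res)
    (hinv : ∀ i ∈ g, i.isInv = true → ∃ o ∈ l, i = o.inv)
    (hmem : ∀ o ∈ l, o.inv ∈ g ∧ o.res ∈ g) :
    operations g = {x | ∃ o ∈ l, x = (o.inv, some o.res)} := by
  ext ⟨i, r⟩
  constructor
  · rintro ⟨h₁, h₂, h₃⟩
    obtain ⟨o, ho, rfl⟩ := hinv i h₁ h₂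
    rcases h₃ with ⟨r, hr, hr', hk, rfl⟩ | ⟨hn, -⟩
    · obtain ⟨o', ho', rfl⟩ := hres r hr hr'
      obtain rfl : o' = o := List.inj_on_of_nodup_map hl ho' ho (by simpa using hk)
      exact ⟨o', ho, rfl⟩
    · exact absurd ⟨o.res, (hmem o ho).2, by simp, by simp⟩ hn
  · rintro ⟨o, ho, he⟩
    obtain ⟨rfl, rfl⟩ := Prod.mk.inj he
    exact ⟨(hmem o ho).1, by simp, .inl ⟨o.res, (hmem o ho).2, by simp, by simp, rfl⟩⟩

theorem operations_toHistory (hl : (l.map RegOp.key).Nodup) :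
    operations (RegOp.toHistory l) = {x | ∃ o ∈ l, x = (o.inv, some o.res)} := by
  refine operations_eq hl (fun r hr hr' => ?_) (fun i hi hi' => ?_) fun o ho =>
    ⟨RegOp.mem_toHistory.2 ⟨o, ho, .inl rfl⟩, RegOp.mem_toHistory.2 ⟨o, ho, .inr rfl⟩⟩
  · obtain ⟨o, ho, rfl | rfl⟩ := RegOp.mem_toHistory.1 hr
    · simp at hr'
    · exact ⟨o, ho, rfl⟩
  · obtain ⟨o, ho, rfl | rfl⟩ := RegOp.mem_toHistory.1 hi
    · exact ⟨o, ho, rfl⟩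
    · simp at hi'

/-- Pending operations that are in `l` receive their response from `responses`; those that are not
in `l` stay without one and are discarded by `completed`. -/
theorem operations_completed (H : IsLinearization ids h l done cur) :
    operations (completed (h ++ responses h l)) = {x | ∃ o ∈ l, x = (o.inv, some o.res)} := by
  have hc : ∀ {a}, a ∈ completed (h ++ responses h l) ↔
      a ∈ h ++ responses h l ∧ Responded (h ++ responses h l) a := by
    simp [completed, restrict, or_and_right]
  have hres : ∀ r ∈ h ++ responses h l, r.isRes = true → ∃ o ∈ l, r = o.res := by
    intro r hr hr'
    rcases List.mem_append.1 hr with hr | hr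
    · obtain ⟨o, ho, rfl⟩ := H.exists_of_isRes hr hr'
      exact ⟨o, H.done_subset _ o ho, rfl⟩
    · obtain ⟨o, ho, -, rfl⟩ := mem_responses.1 hr
      exact ⟨o, ho, rfl⟩
  have hinv : ∀ i ∈ h ++ responses h l, i.isInv = true → i ∈ h := by
    intro i hi hi'
    refine (List.mem_append.1 hi).resolve_right fun hr => ?_
    obtain ⟨o, -, -, rfl⟩ := mem_responses.1 hr
    simp at hi'
  have hmem : ∀ o ∈ l, o.res ∈ h ++ responses h l := by
    intro o ho
    by_cases hr : Responded h o.inv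
    · obtain ⟨o', ho', hk⟩ := H.exists_of_responded hr
      obtain rfl := H.eq_of_mem (H.done_subset _ _ ho') ho (by simpa using hk)
      exact List.mem_append_left _ (H.mem_of_mem_done ho').2
    · exact List.mem_append_right _ (mem_responses.2 ⟨o, ho, hr, rfl⟩)
  refine operations_eq H.nodup (fun r hr => hres r (hc.1 hr).1) (fun i hi hi' => ?_) fun o ho => ?_
  · obtain ⟨hi, r, hr, hr', hk⟩ := hc.1 hi
    obtain ⟨o, ho, rfl⟩ := hres r hr hr'
    exact ⟨o, ho, H.eq_of_key_eq (hinv i hi hi') (H.inv_mem ho) hi' (by simp) (by simp [← hk])⟩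
  · exact ⟨hc.2 ⟨List.mem_append_left _ (H.inv_mem ho), o.res, hmem o ho, by simp, by simp⟩,
      hc.2 ⟨hmem o ho, o.res, hmem o ho, by simp, by simp⟩⟩

theorem sublist_of_precedes (H : IsLinearization ids h l done cur) {a b : RegOp Tid Id}
    (ha : a ∈ l) (hb : b ∈ l) (hp : Precedes h a.key b.key) :
    [a.res, b.inv] <+ RegOp.toHistory l := by
  have hab : a ≠ b := by
    rintro rfl
    exact H.irrefl _ hp
  rcases pair_sublist_or ha hb hab with hs | hs
  · refine List.Sublist.trans ?_ (RegOp.toHistory_sublist hs)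
    exact (((List.nil_sublist [b.res]).cons_cons b.inv).cons_cons a.res).cons a.inv
  · have := H.pairwise.sublist hs
    simp only [List.pairwise_cons, List.mem_singleton, forall_eq] at this
    exact absurd hp this.1

theorem linearizesTo (H : IsLinearization ids h l done cur) :
    LinearizesTo h (RegOp.toHistory l) := by
  refine ⟨responses h l, fun r hr => ?_, H.wellFormed,
    H.operations_completed.trans (operations_toHistory H.nodup).symm, ?_⟩
  · obtain ⟨o, -, -, rfl⟩ := mem_responses.1 hr
    simp
  · rintro o₁ o₂ ⟨h₁, h₂, r, hr, hs⟩
    rw [RealTime, operations_toHistory H.nodup]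
    rw [H.operations_completed] at h₁ h₂
    obtain ⟨a, ha, rfl⟩ := id h₁
    obtain ⟨b, hb, rfl⟩ := id h₂
    obtain rfl := Option.some.inj hr
    refine ⟨h₁, h₂, a.res, rfl, H.sublist_of_precedes ha hb ⟨a.res, b.inv, by simp, by simp,
      by simp, by simp, ?_⟩⟩
    -- Only responses were appended, so a pair ending in an invocation already lies in `h`.
    obtain ⟨l₁, l₂, he, hl₁, hl₂⟩ := List.sublist_append_iff.1
      (hs.trans (List.filter_sublist (l := h ++ responses h l)))
    rcases List.eq_nil_or_concat l₂ with rfl | ⟨l₂, x, rfl⟩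
    · rw [List.append_nil] at he
      exact he ▸ hl₁
    · have hx : b.inv = x := by
        have := congrArg List.getLast? he
        simpa using this
      obtain ⟨o, -, -, ho⟩ := mem_responses.1 (hl₂.subset (by simp : x ∈ l₂.concat x))
      have := RegOp.isInv_inv b
      rw [hx, ho] at this
      simp at this

theorem mem_regSpec (H : IsLinearization ids h l done cur) :
    RegOp.toHistory l ∈ (regSpec Tid Id).histories := by
  refine ⟨⟨?_, ?_⟩, RegOp.regLegal_toHistory H.legal⟩
  · simpa using (RegOp.alternates_toHistory_append (l := l) (h := [])).2 trivial
  · rw [RegOp.map_key_toHistory]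
    exact H.nodup

/-! ### How linearizations evolve: insertion, invocation, response -/

theorem empty : IsLinearization (Tid := Tid) (Id := Id) (fun _ => []) [] [] (fun _ => [])
    (fun _ => none) where
  nodup_ids := by simp
  isInv_cur := by simp
  hist := by simp [restrict]
  keys := by simp
  done_subset := by simp
  mem_done := by simp
  nodup := by simp
  irrefl := by simp [Precedes]
  pairwise := by simp
  legal := trivial

theorem precedes_res (o : RegOp Tid Id) {k₁ k₂ : Tid × Id} :
    Precedes (h ++ [o.res]) k₁ k₂ ↔ Precedes h k₁ k₂ := by
  simp [precedes_concat]

/-- The inserted operation is pending and thus precedes nothing, so only the operations placed after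
it have to be checked against real time. -/
theorem insert {l₁ l₂ : List (RegOp Tid Id)} (H : IsLinearization ids h (l₁ ++ l₂) done cur)
    {o : RegOp Tid Id} (hp : cur o.key.1 = some o.inv) (ho : o.key ∉ (l₁ ++ l₂).map RegOp.key)
    (hl₂ : ∀ b ∈ l₂, ¬ Precedes h b.key o.key) (hl : RegOp.Legal 0 (l₁ ++ o :: l₂)) :
    IsLinearization ids h (l₁ ++ o :: l₂) done cur where
  nodup_ids := H.nodup_ids
  isInv_cur := H.isInv_cur
  hist := H.hist
  keys := H.keys
  done_subset := fun p o' ho' => by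
    have := H.done_subset p o' ho'
    simp only [List.mem_append, List.mem_cons] at this ⊢
    tauto
  mem_done := fun o' ho' => by
    simp only [List.mem_append, List.mem_cons] at ho'
    rcases ho' with ho' | rfl | ho'
    · exact H.mem_done _ (List.mem_append_left _ ho')
    · exact .inr hp
    · exact H.mem_done _ (List.mem_append_right _ ho')
  nodup := by
    have := H.nodup
    rw [List.map_append, List.map_cons, List.nodup_middle, List.nodup_cons, ← List.map_append]
    exact ⟨ho, this⟩
  irrefl := H.irrefl
  pairwise := by
    have h₁ := List.pairwise_append.1 H.pairwise
    have hcur : ∀ k, ¬ Precedes h o.key k := fun k => by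
      simpa using H.not_precedes_of_cur hp k
    rw [List.pairwise_append, List.pairwise_cons]
    refine ⟨h₁.1, ⟨hl₂, h₁.2.1⟩, fun a ha b hb => ?_⟩
    rcases List.mem_cons.1 hb with rfl | hb
    · exact hcur _
    · exact h₁.2.2 a ha b hb
  legal := hl

/-- The response rules of `DR` take the identifier from the state; this identifies it with that of
the pending invocation. -/
theorem getLast?_ids (H : IsLinearization ids h l done cur) {p : Tid} {a : RegAction Tid Id}
    {k k' : Id} (ha : cur p = some a) (hak : a.key = (p, k)) (hk : (ids p).getLast? = some k') :
    k' = k := by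
  have h₁ := congrArg List.getLast? (H.keys p)
  rw [List.getLast?_map, hk] at h₁
  simpa [ha, hak] using h₁.symm

open Function

theorem restrict_concat (a : RegAction Tid Id) (p : Tid) [Decidable (a.thread = p)] :
    restrict (h ++ [a]) {a | a.thread = p} =
      restrict h {a | a.thread = p} ++ if a.thread = p then [a] else [] := by
  simp [restrict, List.filter_append, List.filter_cons]

variable [DecidableEq Tid]

theorem invoke (H : IsLinearization ids h l done cur) {p : Tid} {k : Id} {a : RegAction Tid Id}
    (hp : cur p = none) (hk : k ∉ ids p) (ha : a.isInv = true) (hak : a.key = (p, k)) :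
    IsLinearization (update ids p (ids p ++ [k])) (h ++ [a]) l done (update cur p (some a)) := by
  have hat : a.thread = p := by
    have := congrArg Prod.fst hak
    cases a <;> exact this
  -- As `k` is fresh, no response and no linearized operation carries the new key, so the new
  -- invocation constrains no pair in `l`.
  have hr : ¬ ∃ r ∈ h, r.isRes = true ∧ r.key = (p, k) := by
    intro hr
    obtain ⟨o, ho, hok⟩ := H.exists_of_responded hr
    have : (p, k) ∈ (ids p).map (p, ·) := by
      rw [← H.keys, ← hok]
      exact List.mem_append_left _ (List.mem_map_of_mem ho)
    simp at this
    exact hk this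
  have hl : ∀ o ∈ l, o.key ≠ (p, k) := by
    intro o ho hok
    rcases H.mem_done o ho with hd | hc
    · exact hr ⟨o.res, (H.mem_of_mem_done hd).2, by simp, by simpa⟩
    · rw [hok, hp] at hc
      simp at hc
  constructor
  case nodup_ids =>
    intro q
    by_cases hq : q = p
    · subst hq
      rw [update_self]
      exact List.concat_eq_append ▸ (H.nodup_ids q).concat hk
    · rw [update_of_ne hq]
      exact H.nodup_ids q
  case isInv_cur =>
    intro q b hb
    by_cases hq : q = p
    · subst hq
      rw [update_self] at hb
      exact Option.some.inj hb ▸ ha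
    · rw [update_of_ne hq] at hb
      exact H.isInv_cur q b hb
  case hist =>
    intro q
    rw [restrict_concat, H.hist]
    by_cases hq : q = p
    · subst hq
      simp [hat, hp]
    · rw [update_of_ne hq, if_neg (hat ▸ Ne.symm hq), List.append_nil]
  case keys =>
    intro q
    by_cases hq : q = p
    · subst hq
      have := H.keys q
      simp only [hp, Option.toList_none, List.map_nil, List.append_nil] at this
      simp [hak, this]
    · rw [update_of_ne hq, update_of_ne hq]
      exact H.keys q
  case done_subset => exact H.done_subset
  case mem_done =>
    intro o ho
    refine (H.mem_done o ho).imp_right fun hc => ?_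
    rw [update_of_ne, hc]
    rintro hq
    rw [hq, hp] at hc
    simp at hc
  case nodup => exact H.nodup
  case irrefl =>
    intro k'
    rw [precedes_concat, hak]
    rintro (h₁ | ⟨-, rfl, h₂⟩)
    · exact H.irrefl _ h₁
    · exact hr h₂
  case pairwise =>
    refine H.pairwise.imp_of_mem fun {x y} hx hy hxy => ?_
    rw [precedes_concat, hak]
    rintro (h₁ | ⟨-, h₁, -⟩)
    · exact hxy h₁
    · exact hl x hx h₁.symm
  case legal => exact H.legal

theorem respond (H : IsLinearization ids h l done cur) {p : Tid} {o : RegOp Tid Id}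
    (hp : cur p = some o.inv) (ho : o ∈ l) :
    IsLinearization ids (h ++ [o.res]) l (update done p (done p ++ [o])) (update cur p none) := by
  have hop : o.key.1 = p := by
    rw [← RegOp.thread_inv]
    exact H.thread_of_cur hp
  constructor
  case nodup_ids => exact H.nodup_ids
  case isInv_cur =>
    intro q b hb
    by_cases hq : q = p
    · subst hq
      simp at hb
    · rw [update_of_ne hq] at hb
      exact H.isInv_cur q b hb
  case hist =>
    intro q
    rw [restrict_concat, H.hist]
    by_cases hq : q = p
    · subst hq
      simp [hop, hp]
    · rw [update_of_ne hq, update_of_ne hq, RegOp.thread_res, if_neg (hop ▸ Ne.symm hq),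
        List.append_nil]
  case keys =>
    intro q
    by_cases hq : q = p
    · subst hq
      have := H.keys q
      simpa [hp] using this
    · rw [update_of_ne hq, update_of_ne hq]
      exact H.keys q
  case done_subset =>
    intro q o' ho'
    by_cases hq : q = p
    · subst hq
      simp only [update_self, List.mem_append, List.mem_singleton] at ho'
      rcases ho' with ho' | rfl
      · exact H.done_subset q o' ho'
      · exact ho
    · rw [update_of_ne hq] at ho'
      exact H.done_subset q o' ho'
  case mem_done =>
    intro o' ho'
    by_cases hq : o'.key.1 = p
    · left
      rw [hq, update_self, List.mem_append, List.mem_singleton]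
      rcases H.mem_done o' ho' with hd | hc
      · exact .inl (hq ▸ hd)
      · rw [hq, hp] at hc
        exact .inr (H.eq_of_mem ho' ho
          (by rw [← RegOp.key_inv, ← RegOp.key_inv, Option.some.inj hc]))
    · rw [update_of_ne hq, update_of_ne hq]
      exact H.mem_done o' ho'
  case nodup => exact H.nodup
  case irrefl => exact fun k => by rw [precedes_res]; exact H.irrefl k
  case pairwise => simp only [precedes_res]; exact H.pairwise
  case legal => exact H.legal

end IsLinearization

end RegOps

/-! ## Decisive linearizability of `DR` -/

section DRLinearization

variable {Tid : Type u} {Id : Type v}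

/-- The linearization `l` has a prefix after which the register stores `x` and which contains all
operations that precede the operation with key `k`. -/
def Splits (h : List (RegAction Tid Id)) (l : List (RegOp Tid Id)) (k : Tid × Id) (x : ℕ) : Prop :=
  ∃ s₁ s₂, l = s₁ ++ s₂ ∧ RegOp.eval 0 s₁ = x ∧ ∀ b ∈ s₂, ¬ Precedes h b.key k

theorem Splits.of_history {h h' : List (RegAction Tid Id)} {l : List (RegOp Tid Id)}
    {k : Tid × Id} {x : ℕ} (H : Splits h l k x)
    (hh : ∀ k₁, Precedes h' k₁ k → Precedes h k₁ k) : Splits h' l k x := by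
  obtain ⟨s₁, s₂, h₁, h₂, h₃⟩ := H
  exact ⟨s₁, s₂, h₁, h₂, fun b hb hp => h₃ b hb (hh _ hp)⟩

/-- If `o` lands after the splitting prefix, it joins the rest, which is harmless because it does
not precede `k`. If it lands strictly inside, the operations following it in the prefix must hide
its effect. -/
theorem Splits.insert {h : List (RegAction Tid Id)} {a b : List (RegOp Tid Id)}
    {k : Tid × Id} {x : ℕ} (H : Splits h (a ++ b) k x) {o : RegOp Tid Id}
    (ho : ¬ Precedes h o.key k)
    (hev : ∀ c, c ≠ [] → c <+: b → ∀ x, RegOp.eval x (o :: c) = RegOp.eval x c) :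
    Splits h (a ++ o :: b) k x := by
  obtain ⟨s₁, s₂, h₁, rfl, h₃⟩ := H
  -- An insertion exactly at the split counts as after it: otherwise the prefix would end in `o` and
  -- a write could change its value.
  have hcase : (∃ d, a = s₁ ++ d ∧ s₂ = d ++ b) ∨
      ∃ c, c ≠ [] ∧ s₁ = a ++ c ∧ b = c ++ s₂ := by
    rcases List.append_eq_append_iff.1 h₁ with ⟨c, hc₁, hc₂⟩ | ⟨d, hd₁, hd₂⟩
    · by_cases hc : c = []
      · subst hc
        exact .inl ⟨[], by simpa using hc₁.symm, by simpa using hc₂.symm⟩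
      · exact .inr ⟨c, hc, hc₁, hc₂⟩
    · exact .inl ⟨d, hd₁, hd₂⟩
  rcases hcase with ⟨d, rfl, rfl⟩ | ⟨c, hc, rfl, rfl⟩
  · refine ⟨s₁, d ++ o :: b, by simp, rfl, fun x hx => ?_⟩
    simp only [List.mem_append, List.mem_cons] at hx
    rcases hx with hx | rfl | hx
    · exact h₃ x (by simp [hx])
    · exact ho
    · exact h₃ x (by simp [hx])
  · refine ⟨a ++ o :: c, s₂, by simp, ?_, h₃⟩
    rw [RegOp.eval_append, RegOp.eval_append, hev c hc (List.prefix_append _ _)]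

/-- A write at the head overwrites whatever is inserted before it; this makes a rolled-back write
invisible afterwards. -/
theorem RegOp.eval_cons_of_head {b c l : List (RegOp Tid Id)} {p : Tid} {k : Id} {n : ℕ}
    (hb : b = .write p k n :: l) (hc : c ≠ []) (hcb : c <+: b) (o : RegOp Tid Id) (x : ℕ) :
    RegOp.eval x (o :: c) = RegOp.eval x c := by
  rcases c with _ | ⟨y, c⟩
  · exact absurd rfl hc
  · rw [hb, List.cons_prefix_cons] at hcb
    rw [hcb.1]
    rfl

/-- The part of the invariant of `DR` about a single thread. -/
def DRLocalInv (pc : DRPc) (arg start version : ℕ) (vs : Set ℕ) (h : List (RegAction Tid Id))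
    (l top : List (RegOp Tid Id)) (cur : Option (RegAction Tid Id)) (p : Tid) : Prop :=
  match pc with
  | .main => cur = none
  | .rb => ∃ k, cur = some (.inv .read none p k) ∧ (p, k) ∉ l.map RegOp.key
  | .rl => ∃ k, cur = some (.inv .read none p k) ∧ (p, k) ∉ l.map RegOp.key ∧
      (start < version → ∀ o ∈ top, ¬ Precedes h o.key (p, k)) ∧ ∀ x ∈ vs, Splits h l (p, k) x
  | .re => ∃ k, cur = some (.inv .read none p k) ∧ .read p k arg ∈ l
  | .wb => ∃ k, cur = some (.inv .write (some arg) p k) ∧ (p, k) ∉ l.map RegOp.key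
  | .ww => ∃ k, cur = some (.inv .write (some arg) p k) ∧ (p, k) ∉ l.map RegOp.key ∧
      (start < version → ∀ o ∈ top, ¬ Precedes h o.key (p, k))
  | .wr | .we => ∃ k n, cur = some (.inv .write (some n) p k) ∧ .write p k n ∈ l

theorem DRLocalInv.of_history {pc : DRPc} {arg start version : ℕ} {vs : Set ℕ}
    {h h' : List (RegAction Tid Id)} {l top : List (RegOp Tid Id)}
    {cur : Option (RegAction Tid Id)} {p : Tid}
    (H : DRLocalInv pc arg start version vs h l top cur p)
    (hh : ∀ k₁ k, Precedes h' k₁ (p, k) → Precedes h k₁ (p, k)) :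
    DRLocalInv pc arg start version vs h' l top cur p := by
  cases pc <;> try exact H
  · obtain ⟨k, h₁, h₂, h₃⟩ := H
    exact ⟨k, h₁, h₂, fun hs o ho hp => h₃ hs o ho (hh _ _ hp)⟩
  · obtain ⟨k, h₁, h₂, h₃, h₄⟩ := H
    exact ⟨k, h₁, h₂, fun hs o ho hp => h₃ hs o ho (hh _ _ hp),
      fun x hx => (h₄ x hx).of_history fun k₁ => hh k₁ k⟩

/-- Covers all three ways to linearize. In the first case of `htop` the version may change freely,
since the new `top` holds nothing but the pending `o`, which precedes no operation; in the second,
`top` at most gains `o`. -/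
theorem DRLocalInv.insert {pc : DRPc} {arg start version version' : ℕ} {vs : Set ℕ}
    {h : List (RegAction Tid Id)} {a b top top' : List (RegOp Tid Id)}
    {cur : Option (RegAction Tid Id)} {p : Tid} {o : RegOp Tid Id}
    (H : DRLocalInv pc arg start version vs h (a ++ b) top cur p) (hne : p ≠ o.key.1)
    (ho : ∀ k, ¬ Precedes h o.key k)
    (hev : ∀ c, c ≠ [] → c <+: b → ∀ x, RegOp.eval x (o :: c) = RegOp.eval x c)
    (htop : (∀ x ∈ top', x = o) ∨ (version' = version ∧ ∀ x ∈ top', x = o ∨ x ∈ top)) :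
    DRLocalInv pc arg start version' vs h (a ++ o :: b) top' cur p := by
  have hnot : ∀ {k}, (p, k) ∉ (a ++ b).map RegOp.key → (p, k) ∉ (a ++ o :: b).map RegOp.key := by
    intro k hk
    simp only [List.map_append, List.map_cons, List.mem_append, List.mem_cons, not_or] at hk ⊢
    refine ⟨hk.1, ?_, hk.2⟩
    intro he
    exact hne (congrArg Prod.fst he)
  have hmem : ∀ {x}, x ∈ a ++ b → x ∈ a ++ o :: b := by
    intro x hx
    simp only [List.mem_append, List.mem_cons] at hx ⊢
    tauto
  have hfresh : ∀ {k}, (start < version → ∀ x ∈ top, ¬ Precedes h x.key (p, k)) →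
      start < version' → ∀ x ∈ top', ¬ Precedes h x.key (p, k) := by
    intro k hk hs x hx
    rcases htop with ht | ⟨rfl, ht⟩
    · rw [ht x hx]
      exact ho _
    · rcases ht x hx with rfl | hx'
      · exact ho _
      · exact hk hs x hx'
  cases pc with
  | main => exact H
  | wb | rb =>
    obtain ⟨k, h₁, h₂⟩ := H
    exact ⟨k, h₁, hnot h₂⟩
  | ww =>
    obtain ⟨k, h₁, h₂, h₃⟩ := H
    exact ⟨k, h₁, hnot h₂, hfresh h₃⟩
  | rl =>
    obtain ⟨k, h₁, h₂, h₃, h₄⟩ := H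
    exact ⟨k, h₁, hnot h₂, hfresh h₃, fun x hx => (h₄ x hx).insert (ho _) hev⟩
  | re =>
    obtain ⟨k, h₁, h₂⟩ := H
    exact ⟨k, h₁, hmem h₂⟩
  | wr | we =>
    obtain ⟨k, n, h₁, h₂⟩ := H
    exact ⟨k, n, h₁, hmem h₂⟩

/-- What the linearization of an execution of `DR` depends on: the history, the operations before
the last write that was not rolled back (`pre`) and those from this write on (`top`), the completed
operations and the pending invocation of each thread. -/
structure DRGhost (Tid : Type u) (Id : Type v) where
  hist : List (RegAction Tid Id)
  pre : List (RegOp Tid Id)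
  top : List (RegOp Tid Id)
  done : Tid → List (RegOp Tid Id)
  cur : Tid → Option (RegAction Tid Id)

/-- The linearization. -/
def DRGhost.lin (g : DRGhost Tid Id) : List (RegOp Tid Id) := g.pre ++ g.top

/-- The number of the last write that was not rolled back. -/
def DRState.version (q : DRState Tid Id) : ℕ := q.ver + q.lock.toNat

/-- With the lock free, the register stores the value of the whole linearization. With the lock
held, `top` is undone and it stores the value of `pre`, while the lock holder keeps the other value
in `arg`. Version `0` is the only case in which `top` need not start with a write. -/
structure DRInv (q : DRState Tid Id) (g : DRGhost Tid Id) : Prop where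
  lin : IsLinearization q.ids g.hist (g.pre ++ g.top) g.done g.cur
  val_pre : q.lock = true → q.val = RegOp.eval 0 g.pre
  val_lin : q.lock = false → q.val = RegOp.eval 0 (g.pre ++ g.top)
  top_head : (q.version = 0 ∧ g.top = []) ∨ ∃ p k n l, g.top = .write p k n :: l
  loc : ∀ p, DRLocalInv (q.pc p) (q.arg p) (q.start p) q.version (q.vs p) g.hist
    (g.pre ++ g.top) g.top (g.cur p) p
  wr : ∀ p, q.pc p = .wr → q.lock = true ∧ q.arg p = RegOp.eval 0 (g.pre ++ g.top)
  wr_unique : ∀ p p', q.pc p = .wr → q.pc p' = .wr → p = p'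

/-- The transition system in which linearizations grow by insertion. -/
def linearizationLTS (Tid : Type u) (Id : Type v) : LTS Unit where
  State := DRGhost Tid Id
  init := ⟨[], [], [], fun _ => [], fun _ => none⟩
  Tr := fun g _ g' => g.pre ++ g.top <+ g'.pre ++ g'.top

theorem linearizationLTS_sublist {e : List (linearizationLTS Tid Id).Transition}
    {g : DRGhost Tid Id} (he : (linearizationLTS Tid Id).IsPathFrom g e) :
    g.lin <+ ((linearizationLTS Tid Id).lastState g e).lin := by
  induction e generalizing g with
  | nil => exact List.Sublist.refl _
  | cons t e ih =>
    obtain ⟨rfl, he⟩ := he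
    exact t.valid.trans (ih he)

/-! ### Preservation of the invariant of `DR` -/

open Function

variable [DecidableEq Tid]

theorem DRInv.init : DRInv (DR Tid Id).init ⟨[], [], [], fun _ => [], fun _ => none⟩ where
  lin := IsLinearization.empty
  val_pre := fun h => by cases h
  val_lin := fun _ => rfl
  top_head := .inl ⟨rfl, rfl⟩
  loc := fun _ => rfl
  wr := fun _ h => by cases h
  wr_unique := fun _ _ h => by cases h

theorem DRInv.invoke {q : DRState Tid Id} {g : DRGhost Tid Id} (H : DRInv q g) {p : Tid} {k : Id}
    {a : RegAction Tid Id} {pc : DRPc} {arg : Tid → ℕ} (hpc : q.pc p = .main) (hk : k ∉ q.ids p)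
    (ha : a.isInv = true) (hak : a.key = (p, k)) (hwr : pc ≠ .wr)
    (harg : ∀ p', p' ≠ p → arg p' = q.arg p')
    (hloc : (p, k) ∉ (g.pre ++ g.top).map RegOp.key →
      DRLocalInv pc (arg p) (q.start p) q.version (q.vs p) (g.hist ++ [a]) (g.pre ++ g.top) g.top
        (some a) p) :
    DRInv { q with ids := update q.ids p (q.ids p ++ [k]), pc := update q.pc p pc, arg := arg }
      { g with hist := g.hist ++ [a], cur := update g.cur p (some a) } := by
  have hcur : g.cur p = none := by
    have := H.loc p
    rwa [hpc] at this
  have hnew : (p, k) ∉ (g.pre ++ g.top).map RegOp.key := by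
    intro hm
    obtain ⟨o, ho, hok⟩ := List.mem_map.1 hm
    rcases H.lin.mem_done o ho with hd | hc
    · have : o.key ∈ (q.ids p).map (p, ·) := by
        rw [← H.lin.keys]
        have : o.key.1 = p := by rw [hok]
        exact List.mem_append_left _ (List.mem_map_of_mem (this ▸ hd))
      rw [hok] at this
      simp at this
      exact hk this
    · rw [hok, hcur] at hc
      simp at hc
  have hne : ∀ {p'}, update q.pc p pc p' = .wr → p' ≠ p := by
    rintro p' hp' rfl
    rw [update_self] at hp'
    exact hwr hp'
  exact {
    lin := H.lin.invoke hcur hk ha hak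
    val_pre := H.val_pre
    val_lin := H.val_lin
    top_head := H.top_head
    loc := fun p' => by
      by_cases hp : p' = p
      · subst hp
        simp only [update_self]
        exact hloc hnew
      · simp only [update_of_ne hp, harg p' hp]
        refine (H.loc p').of_history fun k₁ k' h' => ?_
        rw [precedes_concat, hak] at h'
        exact h'.resolve_right fun h'' => hp (congrArg Prod.fst h''.2.1).symm
    wr := fun p' hp' => by
      have h₁ := hne hp'
      have h₂ := H.wr p' (by simpa [update_of_ne h₁] using hp')
      exact ⟨h₂.1, (harg p' h₁).trans h₂.2⟩
    wr_unique := fun p₁ p₂ h₁ h₂ => H.wr_unique p₁ p₂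
      (by simpa [update_of_ne (hne h₁)] using h₁) (by simpa [update_of_ne (hne h₂)] using h₂) }

theorem DRInv.respond {q : DRState Tid Id} {g : DRGhost Tid Id} (H : DRInv q g) {p : Tid}
    {o : RegOp Tid Id} (hcur : g.cur p = some o.inv) (ho : o ∈ g.pre ++ g.top) :
    DRInv { q with pc := update q.pc p .main, vs := update q.vs p ∅,
                   start := update q.start p 0, arg := update q.arg p 0 }
      { g with hist := g.hist ++ [o.res], done := update g.done p (g.done p ++ [o]),
               cur := update g.cur p none } := by
  have hne : ∀ {p'}, update q.pc p .main p' = .wr → p' ≠ p := by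
    rintro p' hp' rfl
    rw [update_self] at hp'
    cases hp'
  exact {
    lin := H.lin.respond hcur ho
    val_pre := H.val_pre
    val_lin := H.val_lin
    top_head := H.top_head
    loc := fun p' => by
      by_cases hp : p' = p
      · subst hp
        simp [DRLocalInv]
      · simp only [update_of_ne hp]
        exact (H.loc p').of_history fun k₁ k' h' => IsLinearization.precedes_res o |>.1 h'
    wr := fun p' hp' => by
      have h₁ := hne hp'
      have h₂ := H.wr p' (by simpa [update_of_ne h₁] using hp')
      exact ⟨h₂.1, by simpa [update_of_ne h₁] using h₂.2⟩
    wr_unique := fun p₁ p₂ h₁ h₂ => H.wr_unique p₁ p₂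
      (by simpa [update_of_ne (hne h₁)] using h₁) (by simpa [update_of_ne (hne h₂)] using h₂) }

/-- Steps that change neither the history nor the linearization nor the shared variables. -/
theorem DRInv.local_step {q : DRState Tid Id} {g : DRGhost Tid Id} (H : DRInv q g) {p : Tid}
    {pc : DRPc} {vs : Tid → Set ℕ} {start : Tid → ℕ} (hwr : pc ≠ .wr)
    (hvs : ∀ p', p' ≠ p → vs p' = q.vs p') (hstart : ∀ p', p' ≠ p → start p' = q.start p')
    (hloc : DRLocalInv pc (q.arg p) (start p) q.version (vs p) g.hist (g.pre ++ g.top) g.top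
      (g.cur p) p) :
    DRInv { q with pc := update q.pc p pc, vs := vs, start := start } g := by
  have hne : ∀ {p'}, update q.pc p pc p' = .wr → p' ≠ p := by
    rintro p' hp' rfl
    rw [update_self] at hp'
    exact hwr hp'
  exact {
    lin := H.lin
    val_pre := H.val_pre
    val_lin := H.val_lin
    top_head := H.top_head
    loc := fun p' => by
      by_cases hp : p' = p
      · subst hp
        simp only [update_self]
        exact hloc
      · simp only [update_of_ne hp, hvs p' hp, hstart p' hp]
        exact H.loc p'
    wr := fun p' hp' => H.wr p' (by simpa [update_of_ne (hne hp')] using hp')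
    wr_unique := fun p₁ p₂ h₁ h₂ => H.wr_unique p₁ p₂
      (by simpa [update_of_ne (hne h₁)] using h₁) (by simpa [update_of_ne (hne h₂)] using h₂) }

/-- The read is inserted at the split of the value it returns. That makes it legal, puts it after
all its predecessors, and changes no value. -/
theorem DRInv.pick {q : DRState Tid Id} {g : DRGhost Tid Id} (H : DRInv q g) {p : Tid} {k : Id}
    {out : ℕ} (hpc : q.pc p = .rl) (hcur : g.cur p = some (.inv .read none p k))
    (hk : (p, k) ∉ (g.pre ++ g.top).map RegOp.key)
    (hs : Splits g.hist (g.pre ++ g.top) (p, k) out) :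
    ∃ pre top, DRInv { q with pc := update q.pc p .re, arg := update q.arg p out }
      { g with pre := pre, top := top } ∧ g.pre ++ g.top <+ pre ++ top := by
  obtain ⟨s₁, s₂, h₁, h₂, h₃⟩ := hs
  obtain ⟨pre, top, ht₁, ht₂, ht₃, ht₄⟩ : ∃ pre top,
      pre ++ top = s₁ ++ RegOp.read p k out :: s₂ ∧ RegOp.eval 0 pre = RegOp.eval 0 g.pre ∧
      (∀ x ∈ top, x = RegOp.read p k out ∨ x ∈ g.top) ∧
      ((q.version = 0 ∧ top = []) ∨ ∃ p k n l, top = .write p k n :: l) := by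
    -- A split at the border puts the read at the end of `pre`, because `top` must keep its write at
    -- the head.
    have hcase : (∃ d, g.pre = s₁ ++ d ∧ s₂ = d ++ g.top) ∨
        ∃ y c, s₁ = g.pre ++ y :: c ∧ g.top = y :: c ++ s₂ := by
      rcases List.append_eq_append_iff.1 h₁ with ⟨_ | ⟨y, c⟩, hc₁, hc₂⟩ | ⟨d, hd₁, hd₂⟩
      · exact .inl ⟨[], by simpa using hc₁.symm, by simpa using hc₂.symm⟩
      · exact .inr ⟨y, c, hc₁, hc₂⟩
      · exact .inl ⟨d, hd₁, hd₂⟩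
    rcases hcase with ⟨d, hd₁, rfl⟩ | ⟨y, c, rfl, hc₂⟩
    · refine ⟨s₁ ++ RegOp.read p k out :: d, g.top, by simp, ?_, fun x hx => .inr hx, H.top_head⟩
      rw [hd₁, RegOp.eval_append, RegOp.eval_append]
      rfl
    · refine ⟨g.pre, y :: c ++ RegOp.read p k out :: s₂, by simp, rfl, fun x hx => ?_, .inr ?_⟩
      · rw [hc₂]
        simp only [List.mem_append, List.mem_cons] at hx ⊢
        tauto
      · rcases H.top_head with ⟨-, h⟩ | ⟨p', k', n', l', h⟩
        · simp [h] at hc₂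
        · rw [h, List.cons_append, List.cons.injEq] at hc₂
          exact ⟨p', k', n', _, by rw [← hc₂.1]; rfl⟩
  have heval : ∀ x, RegOp.eval x (s₁ ++ RegOp.read p k out :: s₂) = RegOp.eval x (s₁ ++ s₂) := by
    intro x
    rw [RegOp.eval_append, RegOp.eval_append]
    rfl
  have hlin : IsLinearization q.ids g.hist (pre ++ top) g.done g.cur := by
    rw [ht₁]
    refine (h₁ ▸ H.lin).insert hcur (h₁ ▸ hk) h₃ ?_
    have := (RegOp.legal_append _ _ _).1 (h₁ ▸ H.lin.legal)
    exact (RegOp.legal_append _ _ _).2 ⟨this.1, h₂.symm, this.2⟩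
  have hne : ∀ {p'}, update q.pc p .re p' = .wr → p' ≠ p := by
    rintro p' hp' rfl
    rw [update_self] at hp'
    cases hp'
  refine ⟨pre, top, ?_, ?_⟩
  · exact {
      lin := hlin
      val_pre := fun h => (H.val_pre h).trans ht₂.symm
      val_lin := fun h => by
        simp only [ht₁, heval, ← h₁]
        exact H.val_lin h
      top_head := ht₄
      loc := fun p' => by
        by_cases hp : p' = p
        · subst hp
          simp only [update_self]
          exact ⟨k, hcur, by simp [ht₁]⟩
        · simp only [update_of_ne hp]
          have := H.loc p'
          rw [h₁] at this
          rw [ht₁]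
          refine this.insert hp (H.lin.not_precedes_of_cur hcur) (fun _ _ _ _ => rfl)
            (.inr ⟨rfl, ht₃⟩)
      wr := fun p' hp' => by
        have h' := hne hp'
        have := H.wr p' (by simpa [update_of_ne h'] using hp')
        simp only [ht₁, heval, ← h₁, update_of_ne h']
        exact this
      wr_unique := fun p₁ p₂ h₁ h₂ => H.wr_unique p₁ p₂
        (by simpa [update_of_ne (hne h₁)] using h₁) (by simpa [update_of_ne (hne h₂)] using h₂) }
  · rw [h₁, ht₁]
    exact (List.Sublist.refl s₁).append (List.sublist_cons_self _ _)

/-- Everything linearized so far moves into `pre`, and the new write alone forms `top`. -/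
theorem DRInv.top {q : DRState Tid Id} {g : DRGhost Tid Id} (H : DRInv q g) {p : Tid}
    (hpc : q.pc p = .ww) (hl : q.lock = false) :
    ∃ pre top, DRInv { q with val := q.arg p, ver := q.ver + 1, pc := update q.pc p .we }
      { g with pre := pre, top := top } ∧ g.pre ++ g.top <+ pre ++ top := by
  have hloc := H.loc p
  rw [hpc] at hloc
  obtain ⟨k, hcur, hk, -⟩ := hloc
  have hwr : ∀ {p'}, update q.pc p .we p' ≠ .wr := by
    intro p' hp'
    by_cases hp : p' = p
    · subst hp
      rw [update_self] at hp'
      cases hp'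
    · rw [update_of_ne hp] at hp'
      have := (H.wr p' hp').1
      simp [hl] at this
  refine ⟨g.pre ++ g.top, [.write p k (q.arg p)], ?_, List.sublist_append_left _ _⟩
  exact {
    lin := by
      have := H.lin
      rw [← List.append_nil (g.pre ++ g.top)] at this hk
      exact this.insert hcur hk (by simp) ((RegOp.legal_append _ _ _).2 ⟨H.lin.legal, trivial⟩)
    val_pre := fun h => by simp [hl] at h
    val_lin := fun _ => by rw [RegOp.eval_append]; rfl
    top_head := .inr ⟨_, _, _, _, rfl⟩
    loc := fun p' => by
      by_cases hp : p' = p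
      · subst hp
        simp only [update_self]
        exact ⟨k, _, hcur, by simp⟩
      · simp only [update_of_ne hp]
        have := H.loc p'
        rw [← List.append_nil (g.pre ++ g.top)] at this
        refine this.insert hp (H.lin.not_precedes_of_cur hcur)
          (fun c hc hc' => absurd (List.prefix_nil.1 hc') hc) (.inl (by simp))
    wr := fun p' hp' => absurd hp' hwr
    wr_unique := fun p₁ p₂ h₁ h₂ => absurd h₁ hwr }

/-- The write becomes the last element of `pre`. The guard on the version says that `top` is younger
than the write, so no operation in `top` precedes it. -/
theorem DRInv.rollBack {q : DRState Tid Id} {g : DRGhost Tid Id} (H : DRInv q g) {p : Tid}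
    (hpc : q.pc p = .ww) (hl : q.lock = false) (hver : q.start p < q.ver) :
    ∃ pre top, DRInv { q with val := q.arg p, ver := q.ver - 1, lock := true,
                              pc := update q.pc p .wr, arg := update q.arg p q.val }
      { g with pre := pre, top := top } ∧ g.pre ++ g.top <+ pre ++ top := by
  have hloc := H.loc p
  rw [hpc] at hloc
  obtain ⟨k, hcur, hk, hfresh⟩ := hloc
  have hv : q.version = q.ver := by simp [DRState.version, hl]
  -- The guard makes the version positive, so there is a write to roll back.
  obtain ⟨p₀, k₀, n₀, l, htop⟩ := H.top_head.resolve_left fun h => by omega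
  have hwr : ∀ {p'}, update q.pc p .wr p' = .wr → p' = p := by
    intro p' hp'
    by_contra hp
    rw [update_of_ne hp] at hp'
    have := (H.wr p' hp').1
    simp [hl] at this
  have hev : ∀ c, c ≠ [] → c <+: g.top → ∀ x,
      RegOp.eval x (.write p k (q.arg p) :: c) = RegOp.eval x c :=
    fun c hc hc' x => RegOp.eval_cons_of_head htop hc hc' _ _
  have heval : RegOp.eval 0 (g.pre ++ .write p k (q.arg p) :: g.top) =
      RegOp.eval 0 (g.pre ++ g.top) := by
    rw [RegOp.eval_append, RegOp.eval_append, hev _ (by simp [htop]) (List.prefix_refl _)]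
  refine ⟨g.pre ++ [.write p k (q.arg p)], g.top, ?_, by simp⟩
  exact {
    lin := by
      have := H.lin.insert (o := .write p k (q.arg p)) hcur hk (hfresh (hv ▸ hver)) (by
        have := (RegOp.legal_append _ _ _).1 H.lin.legal
        refine (RegOp.legal_append _ _ _).2 ⟨this.1, ?_⟩
        rw [htop] at this ⊢
        exact this.2)
      simpa using this
    val_pre := fun _ => by rw [RegOp.eval_append]; rfl
    val_lin := fun h => by cases h
    top_head := .inr ⟨_, _, _, _, htop⟩
    loc := fun p' => by
      -- The held lock compensates the decrement; the truncated subtraction is exact since `q.ver`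
      -- is positive.
      have hv' : DRState.version
          { q with
            val := q.arg p, ver := q.ver - 1, lock := true
            pc := update q.pc p .wr, arg := update q.arg p q.val } = q.version := by
        simp only [DRState.version, hl, Bool.toNat_true, Bool.toNat_false]
        omega
      rw [hv']
      by_cases hp : p' = p
      · subst hp
        simp only [update_self]
        exact ⟨k, _, hcur, by simp⟩
      · simp only [update_of_ne hp]
        have := (H.loc p').insert (o := .write p k (q.arg p)) (top' := g.top) hp
          (H.lin.not_precedes_of_cur hcur) hev (.inr ⟨rfl, fun x hx => .inr hx⟩)
        simpa using this
    wr := fun p' hp' => by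
      obtain rfl := hwr hp'
      have := H.val_lin hl
      refine ⟨rfl, ?_⟩
      simp only [update_self, this, ← heval]
      simp
    wr_unique := fun p₁ p₂ h₁ h₂ => (hwr h₁).trans (hwr h₂).symm }

theorem DRInv.rollForward {q : DRState Tid Id} {g : DRGhost Tid Id} (H : DRInv q g) {p : Tid}
    (hpc : q.pc p = .wr) :
    DRInv { q with val := q.arg p, ver := q.ver + 1, lock := false, pc := update q.pc p .we } g := by
  obtain ⟨hl, harg⟩ := H.wr p hpc
  have hwr : ∀ {p'}, update q.pc p .we p' ≠ .wr := by
    intro p' hp'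
    by_cases hp : p' = p
    · subst hp
      rw [update_self] at hp'
      cases hp'
    · rw [update_of_ne hp] at hp'
      exact hp (H.wr_unique p' p hp' hpc)
  have hv' : DRState.version
      { q with val := q.arg p, ver := q.ver + 1, lock := false, pc := update q.pc p .we } =
        q.version := by
    simp [DRState.version, hl]
  exact {
    lin := H.lin
    val_pre := fun h => by cases h
    val_lin := fun _ => harg
    top_head := by rw [hv']; exact H.top_head
    loc := fun p' => by
      rw [hv']
      by_cases hp : p' = p
      · subst hp
        have := H.loc p'
        rw [hpc] at this
        simpa [DRLocalInv] using this
      · simp only [update_of_ne hp]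
        exact H.loc p'
    wr := fun p' hp' => absurd hp' hwr
    wr_unique := fun p₁ p₂ h₁ h₂ => absurd h₁ hwr }

theorem DRInv.step {q q' : DRState Tid Id} {g : DRGhost Tid Id} {a : RegLabel Tid Id}
    (H : DRInv q g) (hs : DRStep q a q') :
    ∃ g', DRInv q' g' ∧ g'.hist = g.hist ++ [a].filterMap Sum.getLeft? ∧
      g.pre ++ g.top <+ g'.pre ++ g'.top := by
  cases hs with
  | readInv p k hpc hk =>
    exact ⟨_, H.invoke (arg := q.arg) hpc hk rfl rfl (by simp) (fun _ _ => rfl)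
      fun hnew => ⟨k, rfl, hnew⟩, rfl, List.Sublist.refl _⟩
  | writeInv p k n hpc hk =>
    exact ⟨_, H.invoke hpc hk rfl rfl (by simp) (fun p' hp => by rw [update_of_ne hp])
      fun hnew => ⟨k, by rw [update_self], hnew⟩, rfl, List.Sublist.refl _⟩
  | readInit p hpc hl =>
    refine ⟨g, H.local_step (by simp) (fun p' hp => update_of_ne hp _ _)
      (fun p' hp => update_of_ne hp _ _) ?_, by simp, List.Sublist.refl _⟩
    have := H.loc p
    rw [hpc] at this
    obtain ⟨k, h₁, h₂⟩ := this
    -- With the lock free, `start` equals the version, so the freshness clause is vacuous; the first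
    -- collected value belongs to the whole linearization.
    refine ⟨k, h₁, h₂, fun h => ?_, fun x hx => ?_⟩
    · simp [DRState.version, hl] at h
    · rw [update_self] at hx
      exact ⟨_, [], (List.append_nil _).symm, (H.val_lin hl).symm.trans hx.symm, by simp⟩
  | readLoop p hpc hv hver =>
    have hloc := H.loc p
    rw [hpc] at hloc
    obtain ⟨k, h₁, h₂, h₃, h₄⟩ := hloc
    have := H.local_step (p := p) (pc := .rl) (vs := update q.vs p (q.vs p ∪ {q.val}))
      (start := q.start) (by simp) (fun p' hp => update_of_ne hp _ _) (fun _ _ => rfl)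
      ⟨k, h₁, h₂, h₃, fun x hx => ?_⟩
    · rw [← hpc, update_eq_self] at this
      exact ⟨g, this, by simp, List.Sublist.refl _⟩
    · rw [update_self] at hx
      rcases hx with hx | rfl
      · exact h₄ x hx
      · cases hl : q.lock with
        | false => exact ⟨_, [], (List.append_nil _).symm, (H.val_lin hl).symm, by simp⟩
        | true =>
          -- During a rollback the version is `ver + 1`, so the loop guard `start ≤ ver` says that
          -- `top` is younger than the read, which may then be placed before it.
          refine ⟨g.pre, g.top, rfl, (H.val_pre hl).symm, h₃ ?_⟩
          simp only [DRState.version, hl, Bool.toNat_true]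
          omega
  | readPick p out hpc hv =>
    have hloc := H.loc p
    rw [hpc] at hloc
    obtain ⟨k, h₁, h₂, -, h₄⟩ := hloc
    obtain ⟨pre, top, h, hsub⟩ := H.pick hpc h₁ h₂ (h₄ out hv)
    exact ⟨_, h, by simp, hsub⟩
  | readRes p k hpc hk =>
    have hloc := H.loc p
    rw [hpc] at hloc
    obtain ⟨k', h₁, h₂⟩ := hloc
    obtain rfl := H.lin.getLast?_ids h₁ rfl hk
    exact ⟨_, H.respond (o := .read p k (q.arg p)) h₁ h₂, rfl, List.Sublist.refl _⟩
  | writeInit p hpc hl =>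
    have := H.local_step (p := p) (pc := .ww) (vs := q.vs) (start := update q.start p q.ver)
      (by simp) (fun _ _ => rfl) (fun p' hp => update_of_ne hp _ _) (by
        have := H.loc p
        rw [hpc] at this
        obtain ⟨k, h₁, h₂⟩ := this
        exact ⟨k, h₁, h₂, fun h => by simp [DRState.version, hl] at h⟩)
    exact ⟨g, this, by simp, List.Sublist.refl _⟩
  | writeTop p hpc hl =>
    obtain ⟨pre, top, h, hsub⟩ := H.top hpc hl
    exact ⟨_, h, by simp, hsub⟩
  | writeRollBack p hpc hver hl =>
    obtain ⟨pre, top, h, hsub⟩ := H.rollBack hpc hl hver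
    exact ⟨_, h, by simp, hsub⟩
  | writeRollForward p hpc hl => exact ⟨g, H.rollForward hpc, by simp, List.Sublist.refl _⟩
  | writeRes p k hpc hk =>
    have hloc := H.loc p
    rw [hpc] at hloc
    obtain ⟨k', n, h₁, h₂⟩ := hloc
    obtain rfl := H.lin.getLast?_ids h₁ rfl hk
    exact ⟨_, H.respond (o := .write p k n) h₁ h₂, rfl, List.Sublist.refl _⟩

/-- Treating the growth of linearizations as a transition system lets `LTS.exists_path_map` choose
all of them coherently, with `DRInv` as the relation. -/
theorem DR_decisivelyLinearizable : DecisivelyLinearizable (DR Tid Id) (regSpec Tid Id) := by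
  obtain ⟨f, hf₀, hf₁, hf₂⟩ := LTS.exists_path_map (A := DR Tid Id)
    (B := linearizationLTS Tid Id) (R := DRInv)
    (Good := fun t g ρ => DRGhost.hist ((linearizationLTS Tid Id).lastState g ρ) =
      DRGhost.hist g ++ [t.label].filterMap Sum.getLeft?) DRInv.init (by
      intro t g hg
      obtain ⟨g', h₁, h₂, h₃⟩ := hg.step t.valid
      exact ⟨[⟨g, (), g', h₃⟩], ⟨rfl, trivial⟩, h₁, h₂⟩)
  let G : (DR Tid Id).Execution → DRGhost Tid Id := fun e =>
    (linearizationLTS Tid Id).lastState (linearizationLTS Tid Id).init (f e.1)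
  have hhist : ∀ e, (G e).hist = history e := by
    rintro ⟨e, he⟩
    simp only [history, LTS.Execution.trace]
    induction e using List.reverseRecOn with
    | nil => simp [G, hf₀, LTS.lastState, linearizationLTS]
    | append_singleton e t ih =>
      obtain ⟨ρ, h₁, h₂⟩ := hf₂ e t he
      have := ih (he.of_prefix (List.prefix_append _ _))
      simp only [G] at this ⊢
      rw [h₁, LTS.lastState_append, h₂, this]
      simp
  refine ⟨fun e => RegOp.toHistory (G e).lin, fun e => ?_, fun e₁ e₂ h => ?_⟩
  · have H : DRInv _ (G e) := (hf₁ e.1 e.2).2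
    exact ⟨H.lin.mem_regSpec, hhist e ▸ H.lin.linearizesTo⟩
  · refine RegOp.toHistory_sublist ?_
    have hp : f e₁.1 <+: f e₂.1 := by
      refine prefix_map_of_extends (D := (DR Tid Id).IsPathFrom (DR Tid Id).init)
        (fun _ _ h' hp => h'.of_prefix hp) (fun e t he => ?_) e₂.2 h
      obtain ⟨ρ, h₁, -⟩ := hf₂ e t he
      exact h₁ ▸ List.prefix_append _ _
    obtain ⟨ρ, hρ⟩ := hp
    have h₂ := (hf₁ e₂.1 e₂.2).1
    simp only [G]
    rw [← hρ] at h₂ ⊢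
    rw [LTS.lastState_append]
    exact linearizationLTS_sublist ((LTS.isPathFrom_append _ _ _ _).1 h₂).2

end DRLinearization

/-! ## The forward simulation from `ABD` to `DR` -/

/-! ### Majorities -/

section Quorums

variable {Tid : Type u} [Fintype Tid]

theorem Quorum.mono {α : Type v} {A B : Set α} (hA : Quorum Tid A) (h : A ⊆ B) : Quorum Tid B :=
  lt_of_lt_of_le hA (mul_le_mul_right (Set.encard_le_encard h) 2)

theorem Quorum.of_image {α : Type v} {A : Set Tid} {f : Tid → α} (h : Quorum Tid (f '' A)) :
    Quorum Tid A :=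
  lt_of_lt_of_le h (mul_le_mul_right (Set.encard_image_le f A) 2)

theorem Quorum.inter {A B : Set Tid} (hA : Quorum Tid A) (hB : Quorum Tid B) :
    ∃ s ∈ A, s ∈ B := by
  by_contra! h
  have hd : Disjoint A B := Set.disjoint_left.2 h
  have hle : (A ∪ B).encard ≤ Fintype.card Tid := by
    rw [← ENat.card_eq_coe_fintype_card, ← Set.encard_univ]
    exact Set.encard_le_encard (Set.subset_univ _)
  rw [Set.encard_union_eq hd] at hle
  have hfA : A.Finite := Set.toFinite A
  have hfB : B.Finite := Set.toFinite B
  unfold Quorum at hA hB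
  rw [← hfA.cast_ncard_eq] at hA hle
  rw [← hfB.cast_ncard_eq] at hB hle
  norm_cast at hA hB hle
  omega

/-- Without threads there is no quorum at all, hence the guard `Nonempty Tid` in `ABDSim`. -/
theorem quorum_univ [Nonempty Tid] : Quorum Tid (Set.univ : Set Tid) := by
  have : 0 < Fintype.card Tid := Fintype.card_pos
  rw [Quorum, Set.encard_univ, ENat.card_eq_coe_fintype_card]
  norm_cast
  omega

end Quorums

theorem DRStep.steps {Tid : Type u} {Id : Type v} [DecidableEq Tid] {r r' : DRState Tid Id}
    {a : RegLabel Tid Id} (h : DRStep r a r') : (DR Tid Id).Steps r [a] r' :=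
  .cons h (.nil _)

/-! ### Letting concurrent reads of `DR` catch up -/

section Collect

variable {Tid : Type u} {Id : Type v} [Fintype Tid] [DecidableEq Tid]

/-- All concurrent reads that may collect the current value of the register can do so. -/
theorem DR_collect (r : DRState Tid Id) :
    ∃ vs ρ, (DR Tid Id).Steps r ρ { r with vs := vs } ∧ ρ.filterMap Sum.getLeft? = [] ∧
      (∀ p, r.vs p ⊆ vs p) ∧
      ∀ p, r.pc p = .rl → r.start p ≤ r.ver → r.val ∈ vs p := by
  suffices h : ∀ F : Finset Tid, ∃ vs ρ, (DR Tid Id).Steps r ρ { r with vs := vs } ∧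
      ρ.filterMap Sum.getLeft? = [] ∧ (∀ p, r.vs p ⊆ vs p) ∧
      ∀ p ∈ F, r.pc p = .rl → r.start p ≤ r.ver → r.val ∈ vs p by
    simpa using h Finset.univ
  intro F
  induction F using Finset.induction_on with
  | empty => exact ⟨r.vs, [], .nil _, rfl, fun _ => subset_rfl, by simp⟩
  | insert p F hp ih =>
    obtain ⟨vs, ρ, h₁, h₂, h₃, h₄⟩ := ih
    -- The loop rule refuses a value that was collected before; then no step is needed.
    by_cases hc : r.pc p = .rl ∧ r.start p ≤ r.ver ∧ r.val ∉ vs p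
    · refine ⟨Function.update vs p (vs p ∪ {r.val}), ρ ++ [.inr p],
        h₁.trans (DRStep.steps (DRStep.readLoop { r with vs := vs } p hc.1 hc.2.2 hc.2.1)),
        by simp [h₂], fun p' => ?_, fun p' hp' hpc hs => ?_⟩ <;> by_cases he : p' = p
      · subst he
        rw [Function.update_self]
        exact (h₃ p').trans Set.subset_union_left
      · rw [Function.update_of_ne he]
        exact h₃ p'
      · subst he
        simp
      · rw [Function.update_of_ne he]
        exact h₄ p' ((Finset.mem_insert.1 hp').resolve_left he) hpc hs
    · refine ⟨vs, ρ, h₁, h₂, h₃, fun p' hp' hpc hs => ?_⟩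
      rcases Finset.mem_insert.1 hp' with rfl | hp'
      · by_contra hv
        exact hc ⟨hpc, hs, hv⟩
      · exact h₄ p' hp' hpc hs

end Collect

/-! ### The simulation relation and the linearization of writes -/

section ABDSimulation

variable {Tid : Type u} {Id : Type v} [Fintype Tid] [LinearOrder Tid]

/-- The history-dependent part of the simulation relation. -/
structure ABDGhost (Tid : Type u) where
  /-- the largest timestamp that was linearized -/
  top : TS Tid
  /-- the timestamped values whose writes were linearized -/
  lin : Set (ℕ × TS Tid)
  /-- the value of `top` when the current operation of a thread sent its query -/
  low : Tid → TS Tid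
  /-- the timestamped value of the current write of a thread -/
  wr : Tid → ℕ × TS Tid

/-- The timestamped value was linearized or belongs to a write in its second phase. -/
def Avail (q : ABDState Tid Id) (g : ABDGhost Tid) (x : ℕ × TS Tid) : Prop :=
  x ∈ g.lin ∨ ∃ p, q.pc p = .wu ∧ g.wr p = x

/-- Rules ending the second phase accept any update message of the current operation. This condition
before that phase ensures that the message sent on entering it is the only one. -/
def NoUpdate (q : ABDState Tid Id) (p : Tid) : Prop :=
  ∀ k x X, (q.ids p).getLast? = some k → q.msgs (.update p k x) ≠ some X

/-- `G` is a quorum that already stored `low p` or more when the query was sent. Stored timestamps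
only grow, so every reply from `G` is at least `low p`. -/
def QueryInv (q : ABDState Tid Id) (g : ABDGhost Tid) (p : Tid) : Prop :=
  ∃ G : Set Tid, Quorum Tid G ∧ (∀ s ∈ G, g.low p ≤ (q.tval s).2) ∧
    ∀ k X, (q.ids p).getLast? = some k → q.msgs (.query p k) = some X →
      ∀ s ∈ G, ∀ x, Ack.reply s x ∈ X → g.low p ≤ x.2

/-- The strict inequality leaves room for a decrement of the version: it enables a rollback by a
write, and a read's loop step during a rollback. -/
def StartInv (r : DRState Tid Id) (g : ABDGhost Tid) (p : Tid) : Prop :=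
  r.start p ≤ r.ver ∧ (g.low p < g.top → r.start p < r.ver)

/-- A read in `ABD` can only return a timestamp of at least `low p`; all linearized candidates are
therefore kept ready in `DR`. -/
def ReadInv (r : DRState Tid Id) (g : ABDGhost Tid) (p : Tid) : Prop :=
  StartInv r g p ∧ ∀ x ∈ g.lin, g.low p ≤ x.2 → x.1 ∈ r.vs p

/-- The simulation relation for a single thread. -/
def ABDLocalSim (pc : ABDPc) (q : ABDState Tid Id) (r : DRState Tid Id) (g : ABDGhost Tid)
    (p : Tid) : Prop :=
  match pc with
  | .main => r.pc p = .main
  | .rb => r.pc p = .rb ∧ NoUpdate q p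
  | .rq => r.pc p = .rl ∧ ReadInv r g p ∧ NoUpdate q p ∧ QueryInv q g p
  | .ru => r.pc p = .rl ∧ ReadInv r g p ∧ ∀ k x X, (q.ids p).getLast? = some k →
      q.msgs (.update p k x) = some X → q.arg p = x.1 ∧ g.low p ≤ x.2
  | .re => r.pc p = .re ∧ r.arg p = q.arg p
  | .wb => r.pc p = .wb ∧ r.arg p = q.arg p ∧ NoUpdate q p
  | .wq => r.pc p = .ww ∧ r.arg p = q.arg p ∧ NoUpdate q p ∧ QueryInv q g p ∧ StartInv r g p ∧
      ∀ x ∈ g.lin, (ofLex x.2).2 = p → x.2 ≤ g.low p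
  | .wu => (ofLex (g.wr p).2).2 = p ∧ (∀ k x X, (q.ids p).getLast? = some k →
      q.msgs (.update p k x) = some X → x = g.wr p) ∧
      ((g.wr p ∈ g.lin ∧ r.pc p = .we) ∨
        ((∀ x ∈ g.lin, x.2 ≠ (g.wr p).2) ∧ r.pc p = .ww ∧ r.arg p = (g.wr p).1 ∧
          StartInv r g p ∧ g.low p < (g.wr p).2))
  | .we => r.pc p = .we

/-- The simulation relation. -/
structure ABDSim (q : ABDState Tid Id) (r : DRState Tid Id) (g : ABDGhost Tid) : Prop where
  lock : r.lock = false
  ids : r.ids = q.ids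
  top_mem : (r.val, g.top) ∈ g.lin
  le_top : ∀ x ∈ g.lin, x.2 ≤ g.top
  quorum : Nonempty Tid → Quorum Tid {s | g.top ≤ (q.tval s).2}
  unique : ∀ x ∈ g.lin, ∀ y ∈ g.lin, x.2 = y.2 → x = y
  tval : ∀ s, Avail q g (q.tval s)
  reply_avail : ∀ p k X s x, q.msgs (.query p k) = some X → Ack.reply s x ∈ X → Avail q g x
  update_avail : ∀ p k x X, q.msgs (.update p k x) = some X → Avail q g x
  ack : ∀ p k x X, q.msgs (.update p k x) = some X → ∀ a ∈ X, ∃ s, a = .ack s ∧ x.2 ≤ (q.tval s).2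
  dom_query : ∀ p k X, q.msgs (.query p k) = some X → k ∈ q.ids p
  dom_update : ∀ p k x X, q.msgs (.update p k x) = some X → k ∈ q.ids p
  loc : ∀ p, ABDLocalSim (q.pc p) q r g p

/-- What other threads and servers do to a thread: stored timestamps grow, its queries gain replies
with currently stored values, and it gains no update message. -/
theorem ABDLocalSim.mono {pc : ABDPc} {q q' : ABDState Tid Id} {r r' : DRState Tid Id}
    {g g' : ABDGhost Tid} {p : Tid} (H : ABDLocalSim pc q r g p)
    (hq : q'.ids p = q.ids p ∧ q'.arg p = q.arg p)
    (hr : r'.ver = r.ver ∧ r'.pc p = r.pc p ∧ r'.arg p = r.arg p ∧ r'.start p = r.start p ∧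
      r'.vs p = r.vs p)
    (hg : g'.top = g.top ∧ g'.lin = g.lin ∧ g'.low p = g.low p ∧ g'.wr p = g.wr p)
    (htval : ∀ s, (q.tval s).2 ≤ (q'.tval s).2)
    (hquery : ∀ k X', q'.msgs (.query p k) = some X' → ∃ X, q.msgs (.query p k) = some X ∧
      ∀ s x, Ack.reply s x ∈ X' → Ack.reply s x ∈ X ∨ x = q.tval s)
    (hupdate : ∀ k x X', q'.msgs (.update p k x) = some X' →
      ∃ X, q.msgs (.update p k x) = some X) :
    ABDLocalSim pc q' r' g' p := by
  obtain ⟨hq₁, hq₂⟩ := hq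
  obtain ⟨hr₁, hr₂, hr₃, hr₄, hr₅⟩ := hr
  obtain ⟨hg₁, hg₂, hg₃, hg₄⟩ := hg
  have hno : NoUpdate q p → NoUpdate q' p := by
    intro h k x X hk hX
    obtain ⟨X', hX'⟩ := hupdate k x X hX
    exact h k x X' (hq₁ ▸ hk) hX'
  have hqi : QueryInv q g p → QueryInv q' g' p := by
    rintro ⟨G, h₁, h₂, h₃⟩
    refine ⟨G, h₁, fun s hs => hg₃ ▸ (h₂ s hs).trans (htval s), fun k X hk hX s hs x hx => ?_⟩
    obtain ⟨X', hX', h⟩ := hquery k X hX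
    rw [hg₃]
    rcases h s x hx with h | rfl
    · exact h₃ k X' (hq₁ ▸ hk) hX' s hs x h
    · exact h₂ s hs
  have hst : StartInv r g p → StartInv r' g' p := by
    simp only [StartInv, hr₁, hr₄, hg₁, hg₃, imp_self]
  have hrd : ReadInv r g p → ReadInv r' g' p := by
    rintro ⟨h₁, h₂⟩
    exact ⟨hst h₁, by simpa only [hg₂, hg₃, hr₅] using h₂⟩
  cases pc with
  | main | we => exact hr₂.trans H
  | rb => exact ⟨hr₂.trans H.1, hno H.2⟩
  | rq => exact ⟨hr₂.trans H.1, hrd H.2.1, hno H.2.2.1, hqi H.2.2.2⟩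
  | ru =>
    refine ⟨hr₂.trans H.1, hrd H.2.1, fun k x X hk hX => ?_⟩
    obtain ⟨X', hX'⟩ := hupdate k x X hX
    rw [hq₂, hg₃]
    exact H.2.2 k x X' (hq₁ ▸ hk) hX'
  | re => exact ⟨hr₂.trans H.1, (hr₃.trans H.2).trans hq₂.symm⟩
  | wb => exact ⟨hr₂.trans H.1, (hr₃.trans H.2.1).trans hq₂.symm, hno H.2.2⟩
  | wq =>
    obtain ⟨h₁, h₂, h₃, h₄, h₅, h₆⟩ := H
    exact ⟨hr₂.trans h₁, (hr₃.trans h₂).trans hq₂.symm, hno h₃, hqi h₄, hst h₅,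
      by rwa [hg₂, hg₃]⟩
  | wu =>
    obtain ⟨h₁, h₂, h₃⟩ := H
    refine ⟨by rwa [hg₄], fun k x X hk hX => ?_, ?_⟩
    · obtain ⟨X', hX'⟩ := hupdate k x X hX
      rw [hg₄]
      exact h₂ k x X' (hq₁ ▸ hk) hX'
    · rw [hg₂, hg₃, hg₄, hr₂, hr₃]
      exact h₃.imp_right fun h => ⟨h.1, h.2.1, h.2.2.1, hst h.2.2.2.1, h.2.2.2.2⟩

/-- Preservation of the simulation relation by steps that linearize no write. -/
theorem ABDSim.step {q q' : ABDState Tid Id} {r r' : DRState Tid Id} {g g' : ABDGhost Tid}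
    (H : ABDSim q r g) (p : Tid)
    (hr : r'.val = r.val ∧ r'.ver = r.ver ∧ r'.lock = r.lock ∧ r'.ids = q'.ids)
    (hg : g'.top = g.top ∧ g'.lin = g.lin)
    (hne : ∀ p', p' ≠ p → (q'.ids p' = q.ids p' ∧ q'.arg p' = q.arg p' ∧ q'.pc p' = q.pc p') ∧
      (r'.pc p' = r.pc p' ∧ r'.arg p' = r.arg p' ∧ r'.start p' = r.start p' ∧
        r'.vs p' = r.vs p') ∧ g'.low p' = g.low p' ∧ g'.wr p' = g.wr p')
    (hids : ∀ k ∈ q.ids p, k ∈ q'.ids p)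
    (hwu : q.pc p = .wu → g.wr p ∈ g.lin ∨ (q'.pc p = .wu ∧ g'.wr p = g.wr p))
    (htval : ∀ s, q'.tval s = q.tval s ∨
      ((q.tval s).2 ≤ (q'.tval s).2 ∧ Avail q g (q'.tval s)))
    (hquery : ∀ p' k X', q'.msgs (.query p' k) = some X' →
      (∃ X, q.msgs (.query p' k) = some X ∧
        ∀ s x, Ack.reply s x ∈ X' → Ack.reply s x ∈ X ∨ x = q.tval s) ∨
      (p' = p ∧ k ∈ q'.ids p ∧ X' = ∅))
    (hupdate : ∀ p' k x X', q'.msgs (.update p' k x) = some X' →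
      (∃ X, q.msgs (.update p' k x) = some X ∧
        ∀ a ∈ X', a ∈ X ∨ ∃ s, a = .ack s ∧ x.2 ≤ (q'.tval s).2) ∨
      (p' = p ∧ k ∈ q'.ids p ∧ X' = ∅ ∧ Avail q' g' x))
    (hloc : ABDLocalSim (q'.pc p) q' r' g' p) : ABDSim q' r' g' := by
  obtain ⟨hr₁, hr₂, hr₃, hr₄⟩ := hr
  obtain ⟨hg₁, hg₂⟩ := hg
  have hav : ∀ {x}, Avail q g x → Avail q' g' x := by
    rintro x (hx | ⟨p', hp', rfl⟩)
    · exact .inl (hg₂ ▸ hx)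
    · by_cases he : p' = p
      · subst he
        rcases hwu hp' with h | ⟨h₁, h₂⟩
        · exact .inl (hg₂ ▸ h)
        · exact .inr ⟨p', h₁, h₂⟩
      · obtain ⟨⟨-, -, h₁⟩, -, -, h₂⟩ := hne p' he
        exact .inr ⟨p', h₁.trans hp', h₂⟩
  have hmono : ∀ s, (q.tval s).2 ≤ (q'.tval s).2 := by
    intro s
    rcases htval s with h | h
    · rw [h]
    · exact h.1
  have hids' : ∀ p', ∀ k ∈ q.ids p', k ∈ q'.ids p' := by
    intro p' k hk
    by_cases he : p' = p
    · exact he ▸ hids k (he ▸ hk)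
    · rwa [(hne p' he).1.1]
  constructor
  case lock => exact hr₃.trans H.lock
  case ids => exact hr₄
  case top_mem => rw [hr₁, hg₁, hg₂]; exact H.top_mem
  case le_top => rw [hg₁, hg₂]; exact H.le_top
  case quorum => exact fun h => (H.quorum h).mono fun s hs => hg₁ ▸ le_trans hs (hmono s)
  case unique => rw [hg₂]; exact H.unique
  case tval =>
    intro s
    rcases htval s with h | h
    · rw [h]
      exact hav (H.tval s)
    · exact hav h.2
  case reply_avail =>
    intro p' k X' s x hX' hx
    rcases hquery p' k X' hX' with ⟨X, hX, h⟩ | ⟨-, -, rfl⟩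
    · rcases h s x hx with h | rfl
      · exact hav (H.reply_avail p' k X s x hX h)
      · exact hav (H.tval s)
    · exact absurd hx (Set.notMem_empty _)
  case update_avail =>
    intro p' k x X' hX'
    rcases hupdate p' k x X' hX' with ⟨X, hX, -⟩ | ⟨-, -, -, h⟩
    · exact hav (H.update_avail p' k x X hX)
    · exact h
  case ack =>
    intro p' k x X' hX' a ha
    rcases hupdate p' k x X' hX' with ⟨X, hX, h⟩ | ⟨-, -, rfl, -⟩
    · rcases h a ha with h | h
      · obtain ⟨s, hs, hle⟩ := H.ack p' k x X hX a h
        exact ⟨s, hs, hle.trans (hmono s)⟩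
      · exact h
    · exact absurd ha (Set.notMem_empty _)
  case dom_query =>
    intro p' k X' hX'
    rcases hquery p' k X' hX' with ⟨X, hX, -⟩ | ⟨rfl, h, -⟩
    · exact hids' p' k (H.dom_query p' k X hX)
    · exact h
  case dom_update =>
    intro p' k x X' hX'
    rcases hupdate p' k x X' hX' with ⟨X, hX, -⟩ | ⟨rfl, h, -⟩
    · exact hids' p' k (H.dom_update p' k x X hX)
    · exact h
  case loc =>
    intro p'
    by_cases he : p' = p
    · exact he ▸ hloc
    · obtain ⟨⟨h₁, h₂, h₃⟩, h₄, h₅⟩ := hne p' he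
      rw [h₃]
      refine (H.loc p').mono ⟨h₁, h₂⟩ ⟨hr₂, h₄⟩ ⟨hg₁, hg₂, h₅⟩ hmono (fun k X' hX' => ?_)
        fun k x X' hX' => ?_
      · exact (hquery p' k X' hX').resolve_right fun h => he h.1
      · obtain ⟨X, hX, -⟩ := (hupdate p' k x X' hX').resolve_right fun h => he h.1
        exact ⟨X, hX⟩

/-- The effect of linearizing the write of the timestamped value `x` by the thread `w`. -/
theorem ABDSim.insert_lin {q : ABDState Tid Id} {r r' : DRState Tid Id} {g : ABDGhost Tid}
    (H : ABDSim q r g) {w : Tid} (hw : q.pc w = .wu) (hx : g.wr w ∉ g.lin) {c : TS Tid}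
    (hq : Quorum Tid {s | c ≤ (q.tval s).2})
    (hc : (g.top < (g.wr w).2 ∧ c = (g.wr w).2 ∧ r'.val = (g.wr w).1 ∧ r'.ver = r.ver + 1) ∨
      ((g.wr w).2 ≤ g.top ∧ c = g.top ∧ r'.val = r.val ∧ r'.ver = r.ver))
    (hlock : r'.lock = false) (hids : r'.ids = r.ids) (hstart : r'.start = r.start)
    (hpcw : r'.pc w = .we)
    (hpc : ∀ p, p ≠ w → r'.pc p = r.pc p ∧ r'.arg p = r.arg p)
    (hvs : ∀ p, r.vs p ⊆ r'.vs p)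
    (hvs' : ∀ p, r.pc p = .rl → StartInv r g p → g.low p ≤ (g.wr w).2 → (g.wr w).1 ∈ r'.vs p) :
    ABDSim q r' { g with top := c, lin := insert (g.wr w) g.lin } := by
  have hlw := H.loc w
  rw [hw] at hlw
  obtain ⟨hw₁, hw₂, hw₃⟩ := hlw
  obtain ⟨hfresh, hw₄⟩ := hw₃.resolve_left fun h => hx h.1
  have hst : ∀ p, StartInv r g p →
      StartInv r' { g with top := c, lin := insert (g.wr w) g.lin } p := by
    rintro p ⟨h₁, h₂⟩
    simp only [StartInv, hstart]
    rcases hc with ⟨-, -, -, hv⟩ | ⟨-, rfl, -, hv⟩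
    -- A write on top raises the version by one, so every `start` is strictly below it.
    · omega
    · rw [hv]
      exact ⟨h₁, h₂⟩
  have hrd : ∀ p, r.pc p = .rl → ReadInv r g p →
      ReadInv r' { g with top := c, lin := insert (g.wr w) g.lin } p := by
    rintro p hp ⟨h₁, h₂⟩
    refine ⟨hst p h₁, ?_⟩
    rintro x (rfl | hx') hlow
    · exact hvs' p hp h₁ hlow
    · exact hvs p (h₂ x hx' hlow)
  have hav : ∀ {x}, Avail q g x →
      Avail q { g with top := c, lin := insert (g.wr w) g.lin } x :=
    fun h => h.imp_left (Set.mem_insert_of_mem _)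
  constructor
  case lock => exact hlock
  case ids => exact hids.trans H.ids
  case top_mem =>
    rcases hc with ⟨-, rfl, hv, -⟩ | ⟨-, rfl, hv, -⟩
    · rw [hv]
      exact Set.mem_insert _ _
    · rw [hv]
      exact Set.mem_insert_of_mem _ H.top_mem
  case le_top =>
    rintro x (rfl | hx')
    · rcases hc with ⟨-, rfl, -⟩ | ⟨h, rfl, -⟩
      · exact le_rfl
      · exact h
    · refine (H.le_top x hx').trans ?_
      rcases hc with ⟨h, rfl, -⟩ | ⟨h, rfl, -⟩
      · exact h.le
      · exact le_rfl
  case quorum => exact fun _ => hq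
  case unique =>
    rintro x (rfl | hx') y (rfl | hy') hxy
    · rfl
    · exact absurd hxy.symm (hfresh y hy')
    · exact absurd hxy (hfresh x hx')
    · exact H.unique x hx' y hy' hxy
  case tval => exact fun s => hav (H.tval s)
  case reply_avail => exact fun p k X s x h₁ h₂ => hav (H.reply_avail p k X s x h₁ h₂)
  case update_avail => exact fun p k x X h => hav (H.update_avail p k x X h)
  case ack => exact H.ack
  case dom_query => exact H.dom_query
  case dom_update => exact H.dom_update
  case loc =>
    intro p
    by_cases hp : p = w
    · subst hp
      rw [hw]
      exact ⟨hw₁, hw₂, .inl ⟨Set.mem_insert _ _, hpcw⟩⟩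
    · obtain ⟨hp₁, hp₂⟩ := hpc p hp
      have hl := H.loc p
      -- Timestamps carry their writer, so the newly linearized one cannot clash with one of `p`.
      have hne : (ofLex (g.wr w).2).2 ≠ p := by
        rw [hw₁]
        exact fun h => hp (WithBot.coe_injective h).symm
      generalize q.pc p = pc at hl
      cases pc with
      | main | we => exact hp₁.trans hl
      | rb => exact ⟨hp₁.trans hl.1, hl.2⟩
      | rq => exact ⟨hp₁.trans hl.1, hrd p hl.1 hl.2.1, hl.2.2⟩
      | ru => exact ⟨hp₁.trans hl.1, hrd p hl.1 hl.2.1, hl.2.2⟩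
      | re => exact ⟨hp₁.trans hl.1, hp₂.trans hl.2⟩
      | wb => exact ⟨hp₁.trans hl.1, hp₂.trans hl.2.1, hl.2.2⟩
      | wq =>
        obtain ⟨h₁, h₂, h₃, h₄, h₅, h₆⟩ := hl
        refine ⟨hp₁.trans h₁, hp₂.trans h₂, h₃, h₄, hst p h₅, ?_⟩
        rintro x (rfl | hx') hxp
        · exact absurd hxp hne
        · exact h₆ x hx' hxp
      | wu =>
        obtain ⟨h₁, h₂, h₃⟩ := hl
        refine ⟨h₁, h₂, ?_⟩
        rcases h₃ with ⟨h₃, h₄⟩ | ⟨h₃, h₄, h₅, h₆, h₇⟩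
        · exact .inl ⟨Set.mem_insert_of_mem _ h₃, hp₁.trans h₄⟩
        · refine .inr ⟨?_, hp₁.trans h₄, hp₂.trans h₅, hst p h₆, h₇⟩
          rintro x (rfl | hx')
          · intro he
            rw [he] at hne
            exact hne h₁
          · exact h₃ x hx'

/-- `DR` can linearize the write of a timestamped value that is stored by a quorum. -/
theorem ABDSim.exists_linearize {q : ABDState Tid Id} {r : DRState Tid Id} {g : ABDGhost Tid}
    (H : ABDSim q r g) {x : ℕ × TS Tid} (hx : Avail q g x)
    (hq : Quorum Tid {s | x.2 ≤ (q.tval s).2}) :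
    ∃ r' ρ g', (DR Tid Id).Steps r ρ r' ∧ ρ.filterMap Sum.getLeft? = [] ∧ ABDSim q r' g' ∧
      x ∈ g'.lin ∧ g'.low = g.low ∧ g'.wr = g.wr := by
  by_cases hxl : x ∈ g.lin
  · exact ⟨r, [], g, .nil _, rfl, H, hxl, rfl, rfl⟩
  obtain ⟨w, hw, rfl⟩ := hx.resolve_left hxl
  have hlw := H.loc w
  rw [hw] at hlw
  obtain ⟨hfresh, hpcw, hargw, hstw, hloww⟩ := hlw.2.2.resolve_left fun h => hxl h.1
  -- A new largest timestamp goes on top; any other is inserted below the top write by a rollback.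
  rcases lt_or_gt_of_ne (hfresh _ H.top_mem) with hlt | hgt
  · obtain ⟨vs, ρ, hρ₁, hρ₂, hvs, hvs'⟩ := DR_collect
      { r with val := r.arg w, ver := r.ver + 1, pc := Function.update r.pc w .we }
    refine ⟨_, _, _, .cons (DRStep.writeTop r w hpcw H.lock) hρ₁, by simpa using hρ₂,
      H.insert_lin hw hxl hq (.inl ⟨hlt, rfl, hargw, rfl⟩) H.lock rfl rfl
        (Function.update_self _ _ _) (fun p hp => ⟨Function.update_of_ne hp _ _, rfl⟩) hvs ?_,
      Set.mem_insert _ _, rfl, rfl⟩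
    intro p hp hs _
    have hpw : p ≠ w := by
      rintro rfl
      rw [hp] at hpcw
      cases hpcw
    have := hvs' p (by simpa [Function.update_of_ne hpw] using hp) (by have := hs.1; simp; omega)
    exact hargw ▸ this
  -- Since `low w` is below the new timestamp, which is below `top`, some write went on top after
  -- `w` started, and the rollback is enabled.
  · have hver := hstw.2 (hloww.trans hgt)
    -- Reads collect between the rollback and the roll-forward, the only moment at which the
    -- register stores the value of `w`.
    obtain ⟨vs, ρ, hρ₁, hρ₂, hvs, hvs'⟩ := DR_collect
      { r with
        val := r.arg w, ver := r.ver - 1, lock := true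
        pc := Function.update r.pc w .wr, arg := Function.update r.arg w r.val }
    refine ⟨_, _, _, .cons (DRStep.writeRollBack r w hpcw hver H.lock)
      (hρ₁.trans (DRStep.steps (DRStep.writeRollForward _ w (Function.update_self _ _ _) rfl))),
      by simpa using hρ₂, H.insert_lin hw hxl (H.quorum ⟨w⟩) (.inr ⟨hgt.le, rfl, ?_, ?_⟩) rfl rfl rfl
        (Function.update_self _ _ _) (fun p hp => ⟨?_, ?_⟩) hvs ?_, Set.mem_insert _ _, rfl, rfl⟩
    · simp
    · have : r.ver - 1 + 1 = r.ver := by omega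
      exact this
    · simp [Function.update_of_ne hp]
    · simp [Function.update_of_ne hp]
    · intro p hp hs hlow
      have hpw : p ≠ w := by
        rintro rfl
        rw [hp] at hpcw
        cases hpcw
      -- A read for which the new value is a candidate has `low p` below `top`, so its loop guard
      -- holds even for the decremented version.
      have := hs.2 (lt_of_le_of_lt hlow hgt)
      have := hvs' p (by simpa [Function.update_of_ne hpw] using hp) (by simp; omega)
      exact hargw ▸ this

/-- The initial value counts as linearized although no operation wrote it; its thread component `⊥`
excludes clashes with real writes. -/
theorem ABDSim.init : ABDSim (ABD Tid Id).init (DR Tid Id).init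
    ⟨toLex (0, ⊥), {(0, toLex (0, ⊥))}, fun _ => toLex (0, ⊥), fun _ => (0, toLex (0, ⊥))⟩ where
  lock := rfl
  ids := rfl
  top_mem := rfl
  le_top := by
    rintro x rfl
    exact le_rfl
  quorum := fun _ => quorum_univ.mono fun s _ => le_refl (toLex ((0, ⊥) : ℕ × WithBot Tid))
  unique := by
    rintro x rfl y rfl _
    rfl
  tval := fun _ => .inl rfl
  reply_avail := fun _ _ _ _ _ h => by cases h
  update_avail := fun _ _ _ _ h => by cases h
  ack := fun _ _ _ _ h => by cases h
  dom_query := fun _ _ _ h => by cases h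
  dom_update := fun _ _ _ _ h => by cases h
  loc := fun _ => rfl

/-- `DR` can answer a step of `ABD` that is labeled `a` and leads to `q'`. -/
def DRAnswers (q' : ABDState Tid Id) (r : DRState Tid Id) (a : RegLabel Tid Id) : Prop :=
  ∃ r' ρ g', (DR Tid Id).Steps r ρ r' ∧
    ρ.filterMap Sum.getLeft? = [a].filterMap Sum.getLeft? ∧ ABDSim q' r' g'

/-! ### The answers of `DR` to the steps of `ABD` -/

open Function

variable {q q' : ABDState Tid Id} {r : DRState Tid Id} {g : ABDGhost Tid}

/-- A server that acknowledged an update has stored its timestamp or a larger one ever since. -/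
theorem ABDSim.quorum_of_ack (H : ABDSim q r g) {p : Tid} {k : Id} {x : ℕ × TS Tid}
    {X : Set (Ack Tid)} (hX : q.msgs (.update p k x) = some X) (hc : Quorum Tid X) :
    Quorum Tid {s | x.2 ≤ (q.tval s).2} := by
  refine Quorum.of_image (f := Ack.ack) (hc.mono fun a ha => ?_)
  obtain ⟨s, rfl, hs⟩ := H.ack p k x X hX a ha
  exact ⟨s, hs, rfl⟩

theorem ABDSim.noUpdate_concat (H : ABDSim q r g) {p : Tid} {k : Id} (hk : k ∉ q.ids p)
    (hids : q'.ids p = q.ids p ++ [k]) (hm : q'.msgs = q.msgs) : NoUpdate q' p := by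
  intro k' x X hk' hX
  rw [hids, List.getLast?_concat, Option.some.injEq] at hk'
  rw [hm] at hX
  exact hk (hk' ▸ H.dom_update p k' x X hX)

theorem ABDSim.readInv (H : ABDSim q r g) {p : Tid} {k : Id} (hpc : q.pc p = .main)
    (hk : k ∉ q.ids p) :
    DRAnswers { q with ids := update q.ids p (q.ids p ++ [k]), pc := update q.pc p .rb } r
      (.inl (.inv .read none p k)) := by
  have hl := H.loc p
  rw [hpc] at hl
  refine ⟨_, _, g, (DRStep.readInv r p k hl (H.ids ▸ hk)).steps, rfl, ?_⟩
  refine H.step p ⟨rfl, rfl, rfl, by simp [H.ids]⟩ ⟨rfl, rfl⟩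
    (fun p' hp => by simp [update_of_ne hp]) (fun k hk => by simp [hk])
    (fun h => by rw [hpc] at h; cases h) (fun _ => .inl rfl)
    (fun p' k X hX => .inl ⟨X, hX, fun _ _ => .inl⟩)
    (fun p' k x X hX => .inl ⟨X, hX, fun _ => .inl⟩) ?_
  simp only [update_self]
  exact ⟨update_self _ _ _, H.noUpdate_concat hk (update_self _ _ _) rfl⟩

theorem ABDSim.writeInv (H : ABDSim q r g) {p : Tid} {k : Id} {n : ℕ} (hpc : q.pc p = .main)
    (hk : k ∉ q.ids p) :
    DRAnswers { q with ids := update q.ids p (q.ids p ++ [k]), pc := update q.pc p .wb,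
                       arg := update q.arg p n } r
      (.inl (.inv .write (some n) p k)) := by
  have hl := H.loc p
  rw [hpc] at hl
  refine ⟨_, _, g, (DRStep.writeInv r p k n hl (H.ids ▸ hk)).steps, rfl, ?_⟩
  refine H.step p ⟨rfl, rfl, rfl, by simp [H.ids]⟩ ⟨rfl, rfl⟩
    (fun p' hp => by simp [update_of_ne hp]) (fun k hk => by simp [hk])
    (fun h => by rw [hpc] at h; cases h) (fun _ => .inl rfl)
    (fun p' k X hX => .inl ⟨X, hX, fun _ _ => .inl⟩)
    (fun p' k x X hX => .inl ⟨X, hX, fun _ => .inl⟩) ?_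
  simp only [update_self]
  exact ⟨update_self _ _ _, by simp, H.noUpdate_concat hk (update_self _ _ _) rfl⟩

theorem ABDSim.readRes (H : ABDSim q r g) {p : Tid} {k : Id} (hpc : q.pc p = .re)
    (hk : (q.ids p).getLast? = some k) :
    DRAnswers { q with pc := update q.pc p .main, arg := update q.arg p 0 } r
      (.inl (.res .read (some (q.arg p)) p k)) := by
  have hl := H.loc p
  rw [hpc] at hl
  refine ⟨_, _, g, (DRStep.readRes r p k hl.1 (H.ids ▸ hk)).steps, by rw [hl.2], ?_⟩
  refine H.step p ⟨rfl, rfl, rfl, by simp [H.ids]⟩ ⟨rfl, rfl⟩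
    (fun p' hp => by simp [update_of_ne hp]) (fun k hk => hk)
    (fun h => by rw [hpc] at h; cases h) (fun _ => .inl rfl)
    (fun p' k X hX => .inl ⟨X, hX, fun _ _ => .inl⟩)
    (fun p' k x X hX => .inl ⟨X, hX, fun _ => .inl⟩) ?_
  simp only [update_self]
  exact update_self _ _ _

theorem ABDSim.writeRes (H : ABDSim q r g) {p : Tid} {k : Id} (hpc : q.pc p = .we)
    (hk : (q.ids p).getLast? = some k) :
    DRAnswers { q with pc := update q.pc p .main, arg := update q.arg p 0 } r
      (.inl (.res .write none p k)) := by
  have hl := H.loc p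
  rw [hpc] at hl
  refine ⟨_, _, g, (DRStep.writeRes r p k hl (H.ids ▸ hk)).steps, rfl, ?_⟩
  refine H.step p ⟨rfl, rfl, rfl, by simp [H.ids]⟩ ⟨rfl, rfl⟩
    (fun p' hp => by simp [update_of_ne hp]) (fun k hk => hk)
    (fun h => by rw [hpc] at h; cases h) (fun _ => .inl rfl)
    (fun p' k X hX => .inl ⟨X, hX, fun _ _ => .inl⟩)
    (fun p' k x X hX => .inl ⟨X, hX, fun _ => .inl⟩) ?_
  simp only [update_self]
  exact update_self _ _ _

/-- The invariant of a query holds when the query is sent. -/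
theorem ABDSim.queryInv (H : ABDSim q r g) {p : Tid} {k : Id} {g' : ABDGhost Tid}
    (hk : (q.ids p).getLast? = some k) (hlow : g'.low p = g.top) (hids : q'.ids p = q.ids p)
    (htval : q'.tval = q.tval) (hm : q'.msgs (.query p k) = some ∅) : QueryInv q' g' p := by
  refine ⟨_, H.quorum ⟨p⟩, fun s hs => ?_, fun k' X hk' hX s _ x hx => ?_⟩
  · rw [hlow, htval]
    exact hs
  · obtain rfl : k = k' := by
      rw [hids, hk] at hk'
      exact Option.some.inj hk'
    rw [hm] at hX
    rw [← Option.some.inj hX] at hx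
    exact absurd hx (Set.notMem_empty _)

open Classical in
theorem ABDSim.readQuery (H : ABDSim q r g) {p : Tid} {k : Id} (hpc : q.pc p = .rb)
    (hk : (q.ids p).getLast? = some k) :
    DRAnswers { q with msgs := update q.msgs (.query p k) (some ∅), pc := update q.pc p .rq } r
      (.inr p) := by
  have hl := H.loc p
  rw [hpc] at hl
  -- The operation starts in `DR` when the query is sent, so that `low` and `start` are recorded at
  -- the same moment.
  refine ⟨_, _, { g with low := update g.low p g.top }, (DRStep.readInit r p hl.1 H.lock).steps,
    rfl, ?_⟩
  refine H.step p ⟨rfl, rfl, rfl, H.ids⟩ ⟨rfl, rfl⟩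
    (fun p' hp => by simp [update_of_ne hp]) (fun k hk => hk)
    (fun h => by rw [hpc] at h; cases h) (fun _ => .inl rfl)
    (fun p' k' X hX => ?_)
    (fun p' k x X hX => .inl ⟨X, by simpa using hX, fun _ => .inl⟩) ?_
  · by_cases h : Msg.query p' k' = Msg.query p k
    · obtain ⟨rfl, rfl⟩ := Msg.query.inj h
      simp only [update_self, Option.some.injEq] at hX
      exact .inr ⟨rfl, List.mem_of_getLast? hk, hX.symm⟩
    · simp only [update_of_ne h] at hX
      exact .inl ⟨X, hX, fun _ _ => .inl⟩
  · simp only [update_self]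
    refine ⟨update_self _ _ _, ⟨⟨?_, ?_⟩, ?_⟩, ?_, H.queryInv hk (update_self _ _ _) rfl rfl
      (by simp only [update_self])⟩
    · simp
    · simp
    · intro x hx hle
      simp only [update_self] at hle ⊢
      -- At this moment the only candidate is the top value, which is the one just collected.
      rw [H.unique x hx _ H.top_mem (le_antisymm (H.le_top x hx) hle)]
      rfl
    · intro k' x X hk' hX
      exact hl.2 k' x X hk' (by simpa using hX)

open Classical in
theorem ABDSim.writeQuery (H : ABDSim q r g) {p : Tid} {k : Id} (hpc : q.pc p = .wb)
    (hk : (q.ids p).getLast? = some k) :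
    DRAnswers { q with msgs := update q.msgs (.query p k) (some ∅), pc := update q.pc p .wq } r
      (.inr p) := by
  have hl := H.loc p
  rw [hpc] at hl
  refine ⟨_, _, { g with low := update g.low p g.top }, (DRStep.writeInit r p hl.1 H.lock).steps,
    rfl, ?_⟩
  refine H.step p ⟨rfl, rfl, rfl, H.ids⟩ ⟨rfl, rfl⟩
    (fun p' hp => by simp [update_of_ne hp]) (fun k hk => hk)
    (fun h => by rw [hpc] at h; cases h) (fun _ => .inl rfl)
    (fun p' k' X hX => ?_)
    (fun p' k x X hX => .inl ⟨X, by simpa using hX, fun _ => .inl⟩) ?_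
  · by_cases h : Msg.query p' k' = Msg.query p k
    · obtain ⟨rfl, rfl⟩ := Msg.query.inj h
      simp only [update_self, Option.some.injEq] at hX
      exact .inr ⟨rfl, List.mem_of_getLast? hk, hX.symm⟩
    · simp only [update_of_ne h] at hX
      exact .inl ⟨X, hX, fun _ _ => .inl⟩
  · simp only [update_self]
    refine ⟨update_self _ _ _, hl.2.1, ?_, H.queryInv hk (update_self _ _ _) rfl rfl
      (by simp only [update_self]), ⟨?_, ?_⟩, ?_⟩
    · intro k' x X hk' hX
      exact hl.2.2 k' x X hk' (by simpa using hX)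
    · simp
    · simp
    · intro x hx _
      simp only [update_self]
      exact H.le_top x hx

/-- A quorum of replies to a query contains a timestamp that is at least as large as all those that
were linearized before the query. -/
theorem QueryInv.exists_reply {p : Tid} {k : Id} {X : Set (Ack Tid)} {Q : Set Tid}
    (h : QueryInv q g p) (hk : (q.ids p).getLast? = some k) (hX : q.msgs (.query p k) = some X)
    (hQ : Q ⊆ {p' | ∃ vt', Ack.reply p' vt' ∈ X}) (hcard : Quorum Tid Q) :
    ∃ x ∈ replies X Q, g.low p ≤ x.2 := by
  obtain ⟨G, hG, -, h₃⟩ := h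
  obtain ⟨s, hsQ, hsG⟩ := hcard.inter hG
  obtain ⟨x, hx⟩ := hQ hsQ
  exact ⟨x, ⟨s, hsQ, hx⟩, h₃ k X hk hX s hsG x hx⟩

open Classical in
-- `DR` waits: the value is chosen but its write may not be linearized yet. Quorum intersection
-- bounds its timestamp below by `low p`.
theorem ABDSim.readUpdate (H : ABDSim q r g) {p : Tid} {k : Id} {X : Set (Ack Tid)} {Q : Set Tid}
    {vt : ℕ × TS Tid} (hpc : q.pc p = .rq) (hk : (q.ids p).getLast? = some k)
    (hX : q.msgs (.query p k) = some X) (hQ : Q ⊆ {p' | ∃ vt', Ack.reply p' vt' ∈ X})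
    (hcard : Quorum Tid Q) (hmem : vt ∈ replies X Q) (hmax : ∀ vt' ∈ replies X Q, vt'.2 ≤ vt.2) :
    DRAnswers { q with msgs := update q.msgs (.update p k vt) (some ∅), pc := update q.pc p .ru,
                       arg := update q.arg p vt.1 } r (.inr p) := by
  have hl := H.loc p
  rw [hpc] at hl
  obtain ⟨hl₁, hl₂, hl₃, hl₄⟩ := hl
  obtain ⟨x, hx, hlow⟩ := hl₄.exists_reply hk hX hQ hcard
  refine ⟨r, [], g, .nil _, rfl, ?_⟩
  refine H.step p ⟨rfl, rfl, rfl, H.ids⟩ ⟨rfl, rfl⟩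
    (fun p' hp => by simp [update_of_ne hp]) (fun k hk => hk)
    (fun h => by rw [hpc] at h; cases h) (fun _ => .inl rfl)
    (fun p' k' X hX => .inl ⟨X, by simpa using hX, fun _ _ => .inl⟩)
    (fun p' k' x X' hX' => ?_) ?_
  · by_cases h : Msg.update p' k' x = Msg.update p k vt
    · obtain ⟨rfl, rfl, rfl⟩ := Msg.update.inj h
      simp only [update_self, Option.some.injEq] at hX'
      obtain ⟨s, -, hs⟩ := hmem
      refine .inr ⟨rfl, List.mem_of_getLast? hk, hX'.symm,
        (H.reply_avail _ _ X s x hX hs).imp_right ?_⟩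
      rintro ⟨w, hw, rfl⟩
      refine ⟨w, ?_, rfl⟩
      have hne : w ≠ p' := by
        rintro rfl
        rw [hw] at hpc
        cases hpc
      simpa [update_of_ne hne] using hw
    · simp only [update_of_ne h] at hX'
      exact .inl ⟨X', hX', fun _ => .inl⟩
  · simp only [update_self]
    refine ⟨hl₁, hl₂, fun k' x' X' hk' hX' => ?_⟩
    by_cases h : Msg.update p k' x' = Msg.update p k vt
    · obtain ⟨-, -, rfl⟩ := Msg.update.inj h
      exact ⟨update_self _ _ _, hlow.trans (hmax x hx)⟩
    · simp only [update_of_ne h] at hX'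
      exact absurd hX' (hl₃ k' x' X' hk')

open Classical in
-- `DR` waits here too; the point is that the chosen timestamp exceeds `low p` and is new among the
-- linearized ones.
theorem ABDSim.writeUpdate (H : ABDSim q r g) {p : Tid} {k : Id} {X : Set (Ack Tid)} {Q : Set Tid}
    {t : ℕ} {b : WithBot Tid} (hpc : q.pc p = .wq) (hk : (q.ids p).getLast? = some k)
    (hX : q.msgs (.query p k) = some X) (hQ : Q ⊆ {p' | ∃ vt', Ack.reply p' vt' ∈ X})
    (hcard : Quorum Tid Q) (hmax : IsGreatest (Prod.snd '' replies X Q) (toLex (t, b))) :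
    DRAnswers { q with
                msgs := update q.msgs
                  (.update p k (q.arg p, toLex (t + 1, (p : WithBot Tid)))) (some ∅)
                pc := update q.pc p .wu } r (.inr p) := by
  have hl := H.loc p
  rw [hpc] at hl
  obtain ⟨hl₁, hl₂, hl₃, hl₄, hl₅, hl₆⟩ := hl
  obtain ⟨x, hx, hlow⟩ := hl₄.exists_reply hk hX hQ hcard
  have hlt : g.low p < toLex (t + 1, (p : WithBot Tid)) :=
    (hlow.trans (hmax.2 ⟨x, hx, rfl⟩)).trans_lt (Prod.Lex.toLex_lt_toLex.2 (.inl (Nat.lt_succ_self t)))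
  refine ⟨r, [], { g with wr := update g.wr p (q.arg p, toLex (t + 1, (p : WithBot Tid))) },
    .nil _, rfl, ?_⟩
  refine H.step p ⟨rfl, rfl, rfl, H.ids⟩ ⟨rfl, rfl⟩
    (fun p' hp => by simp [update_of_ne hp]) (fun k hk => hk)
    (fun h => by rw [hpc] at h; cases h) (fun _ => .inl rfl)
    (fun p' k' X hX => .inl ⟨X, by simpa using hX, fun _ _ => .inl⟩)
    (fun p' k' x X' hX' => ?_) ?_
  · by_cases h : Msg.update p' k' x =
        Msg.update p k (q.arg p, toLex (t + 1, (p : WithBot Tid)))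
    · obtain ⟨rfl, rfl, rfl⟩ := Msg.update.inj h
      simp only [update_self, Option.some.injEq] at hX'
      exact .inr ⟨rfl, List.mem_of_getLast? hk, hX'.symm,
        .inr ⟨p', update_self _ _ _, update_self _ _ _⟩⟩
    · simp only [update_of_ne h] at hX'
      exact .inl ⟨X', hX', fun _ => .inl⟩
  · simp only [update_self]
    simp only [ABDLocalSim, update_self]
    refine ⟨rfl, fun k' x' X' hk' hX' => ?_, .inr ⟨fun y hy he => ?_, hl₁, hl₂, hl₅, hlt⟩⟩
    · by_cases h : Msg.update p k' x' =
          Msg.update p k (q.arg p, toLex (t + 1, (p : WithBot Tid)))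
      · exact (Msg.update.inj h).2.2
      · rw [update_of_ne h] at hX'
        exact absurd hX' (hl₃ k' x' X' hk')
    -- A linearized value with this timestamp would be one of `p`, and those are all at most `low
    -- p`.
    · refine absurd (hl₆ y hy (by rw [he]; rfl)) ?_
      rw [he]
      exact not_le_of_gt hlt

/-- The value returned is stored by a quorum, so its write can be linearized now, possibly on behalf
of another thread; after that `ReadInv` says that the read has collected it. -/
theorem ABDSim.readEnd (H : ABDSim q r g) {p : Tid} {k : Id} {vt : ℕ × TS Tid}
    {X : Set (Ack Tid)} (hpc : q.pc p = .ru) (hk : (q.ids p).getLast? = some k)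
    (hX : q.msgs (.update p k vt) = some X) (hcard : Quorum Tid X) :
    DRAnswers { q with pc := update q.pc p .re } r (.inr p) := by
  obtain ⟨r', ρ, g', hρ₁, hρ₂, H', hx, -, -⟩ :=
    H.exists_linearize (H.update_avail p k vt X hX) (H.quorum_of_ack hX hcard)
  have hl := H'.loc p
  rw [hpc] at hl
  obtain ⟨hl₁, hl₂, hl₃⟩ := hl
  obtain ⟨harg, hlow⟩ := hl₃ k vt X hk hX
  refine ⟨_, _, g', hρ₁.trans (DRStep.readPick r' p vt.1 hl₁ (hl₂.2 vt hx hlow)).steps,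
    by simp [hρ₂], ?_⟩
  refine H'.step p ⟨rfl, rfl, rfl, H'.ids⟩ ⟨rfl, rfl⟩
    (fun p' hp => by simp [update_of_ne hp]) (fun k hk => hk)
    (fun h => by rw [hpc] at h; cases h) (fun _ => .inl rfl)
    (fun p' k X hX => .inl ⟨X, hX, fun _ _ => .inl⟩)
    (fun p' k x X hX => .inl ⟨X, hX, fun _ => .inl⟩) ?_
  simp only [update_self]
  exact ⟨update_self _ _ _, (update_self _ _ _).trans harg.symm⟩

theorem ABDSim.writeEnd (H : ABDSim q r g) {p : Tid} {k : Id} {vt : ℕ × TS Tid}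
    {X : Set (Ack Tid)} (hpc : q.pc p = .wu) (hk : (q.ids p).getLast? = some k)
    (hX : q.msgs (.update p k vt) = some X) (hcard : Quorum Tid X) :
    DRAnswers { q with pc := update q.pc p .we } r (.inr p) := by
  obtain ⟨r', ρ, g', hρ₁, hρ₂, H', hx, -, -⟩ :=
    H.exists_linearize (H.update_avail p k vt X hX) (H.quorum_of_ack hX hcard)
  have hl := H'.loc p
  rw [hpc] at hl
  obtain ⟨-, hl₂, hl₃⟩ := hl
  obtain rfl := hl₂ k vt X hk hX
  -- The write is linearized by now, perhaps long ago through a read, so its copy in `DR` stands at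
  -- `we`.
  have hl₄ := (hl₃.resolve_right fun h => h.1 _ hx rfl).2
  refine ⟨r', ρ, g', hρ₁, by simp [hρ₂], ?_⟩
  refine H'.step p ⟨rfl, rfl, rfl, H'.ids⟩ ⟨rfl, rfl⟩
    (fun p' hp => by simp [update_of_ne hp]) (fun k hk => hk)
    -- Leaving `wu` removes the second reason for the value to be available, but it has been
    -- linearized.
    (fun _ => .inl hx) (fun _ => .inl rfl)
    (fun p' k X hX => .inl ⟨X, hX, fun _ _ => .inl⟩)
    (fun p' k x X hX => .inl ⟨X, hX, fun _ => .inl⟩) ?_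
  simp only [update_self]
  exact hl₄

/-- Server steps, which change only messages and timestamped values, preserve the simulation
relation. -/
theorem ABDSim.server (H : ABDSim q r g) (p : Tid)
    (hq : q'.ids = q.ids ∧ q'.arg = q.arg ∧ q'.pc = q.pc)
    (htval : ∀ s, q'.tval s = q.tval s ∨
      ((q.tval s).2 ≤ (q'.tval s).2 ∧ Avail q g (q'.tval s)))
    (hquery : ∀ p' k X', q'.msgs (.query p' k) = some X' →
      ∃ X, q.msgs (.query p' k) = some X ∧
        ∀ s x, Ack.reply s x ∈ X' → Ack.reply s x ∈ X ∨ x = q.tval s)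
    (hupdate : ∀ p' k x X', q'.msgs (.update p' k x) = some X' →
      ∃ X, q.msgs (.update p' k x) = some X ∧
        ∀ a ∈ X', a ∈ X ∨ ∃ s, a = .ack s ∧ x.2 ≤ (q'.tval s).2) : ABDSim q' r g := by
  obtain ⟨h₁, h₂, h₃⟩ := hq
  refine H.step p ⟨rfl, rfl, rfl, H.ids.trans h₁.symm⟩ ⟨rfl, rfl⟩
    (fun p' _ => by simp [h₁, h₂, h₃]) (by simp [h₁]) (fun h => .inr ⟨by rw [h₃, h], rfl⟩) htval
    (fun p' k X' hX' => .inl (hquery p' k X' hX'))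
    (fun p' k x X' hX' => .inl (hupdate p' k x X' hX')) ?_
  rw [h₃]
  refine (H.loc p).mono ⟨by rw [h₁], by rw [h₂]⟩ ⟨rfl, rfl, rfl, rfl, rfl⟩ ⟨rfl, rfl, rfl, rfl⟩
    (fun s => ?_) (hquery p) (fun k x X' hX' => ?_)
  · rcases htval s with h | h
    · rw [h]
    · exact h.1
  · obtain ⟨X, hX, -⟩ := hupdate p k x X' hX'
    exact ⟨X, hX⟩

open Classical in
theorem ABDSim.serverQueryAck (H : ABDSim q r g) {p p' : Tid} {k : Id} {X : Set (Ack Tid)}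
    (hX : q.msgs (.query p' k) = some X) :
    ABDSim { q with msgs := update q.msgs (.query p' k) (some (X ∪ {Ack.reply p (q.tval p)})) }
      r g := by
  refine H.server p ⟨rfl, rfl, rfl⟩ (fun _ => .inl rfl) (fun p'' k' X' hX' => ?_)
    fun p'' k' x X' hX' => ⟨X', by simpa using hX', fun _ => .inl⟩
  by_cases h : Msg.query p'' k' = Msg.query p' k
  · obtain ⟨rfl, rfl⟩ := Msg.query.inj h
    simp only [update_self, Option.some.injEq] at hX'
    refine ⟨X, hX, fun s x hx => ?_⟩
    rw [← hX'] at hx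
    refine hx.imp_right fun hx => ?_
    obtain ⟨rfl, rfl⟩ := Ack.reply.inj hx
    rfl
  · simp only [update_of_ne h] at hX'
    exact ⟨X', hX', fun _ _ => .inl⟩

open Classical in
theorem ABDSim.serverUpdateAck (H : ABDSim q r g) {p p' : Tid} {k : Id} {vt : ℕ × TS Tid}
    {X : Set (Ack Tid)} (hX : q.msgs (.update p' k vt) = some X) :
    ABDSim { q with msgs := update q.msgs (.update p' k vt) (some (X ∪ {Ack.ack p}))
                    tval := update q.tval p (if (q.tval p).2 < vt.2 then vt else q.tval p) }
      r g := by
  have hle : vt.2 ≤ (if (q.tval p).2 < vt.2 then vt else q.tval p).2 := by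
    split_ifs with h
    · exact le_rfl
    · exact not_lt.1 h
  refine H.server p ⟨rfl, rfl, rfl⟩ (fun s => ?_)
    (fun p'' k' X' hX' => ⟨X', by simpa using hX', fun _ _ => .inl⟩) fun p'' k' x X' hX' => ?_
  · by_cases hs : s = p
    · subst hs
      simp only [update_self]
      split_ifs with h
      · exact .inr ⟨h.le, H.update_avail _ _ _ _ hX⟩
      · exact .inl rfl
    · exact .inl (update_of_ne hs _ _)
  · by_cases h : Msg.update p'' k' x = Msg.update p' k vt
    · obtain ⟨rfl, rfl, rfl⟩ := Msg.update.inj h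
      simp only [update_self, Option.some.injEq] at hX'
      refine ⟨X, hX, fun a ha => ?_⟩
      rw [← hX'] at ha
      refine ha.imp_right fun ha => ⟨p, ha, ?_⟩
      simpa only [update_self] using hle
    · simp only [update_of_ne h] at hX'
      exact ⟨X', hX', fun _ => .inl⟩

theorem ABDSim.answers (H : ABDSim q r g) {a : RegLabel Tid Id} (hs : ABDStep q a q') :
    DRAnswers q' r a := by
  cases hs with
  | readInv p k hpc hk => exact H.readInv hpc hk
  | readQuery p k hpc hk => exact H.readQuery hpc hk
  | readUpdate p k X Q vt hpc hk hX hQ hcard hmem hmax =>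
    exact H.readUpdate hpc hk hX hQ hcard hmem hmax
  | readEnd p k vt X hpc hk hX hcard => exact H.readEnd hpc hk hX hcard
  | readRes p k hpc hk => exact H.readRes hpc hk
  | writeInv p k n hpc hk => exact H.writeInv hpc hk
  | writeQuery p k hpc hk => exact H.writeQuery hpc hk
  | writeUpdate p k X Q t b hpc hk hX hQ hcard hmax =>
    exact H.writeUpdate hpc hk hX hQ hcard hmax
  | writeEnd p k vt X hpc hk hX hcard => exact H.writeEnd hpc hk hX hcard
  | writeRes p k hpc hk => exact H.writeRes hpc hk
  | serverQueryAck p p' k X hX hp => exact ⟨r, [], g, .nil _, rfl, H.serverQueryAck hX⟩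
  | serverUpdateAck p p' k vt X hX hp => exact ⟨r, [], g, .nil _, rfl, H.serverUpdateAck hX⟩

theorem ABD_simulates_DR : Simulates (ABD Tid Id) (DR Tid Id) IR := by
  refine ⟨fun q r => ∃ g, ABDSim q r g, ⟨_, ABDSim.init⟩, ?_⟩
  rintro q a q' r hs ⟨g, H⟩
  obtain ⟨r', ρ, g', h₁, h₂, h₃⟩ := H.answers hs
  exact ⟨r', ρ, h₁, by rw [restrict_IR, restrict_IR, h₂], g', h₃⟩

end ABDSimulation

end RegSpec

theorem mainTheorem3 (Tid : Type w) (Id : Type x) [Fintype Tid] [LinearOrder Tid] :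
    RegSpec.IsImplementation (RegSpec.ABD Tid Id) ∧
    RegSpec.IsImplementation (RegSpec.DR Tid Id) ∧
    RegSpec.Simulates (RegSpec.ABD Tid Id) (RegSpec.DR Tid Id) RegSpec.IR ∧
    RegSpec.DecisivelyLinearizable (RegSpec.ABD Tid Id) (RegSpec.regSpec Tid Id) ∧
    RegSpec.StronglyRefines.{u, v} (RegSpec.ABD Tid Id) (RegSpec.DR Tid Id) :=
  have hsim := RegSpec.ABD_simulates_DR
  have hlin := RegSpec.DR_decisivelyLinearizable
  ⟨.of_simulates hsim hlin.isImplementation, hlin.isImplementation, hsim,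
    .of_simulates hsim hlin, .of_simulates hsim⟩
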